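/- Let $\mathcal X,\mathcal Y$ be finite alphabets, let $W(y|x)$ be the transition probabilities of a discrete memoryless channel, let $P_X$ be a distribution on $\mathcal X$ that is a type (i.e. the type class $\mathcal T_{P_X}\subseteq\mathcal X^n$ of the vectors with empirical distribution $P_X$ is non-empty for some $n\ge 1$), let $R>0$ and $T\in\mathbb R$. Logarithms are natural. All joint distributions $Q,\tilde Q,Q'$ below are distributions on $\mathcal X\times\mathcal Y$ with $X$-marginal $P_X$. Write $I(Q)$ for the mutual information, $D(\tilde Q_{Y|X}\|W|P_X)$ for the conditional divergence, $[t]_+=\max\{t,0\}$ and $$f(Q)=\sum_{x,y}Q(x,y)\log W(y|x)\in[-\infty,0],\qquad 0\log 0=0 .$$ For each $n$ with $\mathcal T_{P_X}\neq\emptyset$ draw a codebook $\mathcal C=\{\mathbf x_1,\dots,\mathbf x_M\}$ of $M=\lceil e^{nR}\rceil$ codewords independently and uniformly from $\mathcal T_{P_X}\subseteq \mathcal X^n$. The decoder $\phi_T$ puts codeword $m$ on the list at output $\mathbf y$ iff $\mathbf y\in\mathcal R_m$, where $$\mathcal R_m=\Big\{\mathbf y: f(\hat Q_{\mathbf x_m\mathbf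 y})\ge T+\max_{l\ne m}f(\hat Q_{\mathbf x_l\mathbf y})\Big\}$$ and $\hat Q_{\mathbf x\mathbf y}$ is the joint empirical distribution. Let $$P_e(\mathcal C,\phi_T)=\frac1M\sum_m\sum_{\mathbf y\notin\mathcal R_m}P(\mathbf y|\mathbf x_m),\qquad L(\mathcal C,\phi_T)=\sum_{\mathbf y}\frac1M\sum_mP(\mathbf y|\mathbf x_m)\sum_{l\ne m}\mathbf 1\{\mathbf y\in\mathcal R_l\},$$ where $P(\mathbf y|\mathbf x)=\prod_iW(y_i|x_i)$, and let $E_e(R,T)=\liminf_n-\frac1n\log\overline{P_e(\mathcal C,\phi_T)}$ and $E_l(R,T)=\liminf_n-\frac1n\log\overline{L(\mathcal C,\phi_T)}$, where the overline is the average over the random codebook, $n$ runs through the block lengths with $\mathcal T_{P_X}\ne\emptyset$, and $\log0=-\infty$. A minimum over the empty set is $+\infty$. 1. If $T\neq\min\{f(\tilde Q)-f(Q): Q_Y=\tilde Q_Y,\ f(Q)>-\infty,\ f(\tilde Q)>-\infty\}$, then $$E_e(R,T)=\min_{\tilde Q}\ \min_{Q:\,Q_Y=\tilde Q_Y,\ f(Q)+T\ge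 f(\tilde Q)}\Big\{D(\tilde Q_{Y|X}\|W|P_X)+[I(Q)-R]_+\Big\}.$$ 2. If $W(y|x)>0$ for all $y$ and all $x$ with $P_X(x)>0$, then $$E_l(R,T)=\min_{\tilde Q}\ \min_{Q\in\underline{\mathcal D}(\tilde Q,R,T)}\Big\{D(\tilde Q_{Y|X}\|W|P_X)+I(Q)-R\Big\},$$ where $\underline{\mathcal D}(\tilde Q,R,T)=\{Q:Q_Y=\tilde Q_Y,\ f(Q)\ge T+\max\{\underline{\mathbf V}(Q_Y,R),f(\tilde Q)\}\}$ and $\underline{\mathbf V}(Q_Y,R)=\max_{Q':\,Q'_Y=Q_Y,\ I(Q')\le R}f(Q')$. In both cases the minimum is attained whenever it is over a non-empty set. -/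

import Mathlib

open Filter

noncomputable section

namespace ErasureList

variable {X Y A : Type*} [Fintype X] [Fintype Y] [Fintype A]
  [DecidableEq X] [DecidableEq Y] [DecidableEq A]

/-! ### Single-letter quantities -/

/-- The `X`-marginal of a joint distribution `Q`. -/
def margX (Q : X × Y → ℝ) : X → ℝ := fun x => ∑ y, Q (x, y)

/-- The `Y`-marginal of a joint distribution `Q`. -/
def margY (Q : X × Y → ℝ) : Y → ℝ := fun y => ∑ x, Q (x, y)

/-- The joint distributions on `X × Y` whose `X`-marginal is `P`. -/
def jointDists (Y : Type*) [Fintype Y] (P : X → ℝ) : Set (X × Y → ℝ) :=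
  {Q | Q ∈ stdSimplex ℝ (X × Y) ∧ margX Q = P}

open Classical in
/-- The normalized log-likelihood `f(Q) = ∑ Q(x,y) log W(y|x)`, with `0 log 0 = 0`; it is `-∞` if
`Q` charges a pair with `W(y|x) = 0`. -/
def logLik (W : X → Y → ℝ) (Q : X × Y → ℝ) : EReal :=
  if ∀ x y, W x y = 0 → Q (x, y) = 0 then
    ((∑ x, ∑ y, Q (x, y) * Real.log (W x y) : ℝ) : EReal)
  else ⊥

/-- The mutual information `I(Q)`, in nats. -/
def mutualInfo (Q : X × Y → ℝ) : ℝ :=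
  ∑ x, ∑ y, Q (x, y) * Real.log (Q (x, y) / (margX Q x * margY Q y))

open Classical in
/-- The conditional divergence `D(Q_{Y|X} ‖ W | Q_X)`, in nats; it is `+∞` if
`Q` charges a pair with `W(y|x) = 0`. -/
def condDiv (W : X → Y → ℝ) (Q : X × Y → ℝ) : EReal :=
  if ∀ x y, W x y = 0 → Q (x, y) = 0 then
    ((∑ x, margX Q x * ∑ y, (Q (x, y) / margX Q x) *
      Real.log ((Q (x, y) / margX Q x) / W x y) : ℝ) : EReal)
  else ⊤

/-- The maximum of `f(Q')` over the `Q'` with `X`-marginal `P`, `Y`-marginal `QY` and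
`I(Q') ≤ R`. -/
def maxLogLik (W : X → Y → ℝ) (P : X → ℝ) (QY : Y → ℝ) (R : ℝ) : EReal :=
  sSup {v | ∃ Q' ∈ jointDists Y P, margY Q' = QY ∧ mutualInfo Q' ≤ R ∧ v = logLik W Q'}

/-- The set of the joint distributions `Q` with the same `Y`-marginal as `Qt` and
`f(Q) ≥ T + max {V(Q_Y, R), f(Qt)}`, where `V` is `maxLogLik`. -/
def listSet (W : X → Y → ℝ) (P : X → ℝ) (R T : ℝ) (Qt : X × Y → ℝ) : Set (X × Y → ℝ) :=
  {Q | Q ∈ jointDists Y P ∧ margY Q = margY Qt ∧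
    (T : EReal) + max (maxLogLik W P (margY Q) R) (logLik W Qt) ≤ logLik W Q}

/-- The values of the objective in the minimization for the error exponent. -/
def errorValues (W : X → Y → ℝ) (P : X → ℝ) (R T : ℝ) : Set EReal :=
  {v | ∃ Qt ∈ jointDists Y P, ∃ Q ∈ jointDists Y P,
    margY Q = margY Qt ∧ logLik W Qt ≤ logLik W Q + (T : EReal) ∧
    v = condDiv W Qt + ((max (mutualInfo Q - R) 0 : ℝ) : EReal)}

/-- The values of the objective in the minimization for the list size exponent. -/
def listValues (W : X → Y → ℝ) (P : X → ℝ) (R T : ℝ) : Set EReal :=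
  {v | ∃ Qt ∈ jointDists Y P, ∃ Q ∈ listSet W P R T Qt,
    v = condDiv W Qt + ((mutualInfo Q - R : ℝ) : EReal)}

/-- The finite differences `f(Qt) - f(Q)` over the pairs with a common `Y`-marginal. -/
def logLikGaps (W : X → Y → ℝ) (P : X → ℝ) : Set ℝ :=
  {t | ∃ Qt ∈ jointDists Y P, ∃ Q ∈ jointDists Y P, margY Q = margY Qt ∧
    logLik W Q ≠ ⊥ ∧ logLik W Qt = logLik W Q + (t : EReal)}

/-- `v` is the minimum of `S`, with the convention that the minimum of the empty set is `+∞`. -/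
def IsMinOrTop (S : Set EReal) (v : EReal) : Prop := IsLeast (insert ⊤ S) v

/-! ### Channel, codes and decoders -/

/-- The empirical distribution of a vector. -/
def empDist {n : ℕ} (a : Fin n → A) : A → ℝ :=
  fun s => ((Finset.univ.filter (fun i => a i = s)).card : ℝ) / (n : ℝ)

/-- The joint empirical distribution of a pair of vectors. -/
def empJoint {n : ℕ} (x : Fin n → X) (y : Fin n → Y) : X × Y → ℝ :=
  empDist (fun i => (x i, y i))

open Classical in
/-- The type class of `P`: the vectors of length `n` whose empirical distribution is `P`. -/
def typeClass (P : X → ℝ) (n : ℕ) : Finset (Fin n → X) :=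
  Finset.univ.filter (fun x => empDist x = P)

/-- The probability of the output vector `y` of the memoryless channel given the input `x`. -/
def chanProb (W : X → Y → ℝ) {n : ℕ} (x : Fin n → X) (y : Fin n → Y) : ℝ :=
  ∏ i, W (x i) (y i)

open Classical in
/-- The average error probability of the erasure/list decoder with decoding regions `D m`:
the transmitted codeword is not on the list. -/
def errorProb (W : X → Y → ℝ) {n M : ℕ} (C : Fin M → Fin n → X)
    (D : Fin M → Set (Fin n → Y)) : ℝ :=
  (1 / (M : ℝ)) * ∑ m, ∑ y, if y ∈ D m then 0 else chanProb W (C m) y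

open Classical in
/-- The average number of erroneous codewords on the list. -/
def listSize (W : X → Y → ℝ) {n M : ℕ} (C : Fin M → Fin n → X)
    (D : Fin M → Set (Fin n → Y)) : ℝ :=
  ∑ y, (1 / (M : ℝ)) * ∑ m, chanProb W (C m) y *
    ∑ l ∈ Finset.univ.filter (fun l => l ≠ m), if y ∈ D l then 1 else 0

/-- The decoding regions of the decoder with parameter `T`: the codeword `m` is on the list iff
`f(x_m, y) ≥ T + max_{l ≠ m} f(x_l, y)`. -/
def decRegion (W : X → Y → ℝ) (T : ℝ) {n M : ℕ} (C : Fin M → Fin n → X) :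
    Fin M → Set (Fin n → Y) :=
  fun m => {y | (T : EReal) + ⨆ l ∈ {l | l ≠ m}, logLik W (empJoint (C l) y)
    ≤ logLik W (empJoint (C m) y)}

/-! ### Random coding exponents -/

/-- The expectation of `F` over random codebooks of `M` codewords drawn independently and
uniformly from the type class of `P` (so the codebook is uniform on the `M`-fold power). -/
def codeAvg (P : X → ℝ) (n M : ℕ) (F : (Fin M → Fin n → X) → ℝ) : ℝ :=
  (∑ C ∈ Fintype.piFinset (fun _ : Fin M => typeClass P n), F C) /
    ((typeClass P n).card : ℝ) ^ M

/-- The number `e^{nR}` of codewords, rounded up to an integer. -/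
def codeSize (R : ℝ) (n : ℕ) : ℕ := ⌈Real.exp ((n : ℝ) * R)⌉₊

/-- `liminf -(1/n) log (a n)`, where `n → ∞` through the block lengths at which the type class of
`P` is not empty, and `log 0 = -∞`. -/
def expRate (P : X → ℝ) (a : ℕ → ℝ) : EReal :=
  liminf (fun n : ℕ => ((-(1 / (n : ℝ)) : ℝ) : EReal) * ENNReal.log (ENNReal.ofReal (a n)))
    (atTop ⊓ 𝓟 {n : ℕ | (typeClass P n).Nonempty})

/-- The random coding error exponent of the decoder with parameter `T`. -/
def errorExponent (W : X → Y → ℝ) (P : X → ℝ) (R T : ℝ) : EReal :=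
  expRate P fun n => codeAvg P n (codeSize R n) fun C => errorProb W C (decRegion W T C)

/-- The random coding list size exponent of the decoder with parameter `T`. -/
def listExponent (W : X → Y → ℝ) (P : X → ℝ) (R T : ℝ) : EReal :=
  expRate P fun n => codeAvg P n (codeSize R n) fun C => listSize W C (decRegion W T C)

end ErasureList

end

/-! Both averages are computed exactly and then estimated by the method of types. Let M be the
number of codewords. Given the threshold set by a vector `x` at output `y`, an independent uniform
codeword respects it with probability `okFrac` = 1 - p. Hence the average error probability is the
mean over `x` of ∑_y P(y|x) (1 - (1-p)^(M-1)) (`codeAvg_errorProb`). In the list size one sums over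
the listed vector x' with f(x',y) ≥ T + f(x,y), with weight (1-p)^(M-2), where p now refers to x'
(`codeAvg_listSize`). Up to polynomial factors, the outputs of joint type Q̃ with `x` have
probability e^{-nD}, and a random codeword has joint type Q with `y` with probability e^{-nI(Q)}.

Error exponent. The quantity 1 - (1-p)^(M-1) lies between min(1,(M-1)p)/2 and min(1,(M-1)p), whence
[I(Q)-R]_+. A competitor causes an error iff f(Q)+T > f(Q̃), strictly. A limit of dominant pairs of
joint types satisfies the non-strict inequality, and by compactness it yields a pair whose value is
at most the exponent. Conversely, a strict pair is approximated by rational pairs, which are joint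
types at infinitely many lengths. A pair with equality is a limit of strict ones as soon as some
pair has f(Q̃)-f(Q) < T; only the minimal gap is excluded.

List exponent. The factor (1-p)^(M-2) acts as a switch. If a coupling with I < R exceeds the level
f(Q)-T, then Mp is exponentially large and the factor is doubly exponentially small, so limits of
dominant pairs are feasible (`exists_feasible_of_frequently`). For the converse a polynomial loss in
p is not affordable, because M enters as an exponent. `exists_card_exceed_le` gives p = O(e^{-nR})
exactly: change measure to the conditional law of the minimizer of I above the level
(`exists_tilted`). Under it the type class of P has probability O(n^{-(k-1)/2}), k being the support
size of P, and this cancels the polynomial factor in the size of the type class.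

Rational approximation uses ℚ-linear maps ℝ → ℚ fixing 1 and tending pointwise to the identity
(`exists_rat_linear_approx`): they preserve common marginals, zeros and the rational P. The
non-strict constraints of the list formula are not preserved. A feasible pair is therefore perturbed
to a strict one, or its approximants are shown feasible, by convexity of I and a reflection
(`listExponent_le_of_fst_strict`) or because optimality of a coupling depends only on its support
(`linLik_le_of_support`). -/

set_option linter.unusedSectionVars false

namespace ErasureList

open Finset

/-! ### Counting functions with prescribed fibers -/

section Counting

variable {ι A B : Type*} [Fintype ι] [Fintype A] [Fintype B]
  [DecidableEq A] [DecidableEq B]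

/-- The number of occurrences of `s` in the vector `a`. -/
def cnt (a : ι → A) (s : A) : ℕ := (univ.filter fun i => a i = s).card

lemma sum_cnt (a : ι → A) : ∑ s, cnt a s = Fintype.card ι := by
  have := Finset.card_eq_sum_card_fiberwise (f := a) (s := univ) (t := univ) (by simp)
  simpa [cnt] using this.symm

lemma sum_cnt_pair (a : ι → A) (b : ι → B) (s : A) :
    ∑ t, cnt (fun i => (a i, b i)) (s, t) = cnt a s := by
  have := Finset.card_eq_sum_card_fiberwise (f := b) (s := univ.filter fun i => a i = s)
    (t := univ) (by simp)
  simp only [cnt, this, Prod.mk.injEq, Finset.filter_filter]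

lemma exists_perm_comp_eq {a b : ι → A} (h : ∀ s, cnt a s = cnt b s) :
    ∃ σ : Equiv.Perm ι, a ∘ σ = b := by
  have e : ∀ s, {i // b i = s} ≃ {i // a i = s} := fun s => by
    refine Fintype.equivOfCardEq ?_
    rw [Fintype.card_subtype, Fintype.card_subtype]
    exact (h s).symm
  exact ⟨Equiv.ofFiberEquiv e, funext fun i => Equiv.ofFiberEquiv_map e i⟩

lemma cnt_comp_perm (a : ι → A) (σ : Equiv.Perm ι) (s : A) : cnt (a ∘ σ) s = cnt a s := by
  unfold cnt
  refine Finset.card_bij (fun i _ => σ i) (by simp) (by simp) ?_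
  intro i hi
  exact ⟨σ.symm i, by simpa using hi, by simp⟩

lemma card_perm_comp_eq [DecidableEq ι] (a : ι → A) :
    (univ.filter fun σ : Equiv.Perm ι => a ∘ σ = a).card = ∏ s, (cnt a s).factorial := by
  have := DomMulAct.stabilizer_card a
  rw [Fintype.card_subtype] at this
  rw [this]
  refine Finset.prod_congr rfl fun s _ => ?_
  rw [Fintype.card_subtype, cnt]

/-- The number of vectors `b` whose pairing with `a` has the same counts as that of `b₀`. -/
lemma card_same_joint_cnt_mul [DecidableEq ι] (a : ι → A) (b₀ : ι → B) :
    (univ.filter fun b : ι → B =>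
      ∀ s, cnt (fun i => (a i, b i)) s = cnt (fun i => (a i, b₀ i)) s).card *
      ∏ s, (cnt (fun i => (a i, b₀ i)) s).factorial = ∏ s, (cnt a s).factorial := by
  set T := univ.filter fun b : ι → B =>
      ∀ s, cnt (fun i => (a i, b i)) s = cnt (fun i => (a i, b₀ i)) s with hT
  have hmaps : ∀ σ ∈ univ.filter (fun σ : Equiv.Perm ι => a ∘ σ = a), b₀ ∘ σ ∈ T := by
    intro σ hσ
    simp only [mem_filter, mem_univ, true_and] at hσ
    simp only [hT, mem_filter, mem_univ, true_and]
    intro s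
    rw [← cnt_comp_perm (fun i => (a i, b₀ i)) σ s]
    congr 1
    funext i
    simp only [Function.comp]
    rw [← congrFun hσ i]
    rfl
  -- Orbit-stabilizer: the stabilizer of `a` maps to the set by `σ ↦ b₀ ∘ σ`, and each fiber is a
  -- translate of the stabilizer of the pair `(a, b₀)`.
  rw [← card_perm_comp_eq a, ← card_perm_comp_eq (fun i => (a i, b₀ i)),
    Finset.card_eq_sum_card_fiberwise hmaps, ← smul_eq_mul, ← Finset.sum_const]
  refine Finset.sum_congr rfl fun b hb => ?_
  simp only [hT, mem_filter, mem_univ, true_and] at hb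
  obtain ⟨τ, hτ⟩ := exists_perm_comp_eq (fun s => (hb s).symm)
  have h1 : ∀ i, a (τ i) = a i := fun i => congrArg Prod.fst (congrFun hτ i)
  have h2 : ∀ i, b₀ (τ i) = b i := fun i => congrArg Prod.snd (congrFun hτ i)
  refine Finset.card_bij (fun σ _ => σ * τ) ?_ ?_ ?_
  · intro σ hσ
    simp only [mem_filter, mem_univ, true_and] at hσ ⊢
    have e : ∀ i, a (σ i) = a i ∧ b₀ (σ i) = b₀ i := fun i => by
      simpa using congrFun hσ i
    constructor
    · funext i
      simp [(e (τ i)).1, h1]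
    · funext i
      simp [(e (τ i)).2, h2]
  · intro σ _ σ' _ h
    exact mul_right_cancel h
  · intro σ hσ
    simp only [mem_filter, mem_univ, true_and] at hσ
    refine ⟨σ * τ⁻¹, ?_, by simp⟩
    simp only [mem_filter, mem_univ, true_and]
    funext i
    have e1 := congrFun hσ.1 (τ⁻¹ i)
    have e2 := congrFun hσ.2 (τ⁻¹ i)
    have e3 := h1 (τ⁻¹ i)
    have e4 := h2 (τ⁻¹ i)
    have e5 : τ (τ⁻¹ i) = i := τ.apply_symm_apply i
    simp only [Function.comp] at e1 e2
    rw [e5] at e3 e4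
    simp only [Function.comp, Equiv.Perm.mul_apply]
    rw [e1, e2, ← e3, ← e4]

/-- Any matrix of counts compatible with the vector `a` is realized by some vector `b`. -/
lemma exists_joint_cnt (a : ι → A) (c : A × B → ℕ) (hc : ∀ s, ∑ t, c (s, t) = cnt a s) :
    ∃ b : ι → B, ∀ s, cnt (fun i => (a i, b i)) s = c s := by
  -- The disjoint union of `c p` points over each pair `p` has the same fibers over first letters as
  -- `a`. A bijection respecting these fibers supplies the second letters.
  have e : ∀ s, {i // a i = s} ≃ {j : Σ p : A × B, Fin (c p) // j.1.1 = s} := fun s => by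
    refine Fintype.equivOfCardEq ?_
    have hcard : Fintype.card {j : Σ p : A × B, Fin (c p) // j.1.1 = s} = ∑ t, c (s, t) := by
      have e' : {j : Σ p : A × B, Fin (c p) // j.1.1 = s} ≃ Σ t : B, Fin (c (s, t)) :=
        { toFun := fun j => ⟨j.1.1.2, (finCongr (by
            obtain ⟨⟨⟨x, y⟩, k⟩, h⟩ := j
            simp only at h
            subst h; rfl)) j.1.2⟩
          invFun := fun j => ⟨⟨(s, j.1), j.2⟩, rfl⟩
          left_inv := by
            rintro ⟨⟨⟨x, y⟩, k⟩, h⟩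
            simp only at h
            subst h; rfl
          right_inv := by rintro ⟨t, k⟩; rfl }
      rw [Fintype.card_congr e']; simp
    rw [Fintype.card_subtype, hcard, hc]; rfl
  let E := Equiv.ofFiberEquiv (f := a) (g := fun j : Σ p : A × B, Fin (c p) => j.1.1) e
  have hE : ∀ i, (E i).1.1 = a i := fun i => Equiv.ofFiberEquiv_map e i
  refine ⟨fun i => (E i).1.2, fun s => ?_⟩
  have : (fun i => (a i, (E i).1.2)) = fun i => (E i).1 := by
    funext i; rw [← hE i]
  rw [this, cnt]
  rw [← Fintype.card_subtype]
  have e2 : {i // (E i).1 = s} ≃ Fin (c s) :=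
    { toFun := fun i => finCongr (by rw [i.2]) (E i.1).2
      invFun := fun k => ⟨E.symm ⟨s, k⟩, by simp⟩
      left_inv := by
        rintro ⟨i, h⟩
        subst h
        simp
      right_inv := by
        intro k
        have key : ∀ (j : Σ p : A × B, Fin (c p)) (h : j = ⟨s, k⟩),
            ((finCongr (congrArg c (congrArg Sigma.fst h)) j.2 : Fin (c s)) = k) := by
          rintro j rfl
          rfl
        exact key _ (E.apply_symm_apply _) }
  rw [Fintype.card_congr e2, Fintype.card_fin]

end Counting

/-! ### Estimates for factorials and sizes of conditional type classes -/

lemma log_factorial_ge (c : ℕ) :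
    (c : ℝ) * Real.log c - c + Real.log c / 2 ≤ Real.log (c.factorial) := by
  rcases Nat.eq_zero_or_pos c with rfl | hc
  · simp
  have h := Stirling.le_log_factorial_stirling hc.ne'
  have : 0 ≤ Real.log (2 * Real.pi) := Real.log_nonneg (by linarith [Real.pi_gt_three])
  linarith

/-- The Stirling sequence decreases from its first term e/√2; the factor √2 cancels against the
√(2c) in the formula, and the constant 1 remains. -/
lemma log_factorial_le (c : ℕ) :
    Real.log (c.factorial) ≤ (c : ℝ) * Real.log c - c + Real.log c / 2 + 1 := by
  rcases Nat.eq_zero_or_pos c with rfl | hc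
  · simp
  obtain ⟨k, rfl⟩ := Nat.exists_eq_succ_of_ne_zero hc.ne'
  have h1 := Stirling.log_stirlingSeq'_antitone (Nat.zero_le k)
  simp only [Function.comp, Nat.succ_eq_add_one, zero_add] at h1
  rw [Stirling.log_stirlingSeq_formula, Stirling.log_stirlingSeq_formula] at h1
  have hk : (0 : ℝ) < ((k + 1 : ℕ) : ℝ) := by positivity
  rw [Real.log_mul (by norm_num) hk.ne', Real.log_div hk.ne' (Real.exp_ne_zero _),
    Real.log_exp] at h1
  simp at h1
  push_cast at *
  linarith

lemma log_nat_nonneg (c : ℕ) : 0 ≤ Real.log c := by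
  exact Real.log_natCast_nonneg c

/-- The logarithm of the polynomial factor in the estimates for sizes of type classes. -/
noncomputable def slack (n : ℕ) : ℝ := Real.log (3 * ((n : ℝ) + 1))

lemma slack_ge_one (n : ℕ) : 1 ≤ slack n := by
  rw [slack, Real.le_log_iff_exp_le (by positivity)]
  have := Real.exp_one_lt_d9
  have : (0 : ℝ) ≤ n := n.cast_nonneg
  linarith

lemma log_factorial_le_slack {c n : ℕ} (h : c ≤ n) :
    Real.log (c.factorial) ≤ (c : ℝ) * Real.log c - c + slack n := by
  have h1 := log_factorial_le c
  have h2 := log_nat_nonneg c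
  -- Since e < 3, one has e·c ≤ 3(n+1); this is the reason for the constant 3 in `slack`.
  have h3 : Real.log c + 1 ≤ slack n := by
    rcases Nat.eq_zero_or_pos c with rfl | hc
    · simpa using slack_ge_one n
    rw [slack, Real.le_log_iff_exp_le (by positivity), Real.exp_add,
      Real.exp_log (by positivity)]
    have := Real.exp_one_lt_d9
    have : (c : ℝ) ≤ n := by exact_mod_cast h
    nlinarith [Real.exp_pos 1]
  linarith

lemma log_factorial_ge' (c : ℕ) :
    (c : ℝ) * Real.log c - c ≤ Real.log (c.factorial) := by
  linarith [log_factorial_ge c, log_nat_nonneg c]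

/-! ### Entropy estimates for conditional type classes -/

section Phi

variable {A B : Type*} [Fintype A] [Fintype B] [DecidableEq A] [DecidableEq B]

/-- The sum `∑ Q log Q`, i.e. the negative of the entropy. -/
noncomputable def phi (Q : A → ℝ) : ℝ := ∑ s, Q s * Real.log (Q s)

lemma continuous_phi : Continuous (phi : (A → ℝ) → ℝ) := by
  unfold phi
  exact continuous_finsetSum _ fun s _ =>
    Real.continuous_mul_log.comp (continuous_apply s)

lemma empDist_eq {n : ℕ} (a : Fin n → A) (s : A) : empDist a s = (cnt a s : ℝ) / n := rfl

lemma empDist_eq_iff {n : ℕ} (hn : 0 < n) (a b : Fin n → A) :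
    empDist a = empDist b ↔ ∀ s, cnt a s = cnt b s := by
  have hn' : (n : ℝ) ≠ 0 := by positivity
  constructor
  · intro h s
    have := congrFun h s
    rw [empDist_eq, empDist_eq, div_left_inj' hn'] at this
    exact_mod_cast this
  · intro h
    funext s
    rw [empDist_eq, empDist_eq, h s]

lemma cnt_le {n : ℕ} (a : Fin n → A) (s : A) : cnt a s ≤ n := by
  simpa [cnt] using Finset.card_le_univ (univ.filter fun i => a i = s)

lemma sum_cnt_log {n : ℕ} (hn : 0 < n) (a : Fin n → A) :
    ∑ s, (cnt a s : ℝ) * Real.log (cnt a s) = n * phi (empDist a) + n * Real.log n := by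
  have hn' : (n : ℝ) ≠ 0 := by positivity
  have h1 : (n : ℝ) * Real.log n = ∑ s, (cnt a s : ℝ) * Real.log n := by
    rw [← Finset.sum_mul]
    congr 1
    have := sum_cnt a
    rw [Fintype.card_fin] at this
    exact_mod_cast this.symm
  rw [h1, phi, Finset.mul_sum, ← Finset.sum_add_distrib]
  refine Finset.sum_congr rfl fun s _ => ?_
  rw [empDist_eq]
  rcases Nat.eq_zero_or_pos (cnt a s) with h | h
  · simp [h]
  rw [Real.log_div (by positivity) hn']
  field_simp
  ring

lemma sum_log_factorial_cnt_ge {n : ℕ} (hn : 0 < n) (a : Fin n → A) :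
    n * phi (empDist a) + n * Real.log n - n ≤ ∑ s, Real.log ((cnt a s).factorial) := by
  have h2 : (∑ s, (cnt a s : ℝ)) = n := by
    have := sum_cnt a
    rw [Fintype.card_fin] at this
    exact_mod_cast this
  rw [← sum_cnt_log hn a]
  calc _ = ∑ s, ((cnt a s : ℝ) * Real.log (cnt a s) - cnt a s) := by
        rw [Finset.sum_sub_distrib, h2]
    _ ≤ _ := Finset.sum_le_sum fun s _ => log_factorial_ge' _

lemma sum_log_factorial_cnt_le {n : ℕ} (hn : 0 < n) (a : Fin n → A) :
    ∑ s, Real.log ((cnt a s).factorial) ≤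
      n * phi (empDist a) + n * Real.log n - n + Fintype.card A * slack n := by
  have h2 : (∑ s, (cnt a s : ℝ)) = n := by
    have := sum_cnt a
    rw [Fintype.card_fin] at this
    exact_mod_cast this
  rw [← sum_cnt_log hn a]
  calc _ ≤ ∑ s, ((cnt a s : ℝ) * Real.log (cnt a s) - cnt a s + slack n) :=
        Finset.sum_le_sum fun s _ => log_factorial_le_slack (cnt_le a s)
    _ = _ := by
        rw [Finset.sum_add_distrib, Finset.sum_sub_distrib, h2]
        simp

/-- The vectors `b` for which the pair `(a, b)` has the same joint type as `(a, b₀)`. -/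
def condClass {n : ℕ} (a : Fin n → A) (b₀ : Fin n → B) : Finset (Fin n → B) :=
  univ.filter fun b =>
      ∀ s, cnt (fun i => (a i, b i)) s = cnt (fun i => (a i, b₀ i)) s

lemma log_card_condClass {n : ℕ} (a : Fin n → A) (b₀ : Fin n → B) :
    Real.log ((condClass a b₀).card) = ∑ s, Real.log ((cnt a s).factorial) -
      ∑ s, Real.log ((cnt (fun i => (a i, b₀ i)) s).factorial) := by
  have h := card_same_joint_cnt_mul a b₀
  have hne : condClass a b₀ ≠ ∅ := by
    refine Finset.Nonempty.ne_empty ⟨b₀, ?_⟩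
    simp [condClass]
  have hc : ((condClass a b₀).card : ℝ) ≠ 0 := by
    exact_mod_cast (Finset.card_ne_zero.mpr (Finset.nonempty_iff_ne_empty.mpr hne))
  have h' : ((condClass a b₀).card : ℝ) *
      ∏ s, ((cnt (fun i => (a i, b₀ i)) s).factorial : ℝ) = ∏ s, ((cnt a s).factorial : ℝ) := by
    exact_mod_cast h
  have h3 := congrArg Real.log h'
  rw [Real.log_mul hc (Finset.prod_ne_zero_iff.mpr fun s _ => by positivity),
    Real.log_prod (fun s _ => by positivity), Real.log_prod (fun s _ => by positivity)] at h3
  linarith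

lemma condClass_card_pos {n : ℕ} (a : Fin n → A) (b₀ : Fin n → B) :
    0 < (condClass a b₀).card := Finset.card_pos.mpr ⟨b₀, by simp [condClass]⟩

/-- The cardinality is a quotient of products of factorials. By Stirling each product is exp(n·phi +
n log n - n) up to one `slack` per factor, and the terms n log n - n cancel in the quotient. -/
lemma card_condClass_le {n : ℕ} (hn : 0 < n) (a : Fin n → A) (b₀ : Fin n → B) :
    ((condClass a b₀).card : ℝ) ≤
      Real.exp (n * (phi (empDist a) - phi (empJoint a b₀)) + Fintype.card A * slack n) := by
  have h0 : (0 : ℝ) < (condClass a b₀).card := by exact_mod_cast condClass_card_pos a b₀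
  rw [← Real.log_le_iff_le_exp h0, log_card_condClass]
  have h1 := sum_log_factorial_cnt_le hn a
  have h2 := sum_log_factorial_cnt_ge hn (fun i => (a i, b₀ i))
  rw [empJoint]
  linarith

lemma card_condClass_ge {n : ℕ} (hn : 0 < n) (a : Fin n → A) (b₀ : Fin n → B) :
    Real.exp (n * (phi (empDist a) - phi (empJoint a b₀)) -
      Fintype.card A * Fintype.card B * slack n) ≤ ((condClass a b₀).card : ℝ) := by
  have h0 : (0 : ℝ) < (condClass a b₀).card := by exact_mod_cast condClass_card_pos a b₀
  rw [← Real.le_log_iff_exp_le h0, log_card_condClass]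
  have h1 := sum_log_factorial_cnt_ge hn a
  have h2 := sum_log_factorial_cnt_le hn (fun i => (a i, b₀ i))
  rw [Fintype.card_prod] at h2
  push_cast at h2
  rw [empJoint]
  linarith

lemma card_image_empDist_le (A : Type*) [Fintype A] [DecidableEq A] (n : ℕ) :
    ((univ : Finset (Fin n → A)).image fun a => cnt a).card ≤ (n + 1) ^ Fintype.card A := by
  have : ((univ : Finset (Fin n → A)).image fun a => cnt a) ⊆
      Fintype.piFinset fun _ : A => Finset.range (n + 1) := by
    intro c hc
    simp only [mem_image, mem_univ, true_and] at hc
    obtain ⟨a, rfl⟩ := hc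
    simp only [Fintype.mem_piFinset, mem_range]
    intro s
    exact Nat.lt_succ_of_le (cnt_le a s)
  refine (Finset.card_le_card this).trans ?_
  simp

/-- A nonnegative sum over a nonempty set is, up to a polynomial factor, attained on the elements
with one common type. -/
lemma exists_dominant_type {β : Type*} {n : ℕ} {S : Finset β} (hS : S.Nonempty)
    (k : β → Fin n → A) {w : β → ℝ} (hw : ∀ b ∈ S, 0 ≤ w b) :
    ∃ b ∈ S, ∑ c ∈ S, w c ≤ Real.exp (Fintype.card A * slack n) *
      ∑ c ∈ S.filter (fun c => ∀ s, cnt (k c) s = cnt (k b) s), w c := by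
  classical
  -- Pigeonhole: there are at most (n+1)^|A| types, so the largest partial sum is at least the total
  -- divided by that number.
  obtain ⟨b, hb, hmax⟩ := S.exists_max_image
    (fun b => ∑ c ∈ S.filter (fun c => ∀ s, cnt (k c) s = cnt (k b) s), w c) hS
  refine ⟨b, hb, ?_⟩
  have h0 : 0 ≤ ∑ c ∈ S.filter (fun c => ∀ s, cnt (k c) s = cnt (k b) s), w c :=
    Finset.sum_nonneg fun c hc => hw c (Finset.mem_filter.mp hc).1
  have h1 : ∑ c ∈ S, w c = ∑ t ∈ S.image (fun c => cnt (k c)),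
      ∑ c ∈ S.filter (fun c => cnt (k c) = t), w c :=
    (Finset.sum_fiberwise_of_maps_to (fun c hc => Finset.mem_image_of_mem _ hc) _).symm
  have h2 : ∀ t ∈ S.image (fun c => cnt (k c)), ∑ c ∈ S.filter (fun c => cnt (k c) = t), w c ≤
      ∑ c ∈ S.filter (fun c => ∀ s, cnt (k c) s = cnt (k b) s), w c := by
    intro t ht
    obtain ⟨b', hb', rfl⟩ := Finset.mem_image.mp ht
    refine le_trans (le_of_eq ?_) (hmax b' hb')
    refine Finset.sum_congr (Finset.filter_congr fun c _ => funext_iff) fun _ _ => rfl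
  rw [h1]
  refine (Finset.sum_le_card_nsmul _ _ _ h2).trans ?_
  rw [nsmul_eq_mul]
  refine mul_le_mul_of_nonneg_right ?_ h0
  have h3 : (S.image (fun c => cnt (k c))).card ≤ (n + 1) ^ Fintype.card A := by
    refine (Finset.card_le_card ?_).trans (card_image_empDist_le A n)
    intro t ht
    obtain ⟨b', _, rfl⟩ := Finset.mem_image.mp ht
    exact Finset.mem_image_of_mem _ (Finset.mem_univ _)
  have h4 : Real.exp (Fintype.card A * slack n) = (3 * ((n : ℝ) + 1)) ^ Fintype.card A := by
    rw [Real.exp_nat_mul, slack, Real.exp_log (by positivity)]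
  rw [h4]
  calc ((S.image (fun c => cnt (k c))).card : ℝ) ≤ ((n : ℝ) + 1) ^ Fintype.card A := by
        exact_mod_cast h3
    _ ≤ _ := by
        refine pow_le_pow_left₀ (by positivity) ?_ _
        have : (0 : ℝ) ≤ n := n.cast_nonneg
        linarith

end Phi

lemma tendsto_slack_div : Tendsto (fun n : ℕ => slack n / n) atTop (nhds 0) := by
  have h1 : Tendsto (fun x : ℝ => Real.log x / x) atTop (nhds 0) := by
    simpa using Real.isLittleO_log_id_atTop.tendsto_div_nhds_zero
  have h2 : Tendsto (fun n : ℕ => 3 * ((n : ℝ) + 1)) atTop atTop :=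
    (tendsto_natCast_atTop_atTop.atTop_add tendsto_const_nhds).const_mul_atTop (by norm_num)
  have h3 := h1.comp h2
  have h4 : Tendsto (fun n : ℕ => 3 * ((n : ℝ) + 1) / n) atTop (nhds 3) := by
    have : Tendsto (fun n : ℕ => 3 + 3 * (1 / (n : ℝ))) atTop (nhds (3 + 3 * 0)) :=
      (tendsto_one_div_atTop_nhds_zero_nat.const_mul 3).const_add 3
    simp only [mul_zero, add_zero] at this
    refine this.congr' ?_
    filter_upwards [eventually_gt_atTop 0] with n hn
    have : (n : ℝ) ≠ 0 := by positivity
    field_simp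
  have h5 := h3.mul h4
  simp only [zero_mul] at h5
  refine h5.congr' ?_
  filter_upwards [eventually_gt_atTop 0] with n hn
  have : (n : ℝ) ≠ 0 := by positivity
  simp only [Function.comp, slack]
  have h6 : 3 * ((n : ℝ) + 1) ≠ 0 := by positivity
  field_simp

/-! ### Averages over random codebooks -/

section Codebook

variable {α : Type*} [DecidableEq α]

/-- Independence of the codewords: conditionally on codeword `m`, the comparisons of the other M - 1
codewords with it factorize. -/
lemma sum_piFinset_one {M : ℕ} (S : Finset α) (m : Fin M) (F : α → ℝ) (G : α → α → ℝ) :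
    ∑ C ∈ Fintype.piFinset (fun _ : Fin M => S), F (C m) * ∏ l ∈ univ.erase m, G (C m) (C l) =
      ∑ x ∈ S, F x * (∑ z ∈ S, G x z) ^ (M - 1) := by
  have h1 : ∀ x ∈ S, F x * (∑ z ∈ S, G x z) ^ (M - 1) =
      ∑ C ∈ Fintype.piFinset (fun _ : Fin M => S),
        (if C m = x then F x * ∏ l ∈ univ.erase m, G x (C l) else 0) := by
    intro x hx
    -- The conditioning on `C m = x` is built into the factor of index `m`, so the whole summand
    -- becomes a product over the codewords.
    have h2 := Finset.sum_prod_piFinset S (fun (l : Fin M) z =>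
      if l = m then (if z = x then F x else 0) else G x z)
    have h3 : ∏ l : Fin M, ∑ z ∈ S, (if l = m then (if z = x then F x else 0) else G x z) =
        F x * (∑ z ∈ S, G x z) ^ (M - 1) := by
      rw [← Finset.mul_prod_erase univ _ (Finset.mem_univ m)]
      congr 1
      · simp [hx]
      · rw [Finset.prod_congr rfl (g := fun _ => ∑ z ∈ S, G x z)]
        · rw [Finset.prod_const, Finset.card_erase_of_mem (Finset.mem_univ m)]
          simp
        · intro l hl
          simp [(Finset.mem_erase.mp hl).1]
    rw [← h3, ← h2]
    refine Finset.sum_congr rfl fun C _ => ?_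
    rw [← Finset.mul_prod_erase univ _ (Finset.mem_univ m)]
    simp only [if_true]
    split_ifs with h
    · congr 1
      refine Finset.prod_congr rfl fun l hl => ?_
      simp [(Finset.mem_erase.mp hl).1]
    · simp
  rw [Finset.sum_congr rfl h1, Finset.sum_comm]
  refine Finset.sum_congr rfl fun C hC => ?_
  have : C m ∈ S := Fintype.mem_piFinset.mp hC m
  simp [this]

/-- The version for the list size: `m` is transmitted, `l` is the wrong codeword on the list, and
the other M - 2 codewords are compared with `l`. -/
lemma sum_piFinset_two {M : ℕ} (S : Finset α) {m l : Fin M} (hml : m ≠ l) (F : α → α → ℝ)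
    (G : α → α → ℝ) :
    ∑ C ∈ Fintype.piFinset (fun _ : Fin M => S),
      F (C m) (C l) * ∏ j ∈ (univ.erase m).erase l, G (C l) (C j) =
      ∑ x ∈ S, ∑ x' ∈ S, F x x' * (∑ z ∈ S, G x' z) ^ (M - 2) := by
  have hl : l ∈ univ.erase m := Finset.mem_erase.mpr ⟨hml.symm, Finset.mem_univ _⟩
  have h1 : ∀ x ∈ S, ∀ x' ∈ S, F x x' * (∑ z ∈ S, G x' z) ^ (M - 2) =
      ∑ C ∈ Fintype.piFinset (fun _ : Fin M => S),
        (if C m = x then (if C l = x' then F x x' * ∏ j ∈ (univ.erase m).erase l, G x' (C j)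
          else 0) else 0) := by
    intro x hx x' hx'
    have h2 := Finset.sum_prod_piFinset S (fun (j : Fin M) z =>
      if j = m then (if z = x then F x x' else 0) else
      if j = l then (if z = x' then 1 else 0) else G x' z)
    have h3 : ∏ j : Fin M, ∑ z ∈ S, (if j = m then (if z = x then F x x' else 0) else
        if j = l then (if z = x' then 1 else 0) else G x' z) =
        F x x' * (∑ z ∈ S, G x' z) ^ (M - 2) := by
      rw [← Finset.mul_prod_erase univ _ (Finset.mem_univ m), ← Finset.mul_prod_erase _ _ hl]
      have e1 : ∑ z ∈ S, (if m = m then (if z = x then F x x' else 0) else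
        if m = l then (if z = x' then 1 else 0) else G x' z) = F x x' := by simp [hx]
      have e2 : ∑ z ∈ S, (if l = m then (if z = x then F x x' else 0) else
        if l = l then (if z = x' then 1 else 0) else G x' z) = 1 := by simp [hml.symm, hx']
      rw [e1, e2, one_mul]
      congr 1
      rw [Finset.prod_congr rfl (g := fun _ => ∑ z ∈ S, G x' z)]
      · rw [Finset.prod_const, Finset.card_erase_of_mem hl,
          Finset.card_erase_of_mem (Finset.mem_univ m)]
        simp [Nat.sub_sub]
      · intro j hj
        simp [(Finset.mem_erase.mp hj).1, (Finset.mem_erase.mp (Finset.mem_erase.mp hj).2).1]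
    rw [← h3, ← h2]
    refine Finset.sum_congr rfl fun C _ => ?_
    rw [← Finset.mul_prod_erase univ _ (Finset.mem_univ m), ← Finset.mul_prod_erase _ _ hl]
    simp only [if_true, hml.symm, if_false]
    have h5 : ∏ j ∈ (univ.erase m).erase l, (if j = m then (if C j = x then F x x' else 0) else
        if j = l then (if C j = x' then 1 else 0) else G x' (C j)) =
        ∏ j ∈ (univ.erase m).erase l, G x' (C j) := by
      refine Finset.prod_congr rfl fun j hj => ?_
      simp [(Finset.mem_erase.mp hj).1, (Finset.mem_erase.mp (Finset.mem_erase.mp hj).2).1]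
    rw [h5]
    split_ifs <;> simp
  rw [Finset.sum_congr rfl fun x hx => Finset.sum_congr rfl (h1 x hx)]
  rw [Finset.sum_congr rfl fun x _ => Finset.sum_comm, Finset.sum_comm]
  refine Finset.sum_congr rfl fun C hC => ?_
  have e1 : C m ∈ S := Fintype.mem_piFinset.mp hC m
  have e2 : C l ∈ S := Fintype.mem_piFinset.mp hC l
  simp [e1, e2, Finset.sum_ite_irrel]

end Codebook

section Decoder

variable {X Y : Type*} [Fintype X] [Fintype Y] [DecidableEq X] [DecidableEq Y]

/-- As `T` is finite it can be moved across the inequality in `EReal`; the supremum then splits into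
one condition per competitor. -/
lemma mem_decRegion (W : X → Y → ℝ) (T : ℝ) {n M : ℕ} (C : Fin M → Fin n → X) (m : Fin M)
    (y : Fin n → Y) : y ∈ decRegion W T C m ↔
      ∀ l ∈ univ.erase m,
        (T : EReal) + logLik W (empJoint (C l) y) ≤ logLik W (empJoint (C m) y) := by
  have key : ∀ s t : EReal, (T : EReal) + s ≤ t ↔ s ≤ t - T := fun s t => by
    rw [add_comm, EReal.le_sub_iff_add_le (by simp) (by simp)]
  simp only [decRegion, Set.mem_ofPred_eq, key, iSup_le_iff, mem_erase, mem_univ, and_true]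

open Classical in
/-- The fraction of the vectors in the type class that do not beat the threshold set by `x`. -/
noncomputable def okFrac (W : X → Y → ℝ) (P : X → ℝ) (T : ℝ) {n : ℕ} (x : Fin n → X) (y : Fin n → Y) : ℝ :=
  (((typeClass P n).filter fun z =>
    (T : EReal) + logLik W (empJoint z y) ≤ logLik W (empJoint x y)).card : ℝ) /
    (typeClass P n).card

open Classical in
lemma codeAvg_errorProb (W : X → Y → ℝ) (P : X → ℝ) (T : ℝ) {n M : ℕ} (hM : 0 < M)
    (hT : (typeClass P n).Nonempty) :
    codeAvg P n M (fun C => errorProb W C (decRegion W T C)) =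
      (1 / ((typeClass P n).card : ℝ)) * ∑ x ∈ typeClass P n, ∑ y,
        chanProb W x y * (1 - okFrac W P T x y ^ (M - 1)) := by
  set S := typeClass P n with hS
  have hc : (S.card : ℝ) ≠ 0 := by exact_mod_cast Finset.card_ne_zero.mpr hT
  have hM' : (M : ℝ) ≠ 0 := by positivity
  have h1 : ∀ (m : Fin M) (y : Fin n → Y),
      ∑ C ∈ Fintype.piFinset (fun _ : Fin M => S),
        (if y ∈ decRegion W T C m then 0 else chanProb W (C m) y) =
      (S.card : ℝ) ^ (M - 1) *
        ∑ x ∈ S, chanProb W x y * (1 - okFrac W P T x y ^ (M - 1)) := by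
    intro m y
    have e1 : ∀ C : Fin M → Fin n → X, (if y ∈ decRegion W T C m then 0 else chanProb W (C m) y) =
        chanProb W (C m) y * (∏ l ∈ univ.erase m, (1 : ℝ)) - chanProb W (C m) y *
        ∏ l ∈ univ.erase m, (if (T : EReal) + logLik W (empJoint (C l) y) ≤
          logLik W (empJoint (C m) y) then (1 : ℝ) else 0) := by
      intro C
      rw [Finset.prod_boole, mem_decRegion]
      split_ifs <;> simp
    simp only [e1, Finset.sum_sub_distrib]
    rw [sum_piFinset_one S m (fun x => chanProb W x y) (fun _ _ => 1),
      sum_piFinset_one S m (fun x => chanProb W x y)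
        (fun x z => if (T : EReal) + logLik W (empJoint z y) ≤
          logLik W (empJoint x y) then (1 : ℝ) else 0), ← Finset.sum_sub_distrib, Finset.mul_sum]
    refine Finset.sum_congr rfl fun x _ => ?_
    rw [Finset.sum_boole, okFrac, div_pow, ← hS]
    simp only [sum_const, nsmul_eq_mul, mul_one]
    have : (S.card : ℝ) ^ (M - 1) ≠ 0 := pow_ne_zero _ hc
    field_simp
  have h2 : ∑ C ∈ Fintype.piFinset (fun _ : Fin M => S), errorProb W C (decRegion W T C) =
      (S.card : ℝ) ^ (M - 1) * ∑ x ∈ S, ∑ y,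
        chanProb W x y * (1 - okFrac W P T x y ^ (M - 1)) := by
    simp only [errorProb]
    rw [← Finset.mul_sum, Finset.sum_comm]
    have : ∀ m : Fin M, ∑ C ∈ Fintype.piFinset (fun _ : Fin M => S),
        ∑ y, (if y ∈ decRegion W T C m then 0 else chanProb W (C m) y) =
        (S.card : ℝ) ^ (M - 1) * ∑ x ∈ S, ∑ y,
        chanProb W x y * (1 - okFrac W P T x y ^ (M - 1)) := by
      intro m
      rw [Finset.sum_comm, Finset.sum_comm (s := S), Finset.mul_sum]
      exact Finset.sum_congr rfl fun y _ => h1 m y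
    rw [Finset.sum_congr rfl fun m _ => this m]
    simp only [sum_const, card_univ, Fintype.card_fin, nsmul_eq_mul]
    field_simp
  rw [codeAvg, h2, ← hS]
  obtain ⟨k, rfl⟩ := Nat.exists_eq_succ_of_ne_zero hM.ne'
  simp only [Nat.succ_eq_add_one, Nat.add_sub_cancel, pow_succ]
  have : (S.card : ℝ) ^ k ≠ 0 := pow_ne_zero _ hc
  field_simp

open Classical in
-- In the mean over the M transmitted codewords, each has M - 1 possible wrong codewords, all
-- contributing equally. The condition on the transmitted codeword is kept explicit; the remaining M
-- - 2 independent codewords give the power of `okFrac`.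
lemma codeAvg_listSize (W : X → Y → ℝ) (P : X → ℝ) (T : ℝ) {n M : ℕ} (hM : 2 ≤ M)
    (hT : (typeClass P n).Nonempty) :
    codeAvg P n M (fun C => listSize W C (decRegion W T C)) =
      ((M : ℝ) - 1) / ((typeClass P n).card : ℝ) ^ 2 * ∑ x ∈ typeClass P n, ∑ y,
        ∑ x' ∈ typeClass P n, (if (T : EReal) + logLik W (empJoint x y) ≤
          logLik W (empJoint x' y) then chanProb W x y else 0) *
          okFrac W P T x' y ^ (M - 2) := by
  set S := typeClass P n with hS
  have hc : (S.card : ℝ) ≠ 0 := by exact_mod_cast Finset.card_ne_zero.mpr hT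
  have hM' : (M : ℝ) ≠ 0 := by positivity
  have hp : (S.card : ℝ) ^ (M - 2) ≠ 0 := pow_ne_zero _ hc
  have h1 : ∀ (m l : Fin M), m ≠ l → ∀ (y : Fin n → Y),
      ∑ C ∈ Fintype.piFinset (fun _ : Fin M => S),
        chanProb W (C m) y * (if y ∈ decRegion W T C l then 1 else 0) =
      (S.card : ℝ) ^ (M - 2) *
        ∑ x ∈ S, ∑ x' ∈ S, (if (T : EReal) + logLik W (empJoint x y) ≤
          logLik W (empJoint x' y) then chanProb W x y else 0) *
          okFrac W P T x' y ^ (M - 2) := by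
    intro m l hml y
    have e1 : ∀ C : Fin M → Fin n → X,
        chanProb W (C m) y * (if y ∈ decRegion W T C l then 1 else 0) =
        (if (T : EReal) + logLik W (empJoint (C m) y) ≤
          logLik W (empJoint (C l) y) then chanProb W (C m) y else 0) *
        ∏ j ∈ (univ.erase m).erase l, (if (T : EReal) + logLik W (empJoint (C j) y) ≤
          logLik W (empJoint (C l) y) then (1 : ℝ) else 0) := by
      intro C
      have hm : m ∈ univ.erase l := Finset.mem_erase.mpr ⟨hml, Finset.mem_univ _⟩
      have e2 : (y ∈ decRegion W T C l) ↔ ((T : EReal) + logLik W (empJoint (C m) y) ≤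
          logLik W (empJoint (C l) y) ∧ ∀ j ∈ (univ.erase m).erase l,
          (T : EReal) + logLik W (empJoint (C j) y) ≤ logLik W (empJoint (C l) y)) := by
        rw [mem_decRegion, Finset.erase_right_comm]
        conv_lhs => rw [← Finset.insert_erase hm]
        exact Finset.forall_mem_insert _ _ _
      rw [Finset.prod_boole]
      simp only [e2]
      split_ifs <;> simp_all
    simp only [e1]
    rw [sum_piFinset_two S hml (fun x x' => if (T : EReal) + logLik W (empJoint x y) ≤
          logLik W (empJoint x' y) then chanProb W x y else 0)
        (fun x z => if (T : EReal) + logLik W (empJoint z y) ≤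
          logLik W (empJoint x y) then (1 : ℝ) else 0), Finset.mul_sum]
    refine Finset.sum_congr rfl fun x _ => ?_
    rw [Finset.mul_sum]
    refine Finset.sum_congr rfl fun x' _ => ?_
    rw [Finset.sum_boole, okFrac, div_pow, ← hS]
    field_simp
  have h2 : ∑ C ∈ Fintype.piFinset (fun _ : Fin M => S), listSize W C (decRegion W T C) =
      ((M : ℝ) - 1) * (S.card : ℝ) ^ (M - 2) * ∑ x ∈ S, ∑ y, ∑ x' ∈ S,
        (if (T : EReal) + logLik W (empJoint x y) ≤
          logLik W (empJoint x' y) then chanProb W x y else 0) *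
          okFrac W P T x' y ^ (M - 2) := by
    simp only [listSize]
    rw [Finset.sum_comm, Finset.sum_comm (s := S), Finset.mul_sum]
    refine Finset.sum_congr rfl fun y _ => ?_
    rw [← Finset.mul_sum, Finset.sum_comm]
    simp only [Finset.mul_sum (univ.filter _)]
    have : ∀ m : Fin M, ∑ C ∈ Fintype.piFinset (fun _ : Fin M => S),
        ∑ l ∈ univ.filter (fun l => l ≠ m),
          chanProb W (C m) y * (if y ∈ decRegion W T C l then 1 else 0) =
        ((M : ℝ) - 1) * ((S.card : ℝ) ^ (M - 2) *
        ∑ x ∈ S, ∑ x' ∈ S, (if (T : EReal) + logLik W (empJoint x y) ≤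
          logLik W (empJoint x' y) then chanProb W x y else 0) *
          okFrac W P T x' y ^ (M - 2)) := by
      intro m
      rw [Finset.sum_comm, Finset.sum_congr rfl
        fun l hl => h1 m l (Finset.mem_filter.mp hl).2.symm y]
      rw [Finset.sum_const, nsmul_eq_mul, Finset.filter_ne', Finset.card_erase_of_mem (mem_univ m)]
      simp only [card_univ, Fintype.card_fin]
      rw [Nat.cast_sub (by lia), Nat.cast_one]
    rw [Finset.sum_congr rfl fun m _ => this m]
    simp only [sum_const, card_univ, Fintype.card_fin, nsmul_eq_mul]
    field_simp
  rw [codeAvg, h2, ← hS]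
  obtain ⟨k, rfl⟩ := Nat.exists_eq_add_of_le' hM
  simp only [Nat.add_sub_cancel, pow_add] at hp ⊢
  field_simp

end Decoder

/-! ### Exponential rates -/

section Rate

variable {X : Type*} [Fintype X] [DecidableEq X]

lemma neg_inv_mul_log_of_pos {a : ℝ} (ha : 0 < a) (n : ℕ) :
    ((-(1 / (n : ℝ)) : ℝ) : EReal) * ENNReal.log (ENNReal.ofReal a) =
      ((-(1 / (n : ℝ)) * Real.log a : ℝ) : EReal) := by
  rw [ENNReal.log_ofReal_of_pos ha, EReal.coe_mul]

lemma rate_le_of_exp_le {a c : ℝ} {n : ℕ} (hn : 0 < n) (h : Real.exp (-(n * c)) ≤ a) :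
    ((-(1 / (n : ℝ)) : ℝ) : EReal) * ENNReal.log (ENNReal.ofReal a) ≤ c := by
  have hn' : (0 : ℝ) < n := by exact_mod_cast hn
  have ha := (Real.exp_pos _).trans_le h
  rw [neg_inv_mul_log_of_pos ha, EReal.coe_le_coe_iff]
  rw [← Real.le_log_iff_exp_le ha] at h
  have : -(1 / (n : ℝ)) * Real.log a = (-Real.log a) / n := by ring
  rw [this, div_le_iff₀ hn']
  linarith

lemma exp_lt_of_rate_lt {a c : ℝ} {n : ℕ} (hn : 0 < n)
    (h : ((-(1 / (n : ℝ)) : ℝ) : EReal) * ENNReal.log (ENNReal.ofReal a) < c) :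
    Real.exp (-(n * c)) < a := by
  have hn' : (0 : ℝ) < n := by exact_mod_cast hn
  rcases le_or_gt a 0 with ha | ha
  -- For a ≤ 0 the rate is +∞, so it cannot be below a real number.
  · rw [ENNReal.ofReal_of_nonpos ha, ENNReal.log_zero,
      EReal.coe_mul_bot_of_neg (by rw [neg_lt_zero]; positivity)] at h
    exact absurd h (by simp)
  · rw [neg_inv_mul_log_of_pos ha, EReal.coe_lt_coe_iff] at h
    rw [← Real.lt_log_iff_exp_lt ha]
    have e : -(1 / (n : ℝ)) * Real.log a = (-Real.log a) / n := by ring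
    rw [e, div_lt_iff₀ hn'] at h
    linarith

/-- The rate is at most `c` if `a n ≥ exp (-n (c + o(1)))` for the multiples `n` of some `N`. -/
lemma expRate_le {P : X → ℝ} {a δ : ℕ → ℝ} {c : ℝ} {N : ℕ} (hN : 0 < N)
    (hδ : Tendsto δ atTop (nhds 0))
    (h : ∀ n, 0 < n → N ∣ n → (typeClass P n).Nonempty ∧ Real.exp (-(n * (c + δ n))) ≤ a n) :
    expRate P a ≤ c := by
  refine le_of_forall_gt fun d hd => ?_
  obtain ⟨e, hce, hed⟩ := EReal.lt_iff_exists_real_btwn.mp hd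
  refine lt_of_le_of_lt ?_ hed
  refine liminf_le_of_frequently_le ?_ (by isBoundedDefault)
  rw [frequently_inf_principal]
  have h1 : ∀ᶠ n in atTop, δ n < e - c :=
    hδ.eventually_lt_const (by rw [EReal.coe_lt_coe_iff] at hce; linarith)
  -- A bound along a subsequence of block lengths suffices for an upper bound on a liminf.
  have h2 : ∃ᶠ n in atTop, N ∣ n := by
    rw [frequently_atTop]
    exact fun k => ⟨N * k, Nat.le_mul_of_pos_left k hN, dvd_mul_right _ _⟩
  refine ((h2.and_eventually h1).and_eventually (eventually_gt_atTop 0)).mono ?_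
  rintro n ⟨⟨hNn, hn1⟩, hn⟩
  obtain ⟨hne, hn2⟩ := h n hn hNn
  refine ⟨hne, rate_le_of_exp_le hn (le_trans ?_ hn2)⟩
  rw [Real.exp_le_exp, neg_le_neg_iff]
  exact mul_le_mul_of_nonneg_left (by linarith) n.cast_nonneg

lemma frequently_of_expRate_lt {P : X → ℝ} {a : ℕ → ℝ} {c : ℝ}
    (h : expRate P a < c) :
    ∃ᶠ n in atTop, (typeClass P n).Nonempty ∧ 0 < n ∧ Real.exp (-(n * c)) < a n := by
  have h1 := frequently_lt_of_liminf_lt (by isBoundedDefault) h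
  rw [frequently_inf_principal] at h1
  refine (h1.and_eventually (eventually_gt_atTop 0)).mono ?_
  rintro n ⟨⟨h2, h3⟩, hn⟩
  exact ⟨h2, hn, exp_lt_of_rate_lt hn h3⟩

/-- The common frame of both formulas. Hypothesis `h2` is used with a sequence decreasing to the
rate, so it yields an element of `S` not exceeding the rate itself; with `h1` this shows attainment.
A rate -∞ is ruled out by `h2` below the bound of `h3`. -/
lemma isMinOrTop_expRate {P : X → ℝ} {a : ℕ → ℝ} {S : Set EReal}
    (h1 : ∀ v ∈ S, expRate P a ≤ v)
    (h2 : ∀ (c : ℕ → ℝ) (c₀ : ℝ), Tendsto c atTop (nhds c₀) →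
      (∀ j, ∃ᶠ n in atTop, (typeClass P n).Nonempty ∧ 0 < n ∧ Real.exp (-(n * c j)) < a n) →
      ∃ v ∈ S, v ≤ c₀)
    (h3 : ∃ B : ℝ, ∀ v ∈ S, (B : EReal) ≤ v) :
    IsMinOrTop S (expRate P a) := by
  refine ⟨?_, ?_⟩
  · obtain ⟨B, hB⟩ := h3
    induction hE : expRate P a with
    | top => exact Set.mem_insert _ _
    | bot =>
      exfalso
      obtain ⟨v, hv, hvB⟩ := h2 (fun _ => B - 1) (B - 1) tendsto_const_nhds
        (fun _ => frequently_of_expRate_lt (by rw [hE]; exact EReal.bot_lt_coe _))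
      have := (hB v hv).trans hvB
      rw [EReal.coe_le_coe_iff] at this
      linarith
    | coe e =>
      have hlim : Tendsto (fun j : ℕ => e + 1 / ((j : ℝ) + 1)) atTop (nhds e) := by
        simpa using (tendsto_one_div_add_atTop_nhds_zero_nat (𝕜 := ℝ)).const_add e
      obtain ⟨v, hv, hve⟩ := h2 _ e hlim fun j => frequently_of_expRate_lt (by
        rw [hE, EReal.coe_lt_coe_iff]
        have : 0 < 1 / ((j : ℝ) + 1) := by positivity
        linarith)
      have h4 := h1 v hv
      rw [hE] at h4
      rw [le_antisymm h4 hve]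
      exact Set.mem_insert_of_mem _ hv
  · intro v hv
    rcases Set.mem_insert_iff.mp hv with rfl | hv
    · exact le_top
    · exact h1 v hv

end Rate

/-! ### Rational approximation -/

/-- There are `ℚ`-linear maps `ℝ → ℚ` that fix `1` and converge pointwise to the identity. -/
lemma exists_rat_linear_approx :
    ∃ φ : ℕ → (ℝ →ₗ[ℚ] ℚ), (∀ k, φ k 1 = 1) ∧
      ∀ v : ℝ, Tendsto (fun k => (φ k v : ℝ)) atTop (nhds v) := by
  let b := Module.Basis.ofVectorSpace ℚ ℝ
  have h0 : ∀ (k : ℕ) (x : ℝ), ∃ q : ℚ, |(q : ℝ) - x| < 1 / ((k : ℝ) + 1) := by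
    intro k x
    have hk : 0 < 1 / ((k : ℝ) + 1) := by positivity
    obtain ⟨q, h1, h2⟩ := exists_rat_btwn (show x - 1 / ((k : ℝ) + 1) < x + 1 / ((k : ℝ) + 1) by
      linarith)
    exact ⟨q, abs_lt.mpr ⟨by linarith, by linarith⟩⟩
  choose r hr using h0
  have hr' : ∀ x, Tendsto (fun k => (r k x : ℝ)) atTop (nhds x) := by
    intro x
    rw [tendsto_iff_norm_sub_tendsto_zero]
    exact squeeze_zero (fun _ => norm_nonneg _) (fun k => (hr k x).le)
      (tendsto_one_div_add_atTop_nhds_zero_nat (𝕜 := ℝ))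
  -- Rational approximations are chosen freely on a Hamel basis. Convergence at `v` follows because
  -- `v` is a finite rational combination of basis elements.
  let ψ : ℕ → (ℝ →ₗ[ℚ] ℚ) := fun k => b.constr ℚ fun j => r k (b j)
  have hψ : ∀ v : ℝ, Tendsto (fun k => (ψ k v : ℝ)) atTop (nhds v) := by
    intro v
    have e1 : ∀ k, (ψ k v : ℝ) = ∑ j ∈ (b.repr v).support, ((b.repr v j : ℚ) : ℝ) *
        (r k (b j) : ℝ) := by
      intro k
      simp only [ψ, Module.Basis.constr_apply, Finsupp.sum]
      push_cast
      simp
    have e2 : v = ∑ j ∈ (b.repr v).support, ((b.repr v j : ℚ) : ℝ) * b j := by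
      conv_lhs => rw [← b.linearCombination_repr v, Finsupp.linearCombination_apply, Finsupp.sum]
      exact Finset.sum_congr rfl fun j _ => Rat.smul_def _ _
    simp only [e1]
    conv => arg 3; rw [e2]
    exact tendsto_finsetSum _ fun j _ => (hr' (b j)).const_mul _
  have h1 : ∀ᶠ k in atTop, (0 : ℝ) < ψ k 1 := (hψ 1).eventually_const_lt one_pos
  obtain ⟨K, hK⟩ := eventually_atTop.mp h1
  -- Normalization makes the maps fix 1; the shift by `K` guarantees that the divisor is not zero.
  refine ⟨fun k => (ψ (k + K) 1)⁻¹ • ψ (k + K), fun k => ?_, fun v => ?_⟩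
  · have : ψ (k + K) 1 ≠ 0 := by
      have := hK (k + K) (Nat.le_add_left _ _)
      intro h
      rw [h] at this
      simp at this
    simp [this]
  · have h2 : Tendsto (fun k => ((ψ k 1 : ℝ))⁻¹ * (ψ k v : ℝ)) atTop (nhds (1⁻¹ * v)) :=
      ((hψ 1).inv₀ one_ne_zero).mul (hψ v)
    have h3 := h2.comp (tendsto_add_atTop_nat K)
    rw [inv_one, one_mul] at h3
    exact h3.congr fun k => by simp

/-! ### Single-letter quantities in terms of entropies -/

section Info

variable {X Y : Type*} [Fintype X] [Fintype Y] [DecidableEq X] [DecidableEq Y]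

/-- The linear functional `∑ Q log W`. -/
noncomputable def linLik (W : X → Y → ℝ) (Q : X × Y → ℝ) : ℝ :=
  ∑ x, ∑ y, Q (x, y) * Real.log (W x y)

/-- `Q` charges only the pairs with `W(y|x) ≠ 0`. -/
def SuppIn (W : X → Y → ℝ) (Q : X × Y → ℝ) : Prop := ∀ x y, W x y = 0 → Q (x, y) = 0

lemma logLik_of_suppIn {W : X → Y → ℝ} {Q : X × Y → ℝ} (h : SuppIn W Q) :
    logLik W Q = (linLik W Q : EReal) := if_pos h

lemma logLik_of_not_suppIn {W : X → Y → ℝ} {Q : X × Y → ℝ} (h : ¬ SuppIn W Q) :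
    logLik W Q = ⊥ := if_neg h

lemma continuous_linLik (W : X → Y → ℝ) : Continuous (linLik W) := by
  unfold linLik
  fun_prop

lemma continuous_margX : Continuous (margX : (X × Y → ℝ) → X → ℝ) := by
  unfold margX
  fun_prop

lemma continuous_margY : Continuous (margY : (X × Y → ℝ) → Y → ℝ) := by
  unfold margY
  fun_prop

lemma linLik_add (W : X → Y → ℝ) (Q Q' : X × Y → ℝ) (s t : ℝ) :
    linLik W (s • Q + t • Q') = s * linLik W Q + t * linLik W Q' := by
  simp only [linLik, Finset.mul_sum, ← Finset.sum_add_distrib, Pi.add_apply, Pi.smul_apply,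
    smul_eq_mul]
  exact Finset.sum_congr rfl fun x _ => Finset.sum_congr rfl fun y _ => by ring

lemma margX_add (Q Q' : X × Y → ℝ) (s t : ℝ) :
    margX (s • Q + t • Q') = s • margX Q + t • margX Q' := by
  funext x
  simp [margX, Finset.mul_sum, ← Finset.sum_add_distrib]

lemma margY_add (Q Q' : X × Y → ℝ) (s t : ℝ) :
    margY (s • Q + t • Q') = s • margY Q + t • margY Q' := by
  funext x
  simp [margY, Finset.mul_sum, ← Finset.sum_add_distrib]

lemma jointDists_convex (P : X → ℝ) {Q Q' : X × Y → ℝ} (hQ : Q ∈ jointDists Y P)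
    (hQ' : Q' ∈ jointDists Y P) {s t : ℝ} (hs : 0 ≤ s) (ht : 0 ≤ t) (hst : s + t = 1) :
    s • Q + t • Q' ∈ jointDists Y P := by
  refine ⟨convex_stdSimplex ℝ _ hQ.1 hQ'.1 hs ht hst, ?_⟩
  rw [margX_add, hQ.2, hQ'.2, ← add_smul, hst, one_smul]

lemma isCompact_jointDists (P : X → ℝ) : IsCompact (jointDists Y P) := by
  have : jointDists Y P = stdSimplex ℝ (X × Y) ∩ margX ⁻¹' {P} := rfl
  rw [this]
  exact (isCompact_stdSimplex ℝ (X × Y)).inter_right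
    (isClosed_singleton.preimage continuous_margX)

lemma le_margX {Q : X × Y → ℝ} (hQ : ∀ s, 0 ≤ Q s) (x : X) (y : Y) : Q (x, y) ≤ margX Q x :=
  Finset.single_le_sum (f := fun y => Q (x, y)) (fun _ _ => hQ _) (Finset.mem_univ y)

lemma le_margY {Q : X × Y → ℝ} (hQ : ∀ s, 0 ≤ Q s) (x : X) (y : Y) : Q (x, y) ≤ margY Q y :=
  Finset.single_le_sum (f := fun x => Q (x, y)) (fun _ _ => hQ _) (Finset.mem_univ x)

lemma sum_mul_log_margX (Q : X × Y → ℝ) :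
    ∑ x, ∑ y, Q (x, y) * Real.log (margX Q x) = phi (margX Q) := by
  unfold phi
  refine Finset.sum_congr rfl fun x _ => ?_
  rw [← Finset.sum_mul]
  rfl

lemma sum_mul_log_margY (Q : X × Y → ℝ) :
    ∑ x, ∑ y, Q (x, y) * Real.log (margY Q y) = phi (margY Q) := by
  unfold phi
  rw [Finset.sum_comm]
  refine Finset.sum_congr rfl fun x _ => ?_
  rw [← Finset.sum_mul]
  rfl

lemma phi_prod (Q : X × Y → ℝ) : phi Q = ∑ x, ∑ y, Q (x, y) * Real.log (Q (x, y)) := by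
  rw [phi, Fintype.sum_prod_type]

/-- The mutual information as a difference of entropies, for a fixed first marginal `P`. -/
noncomputable def info (P : X → ℝ) (Q : X × Y → ℝ) : ℝ := phi Q - phi P - phi (margY Q)

/-- The conditional divergence as a difference of entropies, for a fixed first marginal `P`. -/
noncomputable def cdiv (W : X → Y → ℝ) (P : X → ℝ) (Q : X × Y → ℝ) : ℝ :=
  phi Q - phi P - linLik W Q

lemma continuous_info (P : X → ℝ) : Continuous (info P : (X × Y → ℝ) → ℝ) := by
  unfold info
  exact (continuous_phi.sub continuous_const).sub (continuous_phi.comp continuous_margY)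

lemma continuous_cdiv (W : X → Y → ℝ) (P : X → ℝ) : Continuous (cdiv W P) := by
  unfold cdiv
  exact (continuous_phi.sub continuous_const).sub (continuous_linLik W)

lemma mutualInfo_eq {P : X → ℝ} {Q : X × Y → ℝ} (hQ : Q ∈ jointDists Y P) :
    mutualInfo Q = info P Q := by
  rw [info, ← hQ.2, ← sum_mul_log_margX, ← sum_mul_log_margY, phi_prod]
  simp only [mutualInfo, ← Finset.sum_sub_distrib]
  refine Finset.sum_congr rfl fun x _ => Finset.sum_congr rfl fun y _ => ?_
  rcases (hQ.1.1 (x, y)).eq_or_lt with h | h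
  · simp [← h]
  have h1 := h.trans_le (le_margX hQ.1.1 x y)
  have h2 := h.trans_le (le_margY hQ.1.1 x y)
  rw [Real.log_div h.ne' (by positivity), Real.log_mul h1.ne' h2.ne']
  ring

lemma condDiv_of_suppIn {W : X → Y → ℝ} {P : X → ℝ} {Q : X × Y → ℝ} (hQ : Q ∈ jointDists Y P)
    (h : SuppIn W Q) : condDiv W Q = (cdiv W P Q : EReal) := by
  rw [condDiv, if_pos (show ∀ x y, W x y = 0 → Q (x, y) = 0 from h), cdiv, linLik, ← hQ.2, ← sum_mul_log_margX, phi_prod]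
  congr 1
  simp only [← Finset.sum_sub_distrib, Finset.mul_sum]
  refine Finset.sum_congr rfl fun x _ => Finset.sum_congr rfl fun y _ => ?_
  rcases (hQ.1.1 (x, y)).eq_or_lt with h0 | h0
  · simp [← h0]
  have h1 := h0.trans_le (le_margX hQ.1.1 x y)
  have h2 : W x y ≠ 0 := fun hw => h0.ne' (h x y hw)
  rw [Real.log_div (by positivity) h2, Real.log_div h0.ne' h1.ne']
  field_simp

lemma condDiv_of_not_suppIn {W : X → Y → ℝ} {Q : X × Y → ℝ} (h : ¬ SuppIn W Q) :
    condDiv W Q = ⊤ := if_neg h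

lemma suppIn_add {W : X → Y → ℝ} {Q Q' : X × Y → ℝ} (h : SuppIn W Q) (h' : SuppIn W Q')
    (s t : ℝ) : SuppIn W (s • Q + t • Q') := fun x y hw => by
  simp [h x y hw, h' x y hw]

end Info

/-! ### Joint types -/

section Types

variable {A X Y : Type*} [Fintype A] [Fintype X] [Fintype Y] [DecidableEq A] [DecidableEq X]
  [DecidableEq Y]

lemma empDist_mem_stdSimplex {n : ℕ} (hn : 0 < n) (a : Fin n → A) :
    empDist a ∈ stdSimplex ℝ A := by
  have hn' : (n : ℝ) ≠ 0 := by positivity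
  refine ⟨fun s => by rw [empDist_eq]; positivity, ?_⟩
  simp only [empDist_eq]
  rw [← Finset.sum_div, div_eq_one_iff_eq hn']
  have := sum_cnt a
  rw [Fintype.card_fin] at this
  exact_mod_cast this

lemma cnt_swap {n : ℕ} (x : Fin n → X) (y : Fin n → Y) (s : X) (t : Y) :
    cnt (fun i => (y i, x i)) (t, s) = cnt (fun i => (x i, y i)) (s, t) := by
  simp only [cnt, Prod.mk.injEq, and_comm]

lemma margX_empJoint {n : ℕ} (x : Fin n → X) (y : Fin n → Y) :
    margX (empJoint x y) = empDist x := by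
  funext s
  simp only [margX, empJoint, empDist_eq]
  rw [← Finset.sum_div, ← sum_cnt_pair x y s]
  push_cast
  rfl

lemma margY_empJoint {n : ℕ} (x : Fin n → X) (y : Fin n → Y) :
    margY (empJoint x y) = empDist y := by
  funext s
  simp only [margY, empJoint, empDist_eq]
  rw [← Finset.sum_div, ← sum_cnt_pair y x s]
  push_cast
  simp only [cnt_swap x y]

lemma phi_empJoint_swap {n : ℕ} (x : Fin n → X) (y : Fin n → Y) :
    phi (empJoint y x) = phi (empJoint x y) := by
  rw [phi_prod, phi_prod, Finset.sum_comm]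
  simp only [empJoint, empDist_eq, cnt_swap x y]

lemma mem_typeClass {P : X → ℝ} {n : ℕ} {x : Fin n → X} : x ∈ typeClass P n ↔ empDist x = P := by
  simp [typeClass]

lemma empJoint_mem {P : X → ℝ} {n : ℕ} (hn : 0 < n) {x : Fin n → X} (hx : x ∈ typeClass P n)
    (y : Fin n → Y) : empJoint x y ∈ jointDists Y P :=
  ⟨empDist_mem_stdSimplex hn _, by rw [margX_empJoint, mem_typeClass.mp hx]⟩

lemma exists_empDist_eq {n : ℕ} (hn : 0 < n) {Q : A → ℝ} (hQ : ∑ s, Q s = 1) {c : A → ℕ}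
    (hc : ∀ s, n * Q s = c s) : ∃ a : Fin n → A, empDist a = Q := by
  have hn' : (n : ℝ) ≠ 0 := by positivity
  have h1 : ∑ s, c s = n := by
    have : (∑ s, (c s : ℝ)) = n := by
      rw [← Finset.sum_congr rfl fun s _ => hc s, ← Finset.mul_sum, hQ, mul_one]
    exact_mod_cast this
  obtain ⟨b, hb⟩ := exists_joint_cnt (fun _ : Fin n => ()) (fun p : Unit × A => c p.2)
    (fun s => by rw [h1]; simp [cnt])
  refine ⟨b, funext fun s => ?_⟩
  have h2 := hb ((), s)
  simp only [cnt, Prod.mk.injEq, true_and] at h2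
  rw [empDist_eq, cnt, h2, ← hc, mul_div_cancel_left₀ _ hn']

lemma exists_empJoint_eq {n : ℕ} (hn : 0 < n) {Q : X × Y → ℝ} {c : X × Y → ℕ}
    (hc : ∀ s, n * Q s = c s) {x : Fin n → X} (hx : empDist x = margX Q) :
    ∃ y : Fin n → Y, empJoint x y = Q := by
  have hn' : (n : ℝ) ≠ 0 := by positivity
  obtain ⟨b, hb⟩ := exists_joint_cnt x c (fun s => by
    have h1 := congrFun hx s
    rw [empDist_eq, margX, div_eq_iff hn', Finset.sum_mul] at h1
    have : ((∑ t, c (s, t) : ℕ) : ℝ) = cnt x s := by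
      rw [h1]
      push_cast
      exact Finset.sum_congr rfl fun t _ => by rw [← hc, mul_comm]
    exact_mod_cast this)
  refine ⟨b, funext fun s => ?_⟩
  rw [empJoint, empDist_eq, hb s, ← hc, mul_div_cancel_left₀ _ hn']

lemma exists_empJoint_eq' {n : ℕ} (hn : 0 < n) {Q : X × Y → ℝ} {c : X × Y → ℕ}
    (hc : ∀ s, n * Q s = c s) {y : Fin n → Y} (hy : empDist y = margY Q) :
    ∃ x : Fin n → X, empJoint x y = Q := by
  obtain ⟨x, hx⟩ := exists_empJoint_eq hn (Q := fun p : Y × X => Q (p.2, p.1))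
    (c := fun p => c (p.2, p.1)) (fun s => hc _) (x := y) (by rw [hy]; rfl)
  refine ⟨x, funext fun s => ?_⟩
  have h1 := congrFun hx (s.2, s.1)
  simpa only [empJoint, empDist_eq, cnt_swap x y] using h1

/-- The exponent of the polynomial factor in the estimates. -/
noncomputable def slackC (X Y : Type*) [Fintype X] [Fintype Y] : ℝ :=
  ((Fintype.card X : ℝ) + 1) * ((Fintype.card Y : ℝ) + 1)

lemma slack_nonneg (n : ℕ) : 0 ≤ slack n := zero_le_one.trans (slack_ge_one n)

/-- Conditioning on a constant vector over a one-letter alphabet turns the bounds for conditional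
classes into bounds for type classes. -/
lemma typeClass_eq_condClass {P : X → ℝ} {n : ℕ} (hn : 0 < n) {x : Fin n → X}
    (hx : x ∈ typeClass P n) : typeClass P n = condClass (fun _ : Fin n => ()) x := by
  ext z
  rw [mem_typeClass] at *
  subst hx
  rw [empDist_eq_iff hn]
  simp [condClass, cnt]

lemma phi_unit {P : X → ℝ} {n : ℕ} (hn : 0 < n) {x : Fin n → X}
    (hx : x ∈ typeClass P n) :
    phi (empDist (fun _ : Fin n => ())) - phi (empJoint (fun _ : Fin n => ()) x) = - phi P := by
  have hn' : (n : ℝ) ≠ 0 := by positivity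
  rw [mem_typeClass] at hx
  subst hx
  rw [phi_prod]
  simp [phi, empJoint, empDist, hn']

lemma card_typeClass_le {P : X → ℝ} {n : ℕ} (hn : 0 < n) (hT : (typeClass P n).Nonempty) :
    ((typeClass P n).card : ℝ) ≤ Real.exp (-(n * phi P) + slack n) := by
  obtain ⟨x, hx⟩ := hT
  have := card_condClass_le hn (fun _ : Fin n => ()) x
  rw [phi_unit hn hx, ← typeClass_eq_condClass hn hx] at this
  simpa using this

lemma card_typeClass_ge {P : X → ℝ} {n : ℕ} (hn : 0 < n) (hT : (typeClass P n).Nonempty) :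
    Real.exp (-(n * phi P) - Fintype.card X * slack n) ≤ ((typeClass P n).card : ℝ) := by
  obtain ⟨x, hx⟩ := hT
  have := card_condClass_ge hn (fun _ : Fin n => ()) x
  rw [phi_unit hn hx, ← typeClass_eq_condClass hn hx] at this
  simpa using this

/-- The vectors `z` with the same joint type with `y` as `x`. -/
def revClass {n : ℕ} (x : Fin n → X) (y : Fin n → Y) : Finset (Fin n → X) := condClass y x

lemma mem_revClass {n : ℕ} (hn : 0 < n) {x z : Fin n → X} {y : Fin n → Y} :
    z ∈ revClass x y ↔ empJoint z y = empJoint x y := by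
  simp only [revClass, condClass, mem_filter, mem_univ, true_and, empJoint]
  rw [empDist_eq_iff hn]
  constructor
  · rintro h ⟨s, t⟩
    rw [← cnt_swap, h, cnt_swap]
  · rintro h ⟨s, t⟩
    rw [cnt_swap, h, cnt_swap]

lemma revClass_subset {P : X → ℝ} {n : ℕ} (hn : 0 < n) {x : Fin n → X} {y : Fin n → Y}
    (hx : x ∈ typeClass P n) : revClass x y ⊆ typeClass P n := by
  intro z hz
  rw [mem_revClass hn] at hz
  rw [mem_typeClass, ← margX_empJoint z y, hz, margX_empJoint, mem_typeClass.mp hx]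

/-- This is the probability that a random codeword has the joint type of `x` with `y`: exp(n(phi Q_Y
- phi Q)) vectors out of exp(-n phi P), and the exponents combine to -nI(Q). -/
lemma card_revClass_div_le {P : X → ℝ} {n : ℕ} (hn : 0 < n) {x : Fin n → X} {y : Fin n → Y}
    (hx : x ∈ typeClass P n) :
    ((revClass x y).card : ℝ) / (typeClass P n).card ≤
      Real.exp (-(n * info P (empJoint x y)) + slackC X Y * slack n) := by
  have h1 := card_condClass_le hn y x
  have h2 := card_typeClass_ge hn ⟨x, hx⟩
  have h3 : (0 : ℝ) < (typeClass P n).card := (Real.exp_pos _).trans_le h2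
  rw [div_le_iff₀ h3]
  refine h1.trans ((le_trans ?_ (mul_le_mul_of_nonneg_left h2 (Real.exp_pos _).le)))
  rw [← Real.exp_add, Real.exp_le_exp, info, margY_empJoint, phi_empJoint_swap, slackC]
  have : 0 ≤ ((Fintype.card X : ℝ) * Fintype.card Y + 1) * slack n :=
    mul_nonneg (by positivity) (slack_nonneg n)
  nlinarith

lemma card_revClass_div_ge {P : X → ℝ} {n : ℕ} (hn : 0 < n) {x : Fin n → X} {y : Fin n → Y}
    (hx : x ∈ typeClass P n) :
    Real.exp (-(n * info P (empJoint x y)) - slackC X Y * slack n) ≤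
    ((revClass x y).card : ℝ) / (typeClass P n).card := by
  have h1 := card_condClass_ge hn y x
  have h2 := card_typeClass_le hn ⟨x, hx⟩
  have h3 : (0 : ℝ) < (typeClass P n).card := by
    exact_mod_cast Finset.card_pos.mpr ⟨x, hx⟩
  rw [le_div_iff₀ h3]
  refine ((mul_le_mul_of_nonneg_left h2 (Real.exp_pos _).le)).trans (le_trans ?_ h1)
  rw [← Real.exp_add, Real.exp_le_exp, info, margY_empJoint, phi_empJoint_swap, slackC]
  have : 0 ≤ ((Fintype.card X : ℝ) + Fintype.card Y) * slack n :=
    mul_nonneg (by positivity) (slack_nonneg n)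
  nlinarith

lemma chanProb_nonneg {W : X → Y → ℝ} (hW : ∀ x y, 0 ≤ W x y) {n : ℕ} (x : Fin n → X)
    (y : Fin n → Y) : 0 ≤ chanProb W x y := Finset.prod_nonneg fun _ _ => hW _ _

lemma chanProb_eq_prod {W : X → Y → ℝ} {n : ℕ} (x : Fin n → X)
    (y : Fin n → Y) : chanProb W x y = ∏ s, W s.1 s.2 ^ cnt (fun i => (x i, y i)) s := by
  rw [chanProb]
  have := Finset.prod_fiberwise_of_maps_to (s := (univ : Finset (Fin n))) (t := univ)
    (g := fun i => (x i, y i)) (fun i _ => Finset.mem_univ _) (fun i => W (x i) (y i))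
  rw [← this]
  refine Finset.prod_congr rfl fun s _ => ?_
  rw [cnt, ← Finset.prod_const]
  refine Finset.prod_congr rfl fun i hi => ?_
  rw [← (Finset.mem_filter.mp hi).2]

lemma suppIn_empJoint_iff {W : X → Y → ℝ} {n : ℕ} (hn : 0 < n) (x : Fin n → X)
    (y : Fin n → Y) : SuppIn W (empJoint x y) ↔ chanProb W x y ≠ 0 := by
  have hn' : (n : ℝ) ≠ 0 := by positivity
  rw [chanProb_eq_prod, Finset.prod_ne_zero_iff]
  simp only [SuppIn, empJoint, empDist_eq, mem_univ, forall_true_left, Prod.forall]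
  refine forall_congr' fun s => forall_congr' fun t => ?_
  rw [Ne, pow_eq_zero_iff', div_eq_zero_iff]
  simp only [Nat.cast_eq_zero, hn', or_false]
  tauto

lemma chanProb_eq_exp {W : X → Y → ℝ} (hW : ∀ x y, 0 ≤ W x y) {n : ℕ} (hn : 0 < n)
    {x : Fin n → X} {y : Fin n → Y} (h : SuppIn W (empJoint x y)) :
    chanProb W x y = Real.exp (n * linLik W (empJoint x y)) := by
  have hn' : (n : ℝ) ≠ 0 := by positivity
  have h0 := (suppIn_empJoint_iff hn x y).mp h
  have h1 : 0 < chanProb W x y := lt_of_le_of_ne (chanProb_nonneg hW x y) h0.symm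
  rw [← Real.exp_log h1]
  congr 1
  rw [chanProb_eq_prod] at *
  rw [Real.log_prod (fun s hs => Finset.prod_ne_zero_iff.mp h0 s hs), linLik, Finset.mul_sum,
    Fintype.sum_prod_type]
  refine Finset.sum_congr rfl fun s _ => ?_
  rw [Finset.mul_sum]
  refine Finset.sum_congr rfl fun t _ => ?_
  rw [Real.log_pow, empJoint, empDist_eq]
  field_simp

lemma mem_condClass {n : ℕ} (hn : 0 < n) {x : Fin n → X} {y z : Fin n → Y} :
    z ∈ condClass x y ↔ empJoint x z = empJoint x y := by
  simp only [condClass, mem_filter, mem_univ, true_and, empJoint]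
  rw [empDist_eq_iff hn]

lemma sum_chanProb_condClass {W : X → Y → ℝ} (hW : ∀ x y, 0 ≤ W x y) {n : ℕ} (hn : 0 < n)
    {x : Fin n → X} {y : Fin n → Y} (h : SuppIn W (empJoint x y)) :
    ∑ z ∈ condClass x y, chanProb W x z =
      (condClass x y).card * Real.exp (n * linLik W (empJoint x y)) := by
  rw [Finset.sum_congr rfl (g := fun _ => Real.exp (n * linLik W (empJoint x y)))]
  · simp
  · intro z hz
    rw [mem_condClass hn] at hz
    rw [← hz] at h ⊢
    exact chanProb_eq_exp hW hn h

/-- All outputs of one joint type Q with `x` have the same probability exp(n·f(Q)), and there are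
about exp(n(phi P - phi Q)) of them; the product is exp(-nD). -/
lemma sum_chanProb_condClass_le {W : X → Y → ℝ} (hW : ∀ x y, 0 ≤ W x y) {P : X → ℝ} {n : ℕ}
    (hn : 0 < n) {x : Fin n → X} (hx : x ∈ typeClass P n) {y : Fin n → Y}
    (h : SuppIn W (empJoint x y)) :
    ∑ z ∈ condClass x y, chanProb W x z ≤
      Real.exp (-(n * cdiv W P (empJoint x y)) + slackC X Y * slack n) := by
  rw [sum_chanProb_condClass hW hn h]
  refine (mul_le_mul_of_nonneg_right (card_condClass_le hn x y) (Real.exp_pos _).le).trans ?_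
  rw [← Real.exp_add, Real.exp_le_exp, cdiv, mem_typeClass.mp hx, slackC]
  have : 0 ≤ ((Fintype.card X : ℝ) * Fintype.card Y + Fintype.card Y + 1) * slack n :=
    mul_nonneg (by positivity) (slack_nonneg n)
  nlinarith

lemma sum_chanProb_condClass_ge {W : X → Y → ℝ} (hW : ∀ x y, 0 ≤ W x y) {P : X → ℝ} {n : ℕ}
    (hn : 0 < n) {x : Fin n → X} (hx : x ∈ typeClass P n) {y : Fin n → Y}
    (h : SuppIn W (empJoint x y)) :
    Real.exp (-(n * cdiv W P (empJoint x y)) - slackC X Y * slack n) ≤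
    ∑ z ∈ condClass x y, chanProb W x z := by
  rw [sum_chanProb_condClass hW hn h]
  refine le_trans ?_ (mul_le_mul_of_nonneg_right (card_condClass_ge hn x y) (Real.exp_pos _).le)
  rw [← Real.exp_add, Real.exp_le_exp, cdiv, mem_typeClass.mp hx, slackC]
  have : 0 ≤ ((Fintype.card X : ℝ) + Fintype.card Y + 1) * slack n :=
    mul_nonneg (by positivity) (slack_nonneg n)
  nlinarith

end Types

/-! ### Rational approximation of joint distributions -/

section Rational

variable {X Y : Type*} [Fintype X] [Fintype Y] [DecidableEq X] [DecidableEq Y]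

/-- `Q` has rational values with common denominator `N`. -/
def HasDenom {A : Type*} (N : ℕ) (Q : A → ℝ) : Prop := ∀ s, ∃ c : ℕ, (N : ℝ) * Q s = c

lemma HasDenom.of_dvd {A : Type*} {N n : ℕ} {Q : A → ℝ} (h : HasDenom N Q) (hn : N ∣ n) :
    HasDenom n Q := by
  obtain ⟨k, rfl⟩ := hn
  intro s
  obtain ⟨c, hc⟩ := h s
  exact ⟨k * c, by push_cast; rw [← hc]; ring⟩

lemma exists_hasDenom {A : Type*} [Fintype A] (q : A → ℚ) (hq : ∀ s, (0 : ℝ) ≤ q s) :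
    ∃ N : ℕ, 0 < N ∧ HasDenom N (fun s => (q s : ℝ)) := by
  classical
  refine ⟨∏ s, (q s).den, Finset.prod_pos fun s _ => (q s).den_pos, fun s => ?_⟩
  have h0 : 0 ≤ (q s).num := Rat.num_nonneg.mpr (by exact_mod_cast hq s)
  refine ⟨(∏ t ∈ univ.erase s, (q t).den) * (q s).num.toNat, ?_⟩
  rw [← Finset.mul_prod_erase univ _ (Finset.mem_univ s)]
  have h1 : (((q s).num.toNat : ℕ) : ℝ) = ((q s).num : ℝ) := by
    exact_mod_cast congrArg (Int.cast : ℤ → ℝ) (Int.toNat_of_nonneg h0)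
  have h2 : ((q s).den : ℝ) * (q s : ℝ) = (q s).num := by
    exact_mod_cast Rat.den_mul_eq_num (q s)
  push_cast
  rw [h1, ← h2]
  ring

/-- The image of `Q` under a `ℚ`-linear map `ℝ → ℚ`. -/
noncomputable def ratImage {A : Type*} (φ : ℝ →ₗ[ℚ] ℚ) (Q : A → ℝ) : A → ℝ := fun s => (φ (Q s) : ℝ)

lemma margY_ratImage (φ : ℝ →ₗ[ℚ] ℚ) (Q : X × Y → ℝ) :
    margY (ratImage φ Q) = ratImage φ (margY Q) := by
  funext y
  simp [margY, ratImage, map_sum]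

lemma margX_ratImage (φ : ℝ →ₗ[ℚ] ℚ) (Q : X × Y → ℝ) :
    margX (ratImage φ Q) = ratImage φ (margX Q) := by
  funext y
  simp [margX, ratImage, map_sum]

lemma ratImage_eq_self {A : Type*} {φ : ℝ →ₗ[ℚ] ℚ} (hφ : φ 1 = 1) {Q : A → ℝ} {N : ℕ}
    (hN : 0 < N) (hQ : HasDenom N Q) : ratImage φ Q = Q := by
  funext s
  obtain ⟨c, hc⟩ := hQ s
  have hN' : (N : ℝ) ≠ 0 := by positivity
  have h1 : Q s = ((c : ℚ) / N) • (1 : ℝ) := by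
    rw [Rat.smul_def, mul_one]
    push_cast
    rw [← hc]
    field_simp
  rw [ratImage, h1, map_smul, hφ, Rat.smul_def]
  simp

lemma suppIn_ratImage {W : X → Y → ℝ} {Q : X × Y → ℝ} (h : SuppIn W Q) (φ : ℝ →ₗ[ℚ] ℚ) :
    SuppIn W (ratImage φ Q) := fun x y hw => by simp [ratImage, h x y hw]

lemma tendsto_ratImage {A : Type*} {φ : ℕ → (ℝ →ₗ[ℚ] ℚ)}
    (hφ : ∀ v : ℝ, Tendsto (fun k => (φ k v : ℝ)) atTop (nhds v)) (Q : A → ℝ) :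
    Tendsto (fun k => ratImage (φ k) Q) atTop (nhds Q) :=
  tendsto_pi_nhds.mpr fun s => hφ (Q s)

/-- Linearity sends zero entries exactly to zero, and positive entries remain positive for large `k`
by convergence. Mere approximation would not protect the zeros. -/
lemma eventually_ratImage_nonneg {A : Type*} [Fintype A] {φ : ℕ → (ℝ →ₗ[ℚ] ℚ)}
    (hφ : ∀ v : ℝ, Tendsto (fun k => (φ k v : ℝ)) atTop (nhds v)) {Q : A → ℝ}
    (hQ : ∀ s, 0 ≤ Q s) : ∀ᶠ k in atTop, ∀ s, 0 ≤ ratImage (φ k) Q s := by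
  rw [eventually_all]
  intro s
  rcases (hQ s).eq_or_lt with h | h
  · exact Eventually.of_forall fun k => by simp [ratImage, ← h]
  · exact ((hφ (Q s)).eventually_const_lt h).mono fun k hk => hk.le

lemma eventually_ratImage_mem {φ : ℕ → (ℝ →ₗ[ℚ] ℚ)} (h1 : ∀ k, φ k 1 = 1)
    (hφ : ∀ v : ℝ, Tendsto (fun k => (φ k v : ℝ)) atTop (nhds v)) {P : X → ℝ} {N : ℕ}
    (hN : 0 < N) (hP : HasDenom N P) {Q : X × Y → ℝ} (hQ : Q ∈ jointDists Y P) :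
    ∀ᶠ k in atTop, ratImage (φ k) Q ∈ jointDists Y P := by
  filter_upwards [eventually_ratImage_nonneg hφ hQ.1.1] with k hk
  refine ⟨⟨hk, ?_⟩, ?_⟩
  · have : ∑ s, ratImage (φ k) Q s = ((φ k (∑ s, Q s) : ℚ) : ℝ) := by
      simp [ratImage, map_sum]
    rw [this, hQ.1.2, h1, Rat.cast_one]
  · rw [margX_ratImage, hQ.2, ratImage_eq_self (h1 k) hN hP]

lemma exists_hasDenom_ratImage {A : Type*} [Fintype A] {φ : ℝ →ₗ[ℚ] ℚ} {Q : A → ℝ}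
    (h : ∀ s, 0 ≤ ratImage φ Q s) : ∃ N : ℕ, 0 < N ∧ HasDenom N (ratImage φ Q) :=
  exists_hasDenom (fun s => φ (Q s)) h

lemma hasDenom_of_typeClass {P : X → ℝ} {n : ℕ} (hn : 0 < n) (h : (typeClass P n).Nonempty) :
    HasDenom n P := by
  obtain ⟨x, hx⟩ := h
  intro s
  refine ⟨cnt x s, ?_⟩
  have : (n : ℝ) ≠ 0 := by positivity
  rw [← mem_typeClass.mp hx, empDist_eq]
  field_simp

end Rational

/-! ### The error exponent -/

section ErrorExponent

variable {X Y : Type*} [Fintype X] [Fintype Y] [DecidableEq X] [DecidableEq Y]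

open Classical in
/-- The vectors in the type class that beat the threshold set by `x`. -/
noncomputable def badSet (W : X → Y → ℝ) (P : X → ℝ) (T : ℝ) {n : ℕ} (x : Fin n → X)
    (y : Fin n → Y) : Finset (Fin n → X) :=
  (typeClass P n).filter fun z =>
    ¬ (T : EReal) + logLik W (empJoint z y) ≤ logLik W (empJoint x y)

open Classical in
lemma okFrac_eq (W : X → Y → ℝ) (P : X → ℝ) (T : ℝ) {n : ℕ} (hT : (typeClass P n).Nonempty)
    (x : Fin n → X) (y : Fin n → Y) :
    okFrac W P T x y = 1 - ((badSet W P T x y).card : ℝ) / (typeClass P n).card := by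
  have hc : ((typeClass P n).card : ℝ) ≠ 0 := by exact_mod_cast Finset.card_ne_zero.mpr hT
  have h := Finset.card_filter_add_card_filter_not (s := typeClass P n) (fun z =>
    (T : EReal) + logLik W (empJoint z y) ≤ logLik W (empJoint x y))
  have h' : (((typeClass P n).filter fun z =>
    (T : EReal) + logLik W (empJoint z y) ≤ logLik W (empJoint x y)).card : ℝ) +
      (badSet W P T x y).card = (typeClass P n).card := by exact_mod_cast h
  rw [okFrac, ← h', eq_sub_iff_add_eq, ← add_div]
  rw [h', div_self hc]

lemma okFrac_nonneg (W : X → Y → ℝ) (P : X → ℝ) (T : ℝ) {n : ℕ}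
    (x : Fin n → X) (y : Fin n → Y) : 0 ≤ okFrac W P T x y := by
  unfold okFrac
  positivity

lemma okFrac_le_one (W : X → Y → ℝ) (P : X → ℝ) (T : ℝ) {n : ℕ} (hT : (typeClass P n).Nonempty)
    (x : Fin n → X) (y : Fin n → Y) : okFrac W P T x y ≤ 1 := by
  rw [okFrac_eq W P T hT]
  have : 0 ≤ ((badSet W P T x y).card : ℝ) / (typeClass P n).card := by positivity
  linarith

lemma codeSize_sub_one_le (R : ℝ) (n : ℕ) : (codeSize R n : ℝ) - 1 ≤ Real.exp (n * R) := by
  have := Nat.ceil_lt_add_one (Real.exp_pos ((n : ℝ) * R)).le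
  rw [codeSize]
  linarith

lemma two_le_codeSize {R : ℝ} (hR : 0 < R) {n : ℕ} (hn : 0 < n) : 2 ≤ codeSize R n := by
  have h1 : (1 : ℝ) < Real.exp (n * R) := Real.one_lt_exp_iff.mpr (by positivity)
  have h2 : ((1 : ℕ) : ℝ) < Real.exp (n * R) := by exact_mod_cast h1
  exact Nat.lt_ceil.mpr h2

lemma half_exp_le_codeSize_sub_one {R : ℝ} (hR : 0 < R) {n : ℕ} (hn : 0 < n) :
    Real.exp (n * R) / 2 ≤ (codeSize R n : ℝ) - 1 := by
  have h1 : (2 : ℝ) ≤ codeSize R n := by exact_mod_cast two_le_codeSize hR hn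
  have h2 : Real.exp (n * R) ≤ codeSize R n := Nat.le_ceil _
  linarith

/-- With t = (M-1)p this turns the bound (1-p)^(M-1) ≤ e^{-t} into an error probability of at least
min(1,t)/2, the source of the positive part in the exponent. -/
lemma exp_neg_le {t : ℝ} (ht : 0 ≤ t) : Real.exp (-t) ≤ 1 - min 1 t / 2 := by
  have h1 : Real.exp (-t) ≤ 1 / (1 + t) := by
    rw [Real.exp_neg, ← one_div]
    exact one_div_le_one_div_of_le (by linarith) (by linarith [Real.add_one_le_exp t])
  refine h1.trans ?_
  rw [div_le_iff₀ (by linarith)]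
  rcases le_total 1 t with h | h
  · rw [min_eq_left h]; linarith
  · rw [min_eq_right h]; nlinarith

lemma card_mul_le_slackC (n : ℕ) :
    (Fintype.card (X × Y) : ℝ) * slack n ≤ slackC X Y * slack n := by
  refine mul_le_mul_of_nonneg_right ?_ (slack_nonneg n)
  rw [Fintype.card_prod, slackC]
  push_cast
  have h1 : (0 : ℝ) ≤ Fintype.card X := Nat.cast_nonneg _
  have h2 : (0 : ℝ) ≤ Fintype.card Y := Nat.cast_nonneg _
  nlinarith

lemma slackC_nonneg : 0 ≤ slackC X Y := by unfold slackC; positivity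

lemma suppIn_of_not_le {W : X → Y → ℝ} {T : ℝ} {Q Q' : X × Y → ℝ} (h : SuppIn W Q)
    (h' : ¬ (T : EReal) + logLik W Q' ≤ logLik W Q) :
    SuppIn W Q' ∧ linLik W Q < T + linLik W Q' := by
  have h1 : SuppIn W Q' := by
    by_contra hn
    rw [logLik_of_not_suppIn hn] at h'
    simp at h'
  refine ⟨h1, ?_⟩
  rw [logLik_of_suppIn h, logLik_of_suppIn h1, ← EReal.coe_add, EReal.coe_le_coe_iff] at h'
  exact not_le.mp h'

/-- Split the bad vectors by their joint type with `y`; the dominant type lies in a single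
`revClass`, of relative size about e^{-nI}. -/
lemma badFrac_le {W : X → Y → ℝ} {P : X → ℝ} {T : ℝ} {n : ℕ} (hn : 0 < n) {x : Fin n → X}
    {y : Fin n → Y} (hne : (badSet W P T x y).Nonempty) :
    ∃ x' ∈ badSet W P T x y, ((badSet W P T x y).card : ℝ) / (typeClass P n).card ≤
      Real.exp (-(n * info P (empJoint x' y)) + 2 * slackC X Y * slack n) := by
  obtain ⟨b, hb, hle⟩ := exists_dominant_type hne (fun z i => (z i, y i)) (w := fun _ => 1)
    (fun _ _ => zero_le_one)
  refine ⟨b, hb, ?_⟩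
  have hbT : b ∈ typeClass P n := (Finset.mem_filter.mp hb).1
  have hc : (0 : ℝ) < (typeClass P n).card := by exact_mod_cast Finset.card_pos.mpr ⟨b, hbT⟩
  simp only [sum_const, nsmul_eq_mul, mul_one] at hle
  have hsub : ((badSet W P T x y).filter (fun c => ∀ s, cnt (fun i => (c i, y i)) s =
      cnt (fun i => (b i, y i)) s)) ⊆ revClass b y := by
    intro z hz
    rw [mem_revClass hn, empJoint, empJoint, empDist_eq_iff hn]
    exact (Finset.mem_filter.mp hz).2
  have h2 : ((badSet W P T x y).card : ℝ) ≤
      Real.exp (slackC X Y * slack n) * (revClass b y).card := by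
    refine hle.trans (mul_le_mul ?_ ?_ (by positivity) (Real.exp_pos _).le)
    · exact Real.exp_le_exp.mpr (card_mul_le_slackC n)
    · exact_mod_cast Finset.card_le_card hsub
  have h3 := card_revClass_div_le (y := y) hn hbT
  calc ((badSet W P T x y).card : ℝ) / (typeClass P n).card
      ≤ Real.exp (slackC X Y * slack n) * ((revClass b y).card / (typeClass P n).card) := by
        rw [← mul_div_assoc]
        exact div_le_div_of_nonneg_right h2 hc.le
    _ ≤ Real.exp (slackC X Y * slack n) *
        Real.exp (-(n * info P (empJoint b y)) + slackC X Y * slack n) :=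
        mul_le_mul_of_nonneg_left h3 (Real.exp_pos _).le
    _ = _ := by rw [← Real.exp_add]; congr 1; ring

/-- Grouping the outputs by joint type. -/
lemma exists_dominant_output {W : X → Y → ℝ} (hW : ∀ x y, 0 ≤ W x y) {P : X → ℝ} {n : ℕ}
    (hn : 0 < n) {x : Fin n → X} (hx : x ∈ typeClass P n) {e : (Fin n → Y) → ℝ}
    (he : ∀ y, 0 ≤ e y) (hpos : 0 < ∑ y, chanProb W x y * e y) :
    ∃ y, SuppIn W (empJoint x y) ∧ 0 < e y ∧ ∑ y, chanProb W x y * e y ≤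
      Real.exp (-(n * cdiv W P (empJoint x y)) + 2 * slackC X Y * slack n) * e y := by
  set S := (univ : Finset (Fin n → Y)).filter fun y => chanProb W x y * e y ≠ 0 with hS
  have hsum : ∑ y, chanProb W x y * e y = ∑ y ∈ S, chanProb W x y * e y :=
    (Finset.sum_filter_ne_zero _).symm
  have hSne : S.Nonempty := by
    rw [Finset.nonempty_iff_ne_empty]
    intro h
    rw [hsum, h] at hpos
    simp at hpos
  have hnn : ∀ y, 0 ≤ chanProb W x y * e y :=
    fun y => mul_nonneg (chanProb_nonneg hW x y) (he y)
  obtain ⟨b, hb, hle⟩ := exists_dominant_type hSne (fun y i => (x i, y i))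
    (w := fun y => chanProb W x y * e y) (fun y _ => hnn y)
  set S' := S.filter (fun c => ∀ s, cnt (fun i => (x i, c i)) s = cnt (fun i => (x i, b i)) s)
    with hS'
  have hbS' : b ∈ S' := Finset.mem_filter.mpr ⟨hb, fun _ => rfl⟩
  -- No invariance of `e` on the joint type is assumed, hence the choice of a maximizer within the
  -- dominant type.
  obtain ⟨y, hy, hmax⟩ := S'.exists_max_image e ⟨b, hbS'⟩
  have hyS : y ∈ S := (Finset.mem_filter.mp hy).1
  have hy0 : chanProb W x y * e y ≠ 0 := (Finset.mem_filter.mp hyS).2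
  have hsupp : SuppIn W (empJoint x y) :=
    (suppIn_empJoint_iff hn x y).mpr (left_ne_zero_of_mul hy0)
  refine ⟨y, hsupp, lt_of_le_of_ne (he y) (right_ne_zero_of_mul hy0).symm, ?_⟩
  have hsub : S' ⊆ condClass x y := by
    intro z hz
    simp only [condClass, mem_filter, mem_univ, true_and]
    intro s
    rw [(Finset.mem_filter.mp hz).2 s, (Finset.mem_filter.mp hy).2 s]
  have h1 : ∑ z ∈ S', chanProb W x z * e z ≤
      Real.exp (-(n * cdiv W P (empJoint x y)) + slackC X Y * slack n) * e y := by
    calc ∑ z ∈ S', chanProb W x z * e z ≤ ∑ z ∈ S', chanProb W x z * e y :=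
          Finset.sum_le_sum fun z hz =>
            mul_le_mul_of_nonneg_left (hmax z hz) (chanProb_nonneg hW x z)
      _ = (∑ z ∈ S', chanProb W x z) * e y := by rw [Finset.sum_mul]
      _ ≤ (∑ z ∈ condClass x y, chanProb W x z) * e y :=
          mul_le_mul_of_nonneg_right (Finset.sum_le_sum_of_subset_of_nonneg hsub
            fun z _ _ => chanProb_nonneg hW x z) (he y)
      _ ≤ _ := mul_le_mul_of_nonneg_right (sum_chanProb_condClass_le hW hn hx hsupp) (he y)
  rw [hsum]
  refine hle.trans ?_
  calc _ ≤ Real.exp (slackC X Y * slack n) *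
        (Real.exp (-(n * cdiv W P (empJoint x y)) + slackC X Y * slack n) * e y) := by
        refine mul_le_mul ?_ h1 (Finset.sum_nonneg fun z _ => hnn z) (Real.exp_pos _).le
        exact Real.exp_le_exp.mpr (card_mul_le_slackC n)
    _ = _ := by rw [← mul_assoc, ← Real.exp_add]; congr 2; ring

/-- The exponent of a pair of joint types in the error probability. -/
noncomputable def errVal (W : X → Y → ℝ) (P : X → ℝ) (R : ℝ) (z : (X × Y → ℝ) × (X × Y → ℝ)) : ℝ :=
  cdiv W P z.1 + max (info P z.2 - R) 0

lemma continuous_errVal (W : X → Y → ℝ) (P : X → ℝ) (R : ℝ) : Continuous (errVal W P R) := by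
  unfold errVal
  exact ((continuous_cdiv W P).comp continuous_fst).add
    ((((continuous_info P).comp continuous_snd).sub continuous_const).max continuous_const)

/-- If I ≤ R the trivial bound 1 is enough. Otherwise Bernoulli's inequality gives (M-1)p ≤ e^{nR}p,
a union bound over the competitors. -/
lemma one_sub_okFrac_pow_le {W : X → Y → ℝ} {P : X → ℝ} {R T : ℝ} {n : ℕ}
    (hR : 0 < R) (hn : 0 < n) (hT : (typeClass P n).Nonempty) {x : Fin n → X} {y : Fin n → Y}
    (hpos : 0 < 1 - okFrac W P T x y ^ (codeSize R n - 1)) :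
    ∃ x' ∈ badSet W P T x y, 1 - okFrac W P T x y ^ (codeSize R n - 1) ≤
      Real.exp (-(n * max (info P (empJoint x' y) - R) 0) + 2 * slackC X Y * slack n) := by
  set p := ((badSet W P T x y).card : ℝ) / (typeClass P n).card with hp
  have hok : okFrac W P T x y = 1 - p := okFrac_eq W P T hT x y
  have hp1 : 0 ≤ 1 - p := hok ▸ okFrac_nonneg W P T x y
  have hne : (badSet W P T x y).Nonempty := by
    rw [Finset.nonempty_iff_ne_empty]
    intro h
    rw [hok, hp, h] at hpos
    simp at hpos
  obtain ⟨x', hx', hle⟩ := badFrac_le hn hne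
  refine ⟨x', hx', ?_⟩
  rw [hok]
  have hM := two_le_codeSize hR hn
  have hs : 0 ≤ 2 * slackC X Y * slack n :=
    mul_nonneg (mul_nonneg zero_le_two slackC_nonneg) (slack_nonneg n)
  rcases le_total (info P (empJoint x' y) - R) 0 with h | h
  · rw [max_eq_right h]
    have h1 : 0 ≤ (1 - p) ^ (codeSize R n - 1) := pow_nonneg hp1 _
    have h2 : 1 ≤ Real.exp (-((n : ℝ) * 0) + 2 * slackC X Y * slack n) :=
      Real.one_le_exp (by linarith)
    linarith
  · rw [max_eq_left h]
    have h1 := one_add_mul_le_pow (a := -p) (by linarith) (codeSize R n - 1)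
    rw [← sub_eq_add_neg 1 p, Nat.cast_sub (by lia), Nat.cast_one] at h1
    have h2 : ((codeSize R n : ℝ) - 1) * p ≤ Real.exp (n * R) * p :=
      mul_le_mul_of_nonneg_right (codeSize_sub_one_le R n) (by positivity)
    have h3 : Real.exp (n * R) * p ≤ Real.exp (n * R) *
        Real.exp (-(n * info P (empJoint x' y)) + 2 * slackC X Y * slack n) :=
      mul_le_mul_of_nonneg_left hle (Real.exp_pos _).le
    rw [← Real.exp_add] at h3
    have h4 : (n : ℝ) * R + (-(n * info P (empJoint x' y)) + 2 * slackC X Y * slack n) =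
      -(n * (info P (empJoint x' y) - R)) + 2 * slackC X Y * slack n := by ring
    rw [h4] at h3
    linarith

lemma exists_le_of_avg {α : Type*} {S : Finset α} (hS : S.Nonempty) (h : α → ℝ) :
    ∃ x ∈ S, (1 / (S.card : ℝ)) * ∑ x ∈ S, h x ≤ h x := by
  obtain ⟨x, hx, hmax⟩ := S.exists_max_image h hS
  refine ⟨x, hx, ?_⟩
  have hc : (0 : ℝ) < S.card := by exact_mod_cast Finset.card_pos.mpr hS
  rw [one_div, inv_mul_le_iff₀ hc, ← nsmul_eq_mul]
  exact Finset.sum_le_card_nsmul S h _ hmax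

lemma errorAvg_le {W : X → Y → ℝ} (hW : ∀ x y, 0 ≤ W x y) {P : X → ℝ} {R T : ℝ} (hR : 0 < R)
    {n : ℕ} (hn : 0 < n) (hT : (typeClass P n).Nonempty)
    (hpos : 0 < codeAvg P n (codeSize R n) fun C => errorProb W C (decRegion W T C)) :
    ∃ x ∈ typeClass P n, ∃ x' ∈ typeClass P n, ∃ y : Fin n → Y,
      SuppIn W (empJoint x y) ∧ SuppIn W (empJoint x' y) ∧
      linLik W (empJoint x y) < T + linLik W (empJoint x' y) ∧
      codeAvg P n (codeSize R n) (fun C => errorProb W C (decRegion W T C)) ≤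
        Real.exp (-(n * errVal W P R (empJoint x y, empJoint x' y)) +
          4 * slackC X Y * slack n) := by
  rw [codeAvg_errorProb W P T (by have := two_le_codeSize hR hn; lia) hT] at hpos ⊢
  obtain ⟨x, hx, hle⟩ := exists_le_of_avg hT fun x => ∑ y,
        chanProb W x y * (1 - okFrac W P T x y ^ (codeSize R n - 1))
  obtain ⟨y, hsupp, hey, hle2⟩ := exists_dominant_output hW hn hx
    (e := fun y => 1 - okFrac W P T x y ^ (codeSize R n - 1))
    (fun y => sub_nonneg.mpr (pow_le_one₀ (okFrac_nonneg W P T x y) (okFrac_le_one W P T hT x y)))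
    (hpos.trans_le hle)
  obtain ⟨x', hx', hle3⟩ := one_sub_okFrac_pow_le hR hn hT hey
  obtain ⟨hx'T, hbad⟩ := Finset.mem_filter.mp hx'
  obtain ⟨hs', hlt⟩ := suppIn_of_not_le hsupp hbad
  refine ⟨x, hx, x', hx'T, y, hsupp, hs', hlt, hle.trans (hle2.trans ?_)⟩
  refine (mul_le_mul_of_nonneg_left hle3 (Real.exp_pos _).le).trans ?_
  rw [← Real.exp_add, Real.exp_le_exp, errVal]
  exact le_of_eq (by ring)

/-- Every vector with the joint type of `x'` beats the threshold as well, so p is at least about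
e^{-nI}; then `exp_neg_le` applies with t = (M-1)p. -/
lemma one_sub_okFrac_pow_ge {W : X → Y → ℝ} {P : X → ℝ} {R T : ℝ} {n : ℕ}
    (hR : 0 < R) (hn : 0 < n) {x x' : Fin n → X} {y : Fin n → Y} (hx' : x' ∈ typeClass P n)
    (hs : SuppIn W (empJoint x y)) (hs' : SuppIn W (empJoint x' y))
    (hlt : linLik W (empJoint x y) < T + linLik W (empJoint x' y)) :
    Real.exp (-(n * max (info P (empJoint x' y) - R) 0) - (slackC X Y + 2) * slack n) ≤
      1 - okFrac W P T x y ^ (codeSize R n - 1) := by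
  have hT : (typeClass P n).Nonempty := ⟨x', hx'⟩
  set p := ((badSet W P T x y).card : ℝ) / (typeClass P n).card with hp
  have hok : okFrac W P T x y = 1 - p := okFrac_eq W P T hT x y
  have hp1 : 0 ≤ 1 - p := hok ▸ okFrac_nonneg W P T x y
  have hp0 : 0 ≤ p := by positivity
  have hsub : revClass x' y ⊆ badSet W P T x y := by
    intro z hz
    refine Finset.mem_filter.mpr ⟨revClass_subset hn hx' hz, ?_⟩
    rw [(mem_revClass hn).mp hz, logLik_of_suppIn hs, logLik_of_suppIn hs', ← EReal.coe_add,
      EReal.coe_le_coe_iff]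
    exact not_le.mpr hlt
  have hpge : Real.exp (-(n * info P (empJoint x' y)) - slackC X Y * slack n) ≤ p := by
    refine (card_revClass_div_ge hn hx').trans ?_
    exact div_le_div_of_nonneg_right (by exact_mod_cast Finset.card_le_card hsub)
      (Nat.cast_nonneg _)
  have hM := two_le_codeSize hR hn
  have h1 : (1 - p) ^ (codeSize R n - 1) ≤ Real.exp (-(((codeSize R n : ℝ) - 1) * p)) := by
    have h2 : 1 - p ≤ Real.exp (-p) := by linarith [Real.add_one_le_exp (-p)]
    refine (pow_le_pow_left₀ hp1 h2 _).trans (le_of_eq ?_)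
    rw [← Real.exp_nat_mul, Nat.cast_sub (by lia), Nat.cast_one]
    congr 1
    ring
  have hM1 : 0 ≤ (codeSize R n : ℝ) - 1 := by
    have : (2 : ℝ) ≤ codeSize R n := by exact_mod_cast hM
    linarith
  have h3 := exp_neg_le (mul_nonneg hM1 hp0)
  rw [hok]
  have h4 : Real.exp (n * R) / 2 * p ≤ ((codeSize R n : ℝ) - 1) * p :=
    mul_le_mul_of_nonneg_right (half_exp_le_codeSize_sub_one hR hn) hp0
  have h5 : Real.exp (n * R) * Real.exp (-(n * info P (empJoint x' y)) - slackC X Y * slack n) ≤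
      Real.exp (n * R) * p := mul_le_mul_of_nonneg_left hpge (Real.exp_pos _).le
  rw [← Real.exp_add] at h5
  have hsl := slack_ge_one n
  have hC : 0 ≤ slackC X Y * slack n := mul_nonneg slackC_nonneg (slack_nonneg n)
  have hn0 : (0 : ℝ) ≤ n := n.cast_nonneg
  have h6 : Real.exp (-(n * max (info P (empJoint x' y) - R) 0) - slackC X Y * slack n) ≤
      2 * min 1 (((codeSize R n : ℝ) - 1) * p) := by
    rw [mul_min_of_nonneg _ _ zero_le_two]
    refine le_min ?_ ?_
    · have : Real.exp (-(n * max (info P (empJoint x' y) - R) 0) - slackC X Y * slack n) ≤ 1 := by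
        rw [Real.exp_le_one_iff]
        have := mul_nonneg hn0 (le_max_right (info P (empJoint x' y) - R) 0)
        linarith
      linarith
    · have : Real.exp (-(n * max (info P (empJoint x' y) - R) 0) - slackC X Y * slack n) ≤
        Real.exp (n * R + (-(n * info P (empJoint x' y)) - slackC X Y * slack n)) := by
        rw [Real.exp_le_exp]
        have := mul_le_mul_of_nonneg_left (le_max_left (info P (empJoint x' y) - R) 0) hn0
        linarith
      linarith
  -- A factor 1/4 is lost: 1/2 in `exp_neg_le` and 1/2 in the comparison `h6`. The extra 2·`slack` ≥
  -- 2 pays for it, since e^{-2} ≤ 1/4.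
  have h7 : Real.exp (-(n * max (info P (empJoint x' y) - R) 0) - (slackC X Y + 2) * slack n) ≤
      Real.exp (-(n * max (info P (empJoint x' y) - R) 0) - slackC X Y * slack n) * (1 / 4) := by
    have e1 : Real.exp (-2) ≤ 1 / 4 := by
      rw [Real.exp_neg, ← one_div]
      refine one_div_le_one_div_of_le (by norm_num) ?_
      have := Real.add_one_le_exp (1 : ℝ)
      have e : Real.exp 2 = Real.exp 1 * Real.exp 1 := by rw [← Real.exp_add]; norm_num
      rw [e]
      nlinarith
    calc _ ≤ Real.exp (-(n * max (info P (empJoint x' y) - R) 0) - slackC X Y * slack n) *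
          Real.exp (-2) := by
          rw [← Real.exp_add, Real.exp_le_exp]
          nlinarith
      _ ≤ _ := mul_le_mul_of_nonneg_left e1 (Real.exp_pos _).le
  linarith

/-- A vector of each joint type that has the common denominator `n`. -/
lemma exists_empJoint_of_hasDenom {P : X → ℝ} {n : ℕ} (hn : 0 < n) {Q : X × Y → ℝ}
    (hd : HasDenom n Q) (hQ : Q ∈ jointDists Y P) {x : Fin n → X} (hx : x ∈ typeClass P n) :
    ∃ y : Fin n → Y, empJoint x y = Q := by
  choose c hc using hd
  exact exists_empJoint_eq hn hc (by rw [mem_typeClass.mp hx, hQ.2])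

lemma exists_empJoint_of_hasDenom' {P : X → ℝ} {n : ℕ} (hn : 0 < n) {Q : X × Y → ℝ}
    (hd : HasDenom n Q) (hQ : Q ∈ jointDists Y P) {y : Fin n → Y} (hy : empDist y = margY Q) :
    ∃ x ∈ typeClass P n, empJoint x y = Q := by
  choose c hc using hd
  obtain ⟨x, hx⟩ := exists_empJoint_eq' hn hc hy
  exact ⟨x, by rw [mem_typeClass, ← margX_empJoint x y, hx, hQ.2], hx⟩

lemma typeClass_nonempty_of_hasDenom {P : X → ℝ} {n : ℕ} (hn : 0 < n) {Q : X × Y → ℝ}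
    (hd : HasDenom n Q) (hQ : Q ∈ jointDists Y P) : (typeClass P n).Nonempty := by
  choose c hc using hd
  obtain ⟨a, ha⟩ := exists_empDist_eq hn hQ.1.2 hc
  refine ⟨fun i => (a i).1, ?_⟩
  have := margX_empJoint (fun i => (a i).1) (fun i => (a i).2)
  rw [mem_typeClass, ← this, ← hQ.2, ← ha]
  rfl

lemma le_avg {α : Type*} {S : Finset α} (hS : S.Nonempty) {h : α → ℝ} {c : ℝ}
    (hc : ∀ x ∈ S, c ≤ h x) : c ≤ (1 / (S.card : ℝ)) * ∑ x ∈ S, h x := by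
  have hpos : (0 : ℝ) < S.card := by exact_mod_cast Finset.card_pos.mpr hS
  rw [one_div, le_inv_mul_iff₀ hpos, ← nsmul_eq_mul]
  exact Finset.card_nsmul_le_sum S h _ hc

lemma sum_chanProb_mul_ge {W : X → Y → ℝ} (hW : ∀ x y, 0 ≤ W x y) {P : X → ℝ} {n : ℕ}
    (hn : 0 < n) {x : Fin n → X} (hx : x ∈ typeClass P n) {Qt : X × Y → ℝ}
    (hd : HasDenom n Qt) (hQt : Qt ∈ jointDists Y P) (hs : SuppIn W Qt)
    {e : (Fin n → Y) → ℝ} (he : ∀ y, 0 ≤ e y) {c : ℝ}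
    (hc : ∀ y, empJoint x y = Qt → Real.exp c ≤ e y) :
    Real.exp (-(n * cdiv W P Qt) - slackC X Y * slack n + c) ≤ ∑ y, chanProb W x y * e y := by
  obtain ⟨y, rfl⟩ := exists_empJoint_of_hasDenom hn hd hQt hx
  have h1 := sum_chanProb_condClass_ge hW hn hx hs
  calc _ = Real.exp (-(n * cdiv W P (empJoint x y)) - slackC X Y * slack n) * Real.exp c := by
        rw [← Real.exp_add]
    _ ≤ (∑ z ∈ condClass x y, chanProb W x z) * Real.exp c :=
        mul_le_mul_of_nonneg_right h1 (Real.exp_pos _).le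
    _ = ∑ z ∈ condClass x y, chanProb W x z * Real.exp c := by rw [Finset.sum_mul]
    _ ≤ ∑ z ∈ condClass x y, chanProb W x z * e z :=
        Finset.sum_le_sum fun z hz => mul_le_mul_of_nonneg_left
          (hc z ((mem_condClass hn).mp hz)) (chanProb_nonneg hW x z)
    _ ≤ _ := Finset.sum_le_sum_of_subset_of_nonneg (Finset.subset_univ _)
        fun z _ _ => mul_nonneg (chanProb_nonneg hW x z) (he z)

lemma errorAvg_ge {W : X → Y → ℝ} (hW : ∀ x y, 0 ≤ W x y) {P : X → ℝ} {R T : ℝ} (hR : 0 < R)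
    {n : ℕ} (hn : 0 < n) {Qt Q : X × Y → ℝ} (hdt : HasDenom n Qt) (hd : HasDenom n Q)
    (hQt : Qt ∈ jointDists Y P) (hQ : Q ∈ jointDists Y P) (hm : margY Q = margY Qt)
    (hst : SuppIn W Qt) (hs : SuppIn W Q) (hlt : linLik W Qt < T + linLik W Q) :
    Real.exp (-(n * errVal W P R (Qt, Q)) - (2 * slackC X Y + 2) * slack n) ≤
      codeAvg P n (codeSize R n) fun C => errorProb W C (decRegion W T C) := by
  have hT := typeClass_nonempty_of_hasDenom hn hdt hQt
  rw [codeAvg_errorProb W P T (by have := two_le_codeSize hR hn; lia) hT]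
  refine le_avg hT fun x hx => ?_
  refine le_trans (le_of_eq ?_) (sum_chanProb_mul_ge hW hn hx hdt hQt hst
    (c := -(n * max (info P Q - R) 0) - (slackC X Y + 2) * slack n)
    (fun y => sub_nonneg.mpr (pow_le_one₀ (okFrac_nonneg W P T x y)
      (okFrac_le_one W P T hT x y))) ?_)
  · rw [errVal]
    congr 1
    ring
  · rintro y rfl
    obtain ⟨x', hx', rfl⟩ := exists_empJoint_of_hasDenom' hn hd hQ
      (y := y) (by rw [hm, margY_empJoint])
    exact one_sub_okFrac_pow_ge hR hn hx' hst hs hlt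

end ErrorExponent

/-! ### The formula for the error exponent: approximation and compactness -/

section ErrorExponentFormula

variable {X Y : Type*} [Fintype X] [Fintype Y] [DecidableEq X] [DecidableEq Y]

lemma tendsto_const_mul_slack_div (C : ℝ) :
    Tendsto (fun n : ℕ => C * slack n / n) atTop (nhds 0) := by
  have := tendsto_slack_div.const_mul C
  rw [mul_zero] at this
  exact this.congr fun n => by ring

lemma le_coe_of_tendsto {E : EReal} {u : ℕ → ℝ} {c : ℝ} (hu : Tendsto u atTop (nhds c))
    (h : ∀ᶠ k in atTop, E ≤ u k) : E ≤ c :=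
  ge_of_tendsto ((continuous_coe_real_ereal.tendsto c).comp hu) h

lemma errorExponent_le_of_hasDenom {W : X → Y → ℝ} (hW : ∀ x y, 0 ≤ W x y) {P : X → ℝ} {R T : ℝ}
    (hR : 0 < R) {N : ℕ} (hN : 0 < N) {Qt Q : X × Y → ℝ} (hdt : HasDenom N Qt)
    (hd : HasDenom N Q) (hQt : Qt ∈ jointDists Y P) (hQ : Q ∈ jointDists Y P)
    (hm : margY Q = margY Qt) (hst : SuppIn W Qt) (hs : SuppIn W Q)
    (hlt : linLik W Qt < T + linLik W Q) :
    errorExponent W P R T ≤ errVal W P R (Qt, Q) := by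
  refine expRate_le hN (tendsto_const_mul_slack_div (2 * slackC X Y + 2)) fun n hn hNn => ?_
  have hn' : (n : ℝ) ≠ 0 := by positivity
  refine ⟨typeClass_nonempty_of_hasDenom hn (hdt.of_dvd hNn) hQt, ?_⟩
  refine le_trans (le_of_eq ?_)
    (errorAvg_ge hW hR hn (hdt.of_dvd hNn) (hd.of_dvd hNn) hQt hQ hm hst hs hlt)
  congr 1
  field_simp
  ring

/-- Pairs of joint distributions with a common second marginal have rational approximations. -/
lemma exists_rational_pairs {W : X → Y → ℝ} {P : X → ℝ} {N : ℕ} (hN : 0 < N) (hP : HasDenom N P)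
    {Qt Q : X × Y → ℝ} (hQt : Qt ∈ jointDists Y P) (hQ : Q ∈ jointDists Y P)
    (hm : margY Q = margY Qt) (hst : SuppIn W Qt) (hs : SuppIn W Q) :
    ∃ z : ℕ → (X × Y → ℝ) × (X × Y → ℝ), Tendsto z atTop (nhds (Qt, Q)) ∧ ∀ᶠ k in atTop,
      (z k).1 ∈ jointDists Y P ∧ (z k).2 ∈ jointDists Y P ∧ margY (z k).2 = margY (z k).1 ∧
      SuppIn W (z k).1 ∧ SuppIn W (z k).2 ∧
      (∃ N, 0 < N ∧ HasDenom N (z k).1 ∧ HasDenom N (z k).2) ∧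
      (∀ s, Qt s = 0 → (z k).1 s = 0) ∧ (∀ s, Q s = 0 → (z k).2 s = 0) := by
  obtain ⟨φ, h1, hφ⟩ := exists_rat_linear_approx
  -- Using the same linear map for both components keeps their second marginals equal.
  refine ⟨fun k => (ratImage (φ k) Qt, ratImage (φ k) Q),
    (tendsto_ratImage hφ Qt).prodMk_nhds (tendsto_ratImage hφ Q), ?_⟩
  filter_upwards [eventually_ratImage_mem h1 hφ hN hP hQt,
    eventually_ratImage_mem h1 hφ hN hP hQ] with k hk hk'
  refine ⟨hk, hk', by rw [margY_ratImage, margY_ratImage, hm], suppIn_ratImage hst _,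
    suppIn_ratImage hs _, ?_, fun s h => by simp [ratImage, h], fun s h => by simp [ratImage, h]⟩
  obtain ⟨N₁, hN₁, h₁⟩ := exists_hasDenom_ratImage hk.1.1
  obtain ⟨N₂, hN₂, h₂⟩ := exists_hasDenom_ratImage hk'.1.1
  exact ⟨N₁ * N₂, Nat.mul_pos hN₁ hN₂, h₁.of_dvd (dvd_mul_right _ _),
    h₂.of_dvd (dvd_mul_left _ _)⟩

/-- The strict inequality is open, so it passes to the rational approximants; the value passes to
the limit by continuity. -/
lemma errorExponent_le_of_lt {W : X → Y → ℝ} (hW : ∀ x y, 0 ≤ W x y) {P : X → ℝ} {R T : ℝ}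
    (hR : 0 < R) {N : ℕ} (hN : 0 < N) (hP : HasDenom N P) {Qt Q : X × Y → ℝ}
    (hQt : Qt ∈ jointDists Y P) (hQ : Q ∈ jointDists Y P)
    (hm : margY Q = margY Qt) (hst : SuppIn W Qt) (hs : SuppIn W Q)
    (hlt : linLik W Qt < T + linLik W Q) :
    errorExponent W P R T ≤ errVal W P R (Qt, Q) := by
  obtain ⟨z, hz, hz'⟩ := exists_rational_pairs hN hP hQt hQ hm hst hs
  refine le_coe_of_tendsto (((continuous_errVal W P R).tendsto (Qt, Q)).comp hz) ?_
  have hopen : ∀ᶠ k in atTop, linLik W (z k).1 < T + linLik W (z k).2 :=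
    (((continuous_linLik W).comp continuous_fst).tendsto (Qt, Q) |>.comp hz).eventually_lt
      ((continuous_const.add ((continuous_linLik W).comp continuous_snd)).tendsto (Qt, Q)
        |>.comp hz) hlt
  filter_upwards [hz', hopen] with k ⟨g1, g2, g3, g4, g5, ⟨M, hM, g6, g7⟩, _⟩ hk
  exact errorExponent_le_of_hasDenom hW hR hM g6 g7 g1 g2 g3 g4 g5 hk

/-- The segment from `z` towards `z'`. -/
lemma tendsto_segment {E : Type*} [AddCommGroup E] [Module ℝ E] [TopologicalSpace E]
    [ContinuousAdd E] [ContinuousSMul ℝ E] (z z' : E) :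
    Tendsto (fun k : ℕ => (1 - 1 / ((k : ℝ) + 1)) • z + (1 / ((k : ℝ) + 1)) • z') atTop
      (nhds z) := by
  have h := tendsto_one_div_add_atTop_nhds_zero_nat (𝕜 := ℝ)
  have h1 := ((h.const_sub 1).smul_const z).add (h.smul_const z')
  simpa using h1

lemma logLik_ne_bot_iff {W : X → Y → ℝ} {Q : X × Y → ℝ} : logLik W Q ≠ ⊥ ↔ SuppIn W Q := by
  constructor
  · intro h
    by_contra hn
    exact h (logLik_of_not_suppIn hn)
  · intro h
    rw [logLik_of_suppIn h]
    exact EReal.coe_ne_bot _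

lemma one_div_succ_bounds (k : ℕ) : 0 < 1 / ((k : ℝ) + 1) ∧ 1 / ((k : ℝ) + 1) ≤ 1 := by
  refine ⟨by positivity, ?_⟩
  rw [div_le_one (by positivity)]
  have : (0 : ℝ) ≤ k := k.cast_nonneg
  linarith

lemma errorExponent_le {W : X → Y → ℝ} (hW : ∀ x y, 0 ≤ W x y) {P : X → ℝ} {R T : ℝ}
    (hR : 0 < R) {N : ℕ} (hN : 0 < N) (hP : HasDenom N P) (hgap : ¬ IsLeast (logLikGaps W P) T) :
    ∀ v ∈ errorValues W P R T, errorExponent W P R T ≤ v := by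
  rintro v ⟨Qt, hQt, Q, hQ, hm, hle, rfl⟩
  by_cases hst : SuppIn W Qt
  swap
  · rw [condDiv_of_not_suppIn hst, EReal.top_add_coe]
    exact le_top
  have hs : SuppIn W Q := by
    by_contra hn
    rw [logLik_of_suppIn hst, logLik_of_not_suppIn hn, EReal.bot_add] at hle
    simp at hle
  rw [condDiv_of_suppIn hQt hst, mutualInfo_eq hQ, ← EReal.coe_add]
  rw [logLik_of_suppIn hst, logLik_of_suppIn hs, ← EReal.coe_add, EReal.coe_le_coe_iff] at hle
  change _ ≤ ((errVal W P R (Qt, Q) : ℝ) : EReal)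
  rcases hle.lt_or_eq with hlt | heq
  · exact errorExponent_le_of_lt hW hR hN hP hQt hQ hm hst hs (by linarith)
  have hT : T ∈ logLikGaps W P := ⟨Qt, hQt, Q, hQ, hm, logLik_ne_bot_iff.mpr hs, by
    rw [logLik_of_suppIn hst, logLik_of_suppIn hs, ← EReal.coe_add, heq]⟩
  -- In the case of equality `T` is itself a gap. Being non-minimal, it has a smaller gap below it,
  -- and mixing in a pair with that gap makes the inequality strict.
  have : ∃ t ∈ logLikGaps W P, t < T := by
    by_contra hno
    push Not at hno
    exact hgap ⟨hT, hno⟩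
  obtain ⟨t, ⟨Qt', hQt', Q', hQ', hm', hne, ht⟩, htT⟩ := this
  have hs' : SuppIn W Q' := logLik_ne_bot_iff.mp hne
  have hst' : SuppIn W Qt' := by
    rw [← logLik_ne_bot_iff, ht, logLik_of_suppIn hs', ← EReal.coe_add]
    exact EReal.coe_ne_bot _
  rw [logLik_of_suppIn hst', logLik_of_suppIn hs', ← EReal.coe_add, EReal.coe_eq_coe_iff] at ht
  refine le_coe_of_tendsto (((continuous_errVal W P R).tendsto (Qt, Q)).comp
    (tendsto_segment (Qt, Q) (Qt', Q'))) (Eventually.of_forall fun k => ?_)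
  obtain ⟨hk0, hk1⟩ := one_div_succ_bounds k
  set ε := 1 / ((k : ℝ) + 1)
  refine errorExponent_le_of_lt hW hR hN hP
    (jointDists_convex P hQt hQt' (by linarith) hk0.le (by ring))
    (jointDists_convex P hQ hQ' (by linarith) hk0.le (by ring)) ?_
    (suppIn_add hst hst' _ _) (suppIn_add hs hs' _ _) ?_
  · change margY ((1 - ε) • Q + ε • Q') = margY ((1 - ε) • Qt + ε • Qt')
    rw [margY_add, margY_add, hm, hm']
  · change linLik W ((1 - ε) • Qt + ε • Qt') < T + linLik W ((1 - ε) • Q + ε • Q')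
    rw [linLik_add, linLik_add, heq, ht]
    nlinarith

lemma isClosed_suppIn (W : X → Y → ℝ) : IsClosed {Q | SuppIn W Q} := by
  simp only [SuppIn, Set.ofPred_forall]
  exact isClosed_iInter fun x => isClosed_iInter fun y => isClosed_iInter fun _ =>
    isClosed_eq (continuous_apply _) continuous_const

/-- A sequence of pairs of joint distributions with a common second marginal has a cluster point
of the same kind. -/
lemma exists_limit_pair {P : X → ℝ} {z : ℕ → (X × Y → ℝ) × (X × Y → ℝ)}
    (h1 : ∀ j, (z j).1 ∈ jointDists Y P) (h2 : ∀ j, (z j).2 ∈ jointDists Y P)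
    (hm : ∀ j, margY (z j).2 = margY (z j).1) :
    ∃ Qt ∈ jointDists Y P, ∃ Q ∈ jointDists Y P, margY Q = margY Qt ∧
      ∃ φ : ℕ → ℕ, StrictMono φ ∧ Tendsto (z ∘ φ) atTop (nhds (Qt, Q)) := by
  obtain ⟨⟨Qt, Q⟩, ⟨hQt, hQ⟩, φ, hφ, hlim⟩ :=
    ((isCompact_jointDists (Y := Y) P).prod (isCompact_jointDists (Y := Y) P)).tendsto_subseq
      (x := z) (fun j => ⟨h1 j, h2 j⟩)
  refine ⟨Qt, hQt, Q, hQ, ?_, φ, hφ, hlim⟩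
  refine tendsto_nhds_unique
    ((continuous_margY.comp continuous_snd).tendsto (Qt, Q) |>.comp hlim) ?_
  refine ((continuous_margY.comp continuous_fst).tendsto (Qt, Q) |>.comp hlim).congr fun j => ?_
  exact (hm (φ j)).symm

theorem isMinOrTop_errorExponent {W : X → Y → ℝ} (hW : ∀ x y, 0 ≤ W x y) {P : X → ℝ} {R T : ℝ}
    (hR : 0 < R) {N : ℕ} (hN : 0 < N) (hP : HasDenom N P) (hgap : ¬ IsLeast (logLikGaps W P) T) :
    IsMinOrTop (errorValues W P R T) (errorExponent W P R T) := by
  refine isMinOrTop_expRate (errorExponent_le hW hR hN hP hgap) ?_ ?_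
  · intro c c₀ hc hfreq
    -- One block length for each `j`, increasing with `j`. Its dominant pair of joint types has
    -- value at most `c j + o(1)`, and a cluster point of these pairs is the required minimizer.
    obtain ⟨φ, hφ, hφ'⟩ := extraction_forall_of_frequently hfreq
    have hex : ∀ j, ∃ z : (X × Y → ℝ) × (X × Y → ℝ), z.1 ∈ jointDists Y P ∧
        z.2 ∈ jointDists Y P ∧ margY z.2 = margY z.1 ∧ SuppIn W z.1 ∧ SuppIn W z.2 ∧
        linLik W z.1 ≤ T + linLik W z.2 ∧
        errVal W P R z ≤ c j + 4 * slackC X Y * slack (φ j) / φ j := by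
      intro j
      obtain ⟨hT, hn, hlt⟩ := hφ' j
      obtain ⟨x, hx, x', hx', y, hs, hs', hl, hle⟩ := errorAvg_le hW hR hn hT
        ((Real.exp_pos _).trans hlt)
      refine ⟨(empJoint x y, empJoint x' y), empJoint_mem hn hx y, empJoint_mem hn hx' y,
        by rw [margY_empJoint, margY_empJoint], hs, hs', hl.le, ?_⟩
      have h1 := Real.exp_le_exp.mp (hlt.le.trans hle)
      have hn' : (0 : ℝ) < φ j := by exact_mod_cast hn
      rw [← sub_le_iff_le_add', le_div_iff₀ hn']
      linarith
    choose z h1 h2 h3 h4 h5 h6 h7 using hex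
    obtain ⟨Qt, hQt, Q, hQ, hm, ψ, hψ, hlim⟩ := exists_limit_pair h1 h2 h3
    have hst : SuppIn W Qt := (isClosed_suppIn W).mem_of_tendsto
      ((continuous_fst.tendsto (Qt, Q)).comp hlim) (Eventually.of_forall fun j => h4 (ψ j))
    have hs : SuppIn W Q := (isClosed_suppIn W).mem_of_tendsto
      ((continuous_snd.tendsto (Qt, Q)).comp hlim) (Eventually.of_forall fun j => h5 (ψ j))
    have hle : linLik W Qt ≤ T + linLik W Q := le_of_tendsto_of_tendsto'
      (((continuous_linLik W).comp continuous_fst).tendsto (Qt, Q) |>.comp hlim)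
      ((continuous_const.add ((continuous_linLik W).comp continuous_snd)).tendsto (Qt, Q)
        |>.comp hlim) fun j => h6 (ψ j)
    have hval : errVal W P R (Qt, Q) ≤ c₀ := by
      refine le_of_tendsto_of_tendsto' ((continuous_errVal W P R).tendsto (Qt, Q) |>.comp hlim)
        (b := atTop) ?_ fun j => h7 (ψ j)
      have := (hc.comp hψ.tendsto_atTop).add
        ((tendsto_const_mul_slack_div (4 * slackC X Y)).comp
          (hφ.tendsto_atTop.comp hψ.tendsto_atTop))
      rw [add_zero] at this
      exact this
    refine ⟨_, ⟨Qt, hQt, Q, hQ, hm, ?_, rfl⟩, ?_⟩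
    · rw [logLik_of_suppIn hst, logLik_of_suppIn hs, ← EReal.coe_add, EReal.coe_le_coe_iff]
      linarith
    · rw [condDiv_of_suppIn hQt hst, mutualInfo_eq hQ, ← EReal.coe_add, EReal.coe_le_coe_iff]
      exact hval
  · obtain ⟨B, hB⟩ := (isCompact_jointDists (Y := Y) P).bddBelow_image
      (continuous_cdiv W P).continuousOn
    refine ⟨B, ?_⟩
    rintro v ⟨Qt, hQt, Q, hQ, hm, hle, rfl⟩
    by_cases hst : SuppIn W Qt
    swap
    · rw [condDiv_of_not_suppIn hst, EReal.top_add_coe]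
      exact le_top
    rw [condDiv_of_suppIn hQt hst, ← EReal.coe_add, EReal.coe_le_coe_iff]
    have h1 : B ≤ cdiv W P Qt := hB (Set.mem_image_of_mem _ hQt)
    linarith [le_max_right (mutualInfo Q - R) 0]

end ErrorExponentFormula

/-! ### Local bounds for multinomial probabilities -/

/-- A bound for the Poisson probabilities. -/
lemma log_poisson_le {a : ℝ} (ha : 0 < a) (c : ℕ) :
    c * Real.log a - a - Real.log (c.factorial) ≤ -(Real.log a / 2) + 1 := by
  rcases Nat.eq_zero_or_pos c with rfl | hc
  · have := Real.log_le_sub_one_of_pos ha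
    simp
    linarith
  have hc1 : (1 : ℝ) ≤ c := by exact_mod_cast hc
  have hc0 : (0 : ℝ) < c := by linarith
  have h1 := log_factorial_ge c
  -- With a = c r², Stirling and log r ≤ r - 1 bound the left side by -c(r-1)² - (log c)/2. Writing
  -- (log c)/2 = (log a)/2 - log r leaves (r-1) - (r-1)² ≤ 1/4.
  set r := Real.sqrt (a / c) with hr
  have hr0 : 0 < r := Real.sqrt_pos.mpr (by positivity)
  have hr2 : r ^ 2 = a / c := Real.sq_sqrt (by positivity)
  have ha' : a = c * r ^ 2 := by rw [hr2]; field_simp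
  have h2 : Real.log a = Real.log c + 2 * Real.log r := by
    rw [ha', Real.log_mul hc0.ne' (by positivity), Real.log_pow]
    norm_num
  have h3 := Real.log_le_sub_one_of_pos hr0
  have h4 : (c : ℝ) * Real.log r ≤ c * (r - 1) := mul_le_mul_of_nonneg_left h3 hc0.le
  have h5 : (r - 1) ^ 2 ≤ c * (r - 1) ^ 2 := le_mul_of_one_le_left (sq_nonneg _) hc1
  have h6 : a = c * (r - 1) ^ 2 + 2 * (c * (r - 1)) + c := by rw [ha']; ring
  have h7 : (c : ℝ) * Real.log a = c * Real.log c + 2 * (c * Real.log r) := by rw [h2]; ring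
  nlinarith [sq_nonneg (r - 1 - 1 / 2)]

section Multinomial

variable {ι X : Type*} [Fintype ι] [DecidableEq ι] [Fintype X] [DecidableEq X]

lemma card_same_cnt_mul (u : ι → X) :
    (univ.filter fun w : ι → X => ∀ s, cnt w s = cnt u s).card * ∏ s, (cnt u s).factorial =
      (Fintype.card ι).factorial := by
  have h := card_same_joint_cnt_mul (fun _ : ι => ()) u
  simp only [cnt, Prod.forall, Prod.mk.injEq, true_and, forall_const, Fintype.prod_prod_type,
    univ_unique, prod_singleton, filter_true, card_univ] at h
  exact h

lemma prod_eq_prod_pow_cnt (θ : X → ℝ) (u : ι → X) : ∏ i, θ (u i) = ∏ s, θ s ^ cnt u s := by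
  rw [← Finset.prod_fiberwise_of_maps_to (s := (univ : Finset ι)) (t := univ)
    (g := u) (fun i _ => Finset.mem_univ _) (fun i => θ (u i))]
  refine Finset.prod_congr rfl fun s _ => ?_
  rw [cnt, ← Finset.prod_const]
  exact Finset.prod_congr rfl fun i hi => by rw [(Finset.mem_filter.mp hi).2]

/-- The multinomial probabilities are at most of order `m ^ (-(k - 1) / 2)`, where `k` is the
number of letters of positive probability. -/
lemma multinomial_le {θ : X → ℝ} (hθ : ∀ x, 0 ≤ θ x) (hsum : ∑ x, θ x = 1)
    (hι : 0 < Fintype.card ι) (u : ι → X) :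
    ∑ w ∈ univ.filter (fun w : ι → X => ∀ s, cnt w s = cnt u s), ∏ i, θ (w i) ≤
      Real.exp (1 + ∑ x ∈ univ.filter (fun x => 0 < θ x), (1 - Real.log (θ x) / 2) -
        (((univ.filter (fun x => 0 < θ x)).card : ℝ) - 1) / 2 * Real.log (Fintype.card ι)) := by
  set m := Fintype.card ι with hm
  set S := univ.filter (fun x => 0 < θ x) with hS
  set F := univ.filter (fun w : ι → X => ∀ s, cnt w s = cnt u s) with hF
  have hm0 : (0 : ℝ) < m := by exact_mod_cast hι
  have hu : u ∈ F := by simp [hF]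
  have hFpos : (0 : ℝ) < F.card := by exact_mod_cast Finset.card_pos.mpr ⟨u, hu⟩
  have h1 : ∑ w ∈ F, ∏ i, θ (w i) = F.card * ∏ i, θ (u i) := by
    rw [Finset.sum_congr rfl (g := fun _ => ∏ i, θ (u i))]
    · simp
    · intro w hw
      rw [prod_eq_prod_pow_cnt, prod_eq_prod_pow_cnt]
      exact Finset.prod_congr rfl fun s _ => by rw [(Finset.mem_filter.mp hw).2 s]
  rw [h1]
  by_cases hz : ∏ i, θ (u i) = 0
  · rw [hz, mul_zero]
    exact (Real.exp_pos _).le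
  have hpos : 0 < ∏ i, θ (u i) := lt_of_le_of_ne
    (Finset.prod_nonneg fun i _ => hθ _) (Ne.symm hz)
  rw [← Real.log_le_iff_le_exp (by positivity), Real.log_mul hFpos.ne' hz]
  have hcnt0 : ∀ x, x ∉ S → cnt u x = 0 := by
    intro x hx
    rw [cnt, Finset.card_eq_zero, Finset.filter_eq_empty_iff]
    intro i _ hi
    have h2 : θ x = 0 := le_antisymm (not_lt.mp (by simpa [hS] using hx)) (hθ x)
    exact hz (Finset.prod_eq_zero (Finset.mem_univ i) (by rw [hi, h2]))
  have hlogF : Real.log F.card = Real.log (m.factorial) -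
      ∑ x ∈ S, Real.log ((cnt u x).factorial) := by
    have h2 : (F.card : ℝ) * ∏ s, ((cnt u s).factorial : ℝ) = m.factorial := by
      exact_mod_cast card_same_cnt_mul u
    have h3 := congrArg Real.log h2
    rw [Real.log_mul hFpos.ne' (Finset.prod_ne_zero_iff.mpr fun s _ => by positivity),
      Real.log_prod (fun s _ => by positivity)] at h3
    have h4 : ∑ s, Real.log ((cnt u s).factorial : ℝ) =
        ∑ s ∈ S, Real.log ((cnt u s).factorial : ℝ) := by
      symm
      refine Finset.sum_subset (Finset.subset_univ _) fun x _ hx => ?_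
      simp [hcnt0 x hx]
    linarith
  have hlogP : Real.log (∏ i, θ (u i)) = ∑ x ∈ S, (cnt u x : ℝ) * Real.log (θ x) := by
    rw [prod_eq_prod_pow_cnt] at hz ⊢
    rw [Real.log_prod (fun s hs => Finset.prod_ne_zero_iff.mp hz s hs)]
    simp only [Real.log_pow]
    symm
    refine Finset.sum_subset (Finset.subset_univ _) fun x _ hx => ?_
    simp [hcnt0 x hx]
  have hsumc : ∑ x ∈ S, (cnt u x : ℝ) = m := by
    have h2 : ∑ x ∈ S, (cnt u x : ℝ) = ∑ x, (cnt u x : ℝ) :=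
      Finset.sum_subset (Finset.subset_univ _) fun x _ hx => by simp [hcnt0 x hx]
    rw [h2]
    exact_mod_cast sum_cnt u
  have hsumθ : ∑ x ∈ S, θ x = 1 := by
    rw [← hsum]
    refine Finset.sum_subset (Finset.subset_univ _) fun x _ hx => ?_
    exact le_antisymm (not_lt.mp (by simpa [hS] using hx)) (hθ x)
  -- Each of the k letters contributes a Poisson probability of mean mθ, of order m^{-1/2}. The
  -- factorial of m gives back one factor m^{1/2}, whence the exponent (k-1)/2.
  have hterm : ∀ x ∈ S, (cnt u x : ℝ) * Real.log (θ x) - Real.log ((cnt u x).factorial) ≤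
      m * θ x - cnt u x * Real.log m - Real.log m / 2 + (1 - Real.log (θ x) / 2) := by
    intro x hx
    have hθx : 0 < θ x := (Finset.mem_filter.mp hx).2
    have h2 := log_poisson_le (mul_pos hm0 hθx) (cnt u x)
    rw [Real.log_mul hm0.ne' hθx.ne'] at h2
    linarith
  have hle := Finset.sum_le_sum hterm
  rw [Finset.sum_sub_distrib, Finset.sum_add_distrib, Finset.sum_sub_distrib,
    Finset.sum_sub_distrib, ← Finset.mul_sum, ← Finset.sum_mul, hsumc, hsumθ,
    Finset.sum_const, nsmul_eq_mul] at hle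
  have hfac := log_factorial_le m
  rw [hlogF, hlogP]
  linarith

/-- A lower bound of the correct order for the size of a type class. -/
lemma log_card_typeClass_ge {P : X → ℝ} {n : ℕ} (hn : 0 < n) (hT : (typeClass P n).Nonempty) :
    -(n * phi P) - (((univ.filter (fun x => 0 < P x)).card : ℝ) - 1) / 2 * Real.log n -
      (univ.filter (fun x => 0 < P x)).card ≤ Real.log (typeClass P n).card := by
  obtain ⟨x, hx⟩ := hT
  have hn' : (0 : ℝ) < n := by exact_mod_cast hn
  have hP : ∀ s, (cnt x s : ℝ) = n * P s := by
    intro s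
    rw [← mem_typeClass.mp hx, empDist_eq]
    field_simp
  set S := univ.filter (fun x => 0 < P x) with hS
  have hcnt0 : ∀ s, s ∉ S → cnt x s = 0 := by
    intro s hs
    have h1 : P s ≤ 0 := not_lt.mp (by simpa [hS] using hs)
    have h2 : (cnt x s : ℝ) ≤ 0 := by rw [hP s]; nlinarith
    exact_mod_cast le_antisymm h2 (Nat.cast_nonneg _)
  have h1 : Real.log (typeClass P n).card = Real.log (n.factorial) -
      ∑ s ∈ S, Real.log ((cnt x s).factorial) := by
    rw [typeClass_eq_condClass hn hx, log_card_condClass]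
    have h4 : ∑ s, Real.log ((cnt x s).factorial : ℝ) =
        ∑ s ∈ S, Real.log ((cnt x s).factorial : ℝ) := by
      symm
      refine Finset.sum_subset (Finset.subset_univ _) fun s _ hs => ?_
      simp [hcnt0 s hs]
    rw [← h4, Fintype.sum_prod_type]
    simp [cnt]
  have hsumc : ∑ s ∈ S, (cnt x s : ℝ) = n := by
    have h2 : ∑ s ∈ S, (cnt x s : ℝ) = ∑ s, (cnt x s : ℝ) :=
      Finset.sum_subset (Finset.subset_univ _) fun s _ hs => by simp [hcnt0 s hs]
    have h3 := sum_cnt x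
    rw [Fintype.card_fin] at h3
    rw [h2]
    exact_mod_cast h3
  have hsuml : ∑ s ∈ S, (cnt x s : ℝ) * Real.log (cnt x s) = n * phi P + n * Real.log n := by
    rw [← mem_typeClass.mp hx, ← sum_cnt_log hn x]
    exact Finset.sum_subset (Finset.subset_univ _) fun s _ hs => by simp [hcnt0 s hs]
  have hterm : ∀ s ∈ S, Real.log ((cnt x s).factorial) ≤
      (cnt x s : ℝ) * Real.log (cnt x s) - cnt x s + (Real.log n / 2 + 1) := by
    intro s hs
    have h2 := log_factorial_le (cnt x s)
    have h3 : Real.log (cnt x s) ≤ Real.log n := by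
      refine Real.log_le_log ?_ (by exact_mod_cast cnt_le x s)
      rw [hP s]
      exact mul_pos hn' (Finset.mem_filter.mp hs).2
    linarith
  have hle := Finset.sum_le_sum hterm
  rw [Finset.sum_add_distrib, Finset.sum_sub_distrib, hsumc, hsuml, Finset.sum_const,
    nsmul_eq_mul] at hle
  have hfac := log_factorial_ge n
  rw [h1]
  linarith

end Multinomial

section LocalBound

variable {X Y : Type*} [Fintype X] [Fintype Y] [DecidableEq X] [DecidableEq Y]

/-- The probability that independent letters with laws `θ x (y i)` form a vector of the type `P`
is at most the maximal multinomial probability over the positions with `y i = b`. -/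
lemma sum_typeClass_chanProb_le {θ : X → Y → ℝ} (hθ : ∀ x y, 0 ≤ θ x y) {P : X → ℝ} {n : ℕ}
    (hn : 0 < n) {y : Fin n → Y} (hsum : ∀ i, ∑ x, θ x (y i) = 1) {b : Y} {B : ℝ} (hB : 0 ≤ B)
    (hbound : ∀ u : {i // y i = b} → X,
      ∑ w ∈ univ.filter (fun w : {i // y i = b} → X => ∀ s, cnt w s = cnt u s),
        ∏ i, θ (w i) b ≤ B) :
    ∑ x ∈ typeClass P n, chanProb θ x y ≤ B := by
  classical
  let e := Equiv.piEquivPiSubtypeProd (fun i => y i = b) (fun _ : Fin n => X)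
  have h1 : ∑ x ∈ typeClass P n, chanProb θ x y =
      ∑ w : {i // ¬ y i = b} → X, ∑ u : {i // y i = b} → X,
        (if e.symm (u, w) ∈ typeClass P n then chanProb θ (e.symm (u, w)) y else 0) := by
    have h0 := Equiv.sum_comp e.symm
      (fun x => if x ∈ typeClass P n then chanProb θ x y else 0)
    rw [Fintype.sum_prod_type_right] at h0
    rw [h0]
    simp
  have happ : ∀ (u : {i // y i = b} → X) (w : {i // ¬ y i = b} → X),
      (∀ i : {i // y i = b}, e.symm (u, w) i = u i) ∧
      (∀ i : {i // ¬ y i = b}, e.symm (u, w) i = w i) := fun u w =>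
    ⟨fun i => by simp [e, Equiv.piEquivPiSubtypeProd, i.2],
      fun i => by simp [e, Equiv.piEquivPiSubtypeProd, i.2]⟩
  have hprod : ∀ (u : {i // y i = b} → X) (w : {i // ¬ y i = b} → X),
      chanProb θ (e.symm (u, w)) y = (∏ i, θ (w i) (y i)) * ∏ i, θ (u i) b := by
    intro u w
    rw [chanProb, ← Fintype.prod_subtype_mul_prod_subtype (fun i => y i = b), mul_comm]
    congr 1
    · exact Finset.prod_congr rfl fun i _ => by rw [(happ u w).2]
    · exact Finset.prod_congr rfl fun i _ => by rw [(happ u w).1, i.2]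
  have hcnt : ∀ (u : {i // y i = b} → X) (w : {i // ¬ y i = b} → X) (s : X),
      cnt (e.symm (u, w)) s = cnt u s + cnt w s := by
    intro u w s
    simp only [cnt, Finset.card_filter]
    rw [← Fintype.sum_subtype_add_sum_subtype (fun i => y i = b)]
    congr 1
    · exact Finset.sum_congr rfl fun i _ => by rw [(happ u w).1]
    · exact Finset.sum_congr rfl fun i _ => by rw [(happ u w).2]
  -- Once the letters outside the positions with `y i = b` are fixed, membership in the type class
  -- determines the letter counts at the remaining positions.
  have hinner : ∀ w : {i // ¬ y i = b} → X, ∑ u : {i // y i = b} → X,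
      (if e.symm (u, w) ∈ typeClass P n then chanProb θ (e.symm (u, w)) y else 0) ≤
      (∏ i, θ (w i) (y i)) * B := by
    intro w
    have hw : 0 ≤ ∏ i, θ (w i) (y i) := Finset.prod_nonneg fun i _ => hθ _ _
    by_cases hex : ∃ u₀, e.symm (u₀, w) ∈ typeClass P n
    · obtain ⟨u₀, hu₀⟩ := hex
      refine le_trans ?_ (mul_le_mul_of_nonneg_left (hbound u₀) hw)
      rw [Finset.mul_sum, Finset.sum_filter]
      refine Finset.sum_le_sum fun u _ => ?_
      have hnn : 0 ≤ (∏ i, θ (w i) (y i)) * ∏ i, θ (u i) b :=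
        mul_nonneg hw (Finset.prod_nonneg fun i _ => hθ _ _)
      split_ifs with h2 h3
      · exact (hprod u w).le
      · refine absurd (fun s => ?_) h3
        rw [mem_typeClass] at h2 hu₀
        have h4 := (empDist_eq_iff hn _ _).mp (h2.trans hu₀.symm) s
        rw [hcnt, hcnt] at h4
        exact Nat.add_right_cancel h4
      · exact hnn
      · exact le_rfl
    · push Not at hex
      rw [Finset.sum_eq_zero fun u _ => if_neg (hex u)]
      exact mul_nonneg hw hB
  rw [h1]
  refine (Finset.sum_le_sum fun w _ => hinner w).trans (le_of_eq ?_)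
  rw [← Finset.sum_mul]
  have h5 := Finset.prod_univ_sum (fun _ : {i // ¬ y i = b} => (univ : Finset X))
    (fun i x => θ x (y i))
  rw [Fintype.piFinset_univ] at h5
  rw [← h5, Finset.prod_eq_one fun (i : {i // ¬ y i = b}) _ => hsum i, one_mul]

end LocalBound

/-! ### The minimizer of the information and its tilting -/

section Tilt

variable {X Y : Type*} [Fintype X] [Fintype Y] [DecidableEq X] [DecidableEq Y]

/-- The joint distributions with given marginals. -/
def couplings (P : X → ℝ) (q : Y → ℝ) : Set (X × Y → ℝ) :=
  {Q | Q ∈ jointDists Y P ∧ margY Q = q}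

lemma isCompact_couplings (P : X → ℝ) (q : Y → ℝ) : IsCompact (couplings P q) := by
  have : couplings P q = jointDists Y P ∩ margY ⁻¹' {q} := rfl
  rw [this]
  exact (isCompact_jointDists P).inter_right (isClosed_singleton.preimage continuous_margY)

lemma couplings_convex {P : X → ℝ} {q : Y → ℝ} {Q Q' : X × Y → ℝ} (hQ : Q ∈ couplings P q)
    (hQ' : Q' ∈ couplings P q) {s t : ℝ} (hs : 0 ≤ s) (ht : 0 ≤ t) (hst : s + t = 1) :
    s • Q + t • Q' ∈ couplings P q := by
  refine ⟨jointDists_convex P hQ.1 hQ'.1 hs ht hst, ?_⟩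
  rw [margY_add, hQ.2, hQ'.2, ← add_smul, hst, one_smul]

/-- The product distribution. -/
def prodDist (P : X → ℝ) (q : Y → ℝ) : X × Y → ℝ := fun s => P s.1 * q s.2

lemma prodDist_mem {P : X → ℝ} {q : Y → ℝ} (hP : P ∈ stdSimplex ℝ X) (hq : q ∈ stdSimplex ℝ Y) :
    prodDist P q ∈ couplings P q := by
  have hX : margX (prodDist P q) = P := by
    funext x
    simp [margX, prodDist, ← Finset.mul_sum, hq.2]
  have hY : margY (prodDist P q) = q := by
    funext y
    simp [margY, prodDist, ← Finset.sum_mul, hP.2]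
  refine ⟨⟨⟨fun s => mul_nonneg (hP.1 _) (hq.1 _), ?_⟩, hX⟩, hY⟩
  rw [Fintype.sum_prod_type]
  change ∑ x, margX (prodDist P q) x = 1
  rw [hX, hP.2]

lemma margX_mem {Q : X × Y → ℝ} (hQ : Q ∈ stdSimplex ℝ (X × Y)) : margX Q ∈ stdSimplex ℝ X := by
  refine ⟨fun x => Finset.sum_nonneg fun y _ => hQ.1 _, ?_⟩
  rw [← hQ.2, Fintype.sum_prod_type]
  rfl

lemma margY_mem {Q : X × Y → ℝ} (hQ : Q ∈ stdSimplex ℝ (X × Y)) : margY Q ∈ stdSimplex ℝ Y := by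
  refine ⟨fun x => Finset.sum_nonneg fun y _ => hQ.1 _, ?_⟩
  rw [← hQ.2, Fintype.sum_prod_type_right]
  rfl

lemma coupling_zero {P : X → ℝ} {q : Y → ℝ} {Q : X × Y → ℝ} (hQ : Q ∈ couplings P q) {x : X}
    {y : Y} (h : P x = 0 ∨ q y = 0) : Q (x, y) = 0 := by
  have h0 := hQ.1.1.1
  refine le_antisymm ?_ (h0 _)
  rcases h with h | h
  · rw [← h, ← hQ.1.2]; exact le_margX h0 x y
  · rw [← h, ← hQ.2]; exact le_margY h0 x y

lemma mul_log_mix_le {a b t : ℝ} (ha : 0 ≤ a) (hb : 0 ≤ b) (ht0 : 0 ≤ t) (ht1 : t ≤ 1) :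
    ((1 - t) * a + t * b) * Real.log ((1 - t) * a + t * b) ≤
      (1 - t) * (a * Real.log a) + t * (b * Real.log b) := by
  simpa [smul_eq_mul] using Real.convexOn_mul_log.2 (Set.mem_Ici.mpr ha) (Set.mem_Ici.mpr hb)
    (sub_nonneg.mpr ht1) ht0 (by ring)

/-- A minimizer of `∑ Q log Q` over a convex set charges every letter that is charged by some
element of the set. -/
lemma pos_of_phi_minimizer {A : Type*} [Fintype A] [DecidableEq A] {Q Q' : A → ℝ}
    (hQ : ∀ s, 0 ≤ Q s) (hQ' : ∀ s, 0 ≤ Q' s)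
    (hmin : ∀ t : ℝ, 0 ≤ t → t ≤ 1 → phi Q ≤ phi ((1 - t) • Q + t • Q')) {s₀ : A}
    (hs₀ : 0 < Q' s₀) : 0 < Q s₀ := by
  refine lt_of_le_of_ne (hQ s₀) fun h0 => ?_
  set b := Q' s₀ with hb
  set D := phi Q' - phi Q with hD
  -- If `Q s₀ = 0`, the entry at `s₀` adds t·b·log t beyond the convexity bound. Its slope at 0 is
  -- -∞, against minimality.
  have key : ∀ t : ℝ, 0 < t → t ≤ 1 → 0 ≤ D + b * Real.log t := by
    intro t ht0 ht1
    have h1 : phi ((1 - t) • Q + t • Q') ≤ (1 - t) * phi Q + t * phi Q' + t * b * Real.log t := by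
      simp only [phi]
      rw [Finset.mul_sum, Finset.mul_sum, ← Finset.sum_add_distrib]
      have h2 : t * b * Real.log t = ∑ s, if s = s₀ then t * b * Real.log t else 0 := by simp
      rw [h2, ← Finset.sum_add_distrib]
      refine Finset.sum_le_sum fun s _ => ?_
      simp only [Pi.add_apply, Pi.smul_apply, smul_eq_mul]
      split_ifs with hs
      · subst hs
        rw [← h0, ← hb, mul_zero, zero_add, zero_mul, mul_zero, zero_add,
          Real.log_mul ht0.ne' hs₀.ne']
        exact le_of_eq (by ring)
      · rw [add_zero]
        exact mul_log_mix_le (hQ s) (hQ' s) ht0.le ht1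
    have h3 := hmin t ht0.le ht1
    have h4 : 0 ≤ t * (D + b * Real.log t) := by rw [hD]; nlinarith
    exact nonneg_of_mul_nonneg_right h4 ht0
  -- For this `t` the term b·log t equals -(|D|+1).
  have h5 := key (Real.exp (-((|D| + 1) / b))) (Real.exp_pos _)
    (Real.exp_le_one_iff.mpr (by rw [neg_nonpos]; positivity))
  rw [Real.log_exp, mul_neg, mul_div_cancel₀ _ hs₀.ne'] at h5
  linarith [le_abs_self D]

/-- This is log(u/a) ≤ u/a - 1 multiplied by u. The explicit quadratic remainder gives first-order
conditions without differentiation. -/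
lemma mul_log_le_quadratic {a u : ℝ} (ha : 0 < a) (hu : 0 ≤ u) :
    u * Real.log u ≤ a * Real.log a + (u - a) * Real.log a + (u - a) + (u - a) ^ 2 / a := by
  rcases hu.eq_or_lt with rfl | hu
  · simp
    field_simp
    linarith
  have h1 := Real.log_le_sub_one_of_pos (div_pos hu ha)
  rw [Real.log_div hu.ne' ha.ne'] at h1
  have h2 := mul_le_mul_of_nonneg_left h1 hu.le
  have h3 : u * (u / a - 1) = (u - a) + (u - a) ^ 2 / a := by field_simp; ring
  linarith

/-- The first-order condition for a minimizer of `∑ Q log Q`. -/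
lemma phi_le_cross_of_minimizer {A : Type*} [Fintype A] [DecidableEq A] {Q Q' : A → ℝ}
    (hQ : ∀ s, 0 ≤ Q s) (hQ' : ∀ s, 0 ≤ Q' s) (hsum : ∑ s, Q s = ∑ s, Q' s)
    (hzero : ∀ s, Q s = 0 → Q' s = 0)
    (hmin : ∀ t : ℝ, 0 ≤ t → t ≤ 1 → phi Q ≤ phi ((1 - t) • Q + t • Q')) :
    phi Q ≤ ∑ s, Q' s * Real.log (Q s) := by
  set K := ∑ s, (Q' s - Q s) ^ 2 / Q s with hK
  set L := (∑ s, Q' s * Real.log (Q s)) - phi Q with hL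
  -- Along the segment phi is at most phi Q + tL + t²K; minimality and division by `t` give the
  -- claim, and t → 0 then gives L ≥ 0.
  have key : ∀ t : ℝ, 0 < t → t ≤ 1 → 0 ≤ L + t * K := by
    intro t ht0 ht1
    have h1 : phi ((1 - t) • Q + t • Q') ≤ phi Q + t * L + t * (∑ s, Q' s - ∑ s, Q s) +
        t ^ 2 * K := by
      rw [hL, hK]
      simp only [phi]
      rw [← Finset.sum_sub_distrib, ← Finset.sum_sub_distrib, Finset.mul_sum, Finset.mul_sum,
        Finset.mul_sum, ← Finset.sum_add_distrib, ← Finset.sum_add_distrib,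
        ← Finset.sum_add_distrib]
      refine Finset.sum_le_sum fun s _ => ?_
      simp only [Pi.add_apply, Pi.smul_apply, smul_eq_mul]
      rcases (hQ s).eq_or_lt with h | h
      · simp [← h, hzero s h.symm]
      have h2 := mul_log_le_quadratic h (u := (1 - t) * Q s + t * Q' s)
        (add_nonneg (mul_nonneg (by linarith) h.le) (mul_nonneg ht0.le (hQ' s)))
      have h3 : (1 - t) * Q s + t * Q' s - Q s = t * (Q' s - Q s) := by ring
      rw [h3] at h2
      refine h2.trans (le_of_eq ?_)
      ring
    have h3 := hmin t ht0.le ht1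
    rw [hsum, sub_self, mul_zero, add_zero] at h1
    have h4 : 0 ≤ t * (L + t * K) := by nlinarith
    exact nonneg_of_mul_nonneg_right h4 ht0
  have h5 : Tendsto (fun k : ℕ => L + 1 / ((k : ℝ) + 1) * K) atTop (nhds (L + 0 * K)) :=
    ((tendsto_one_div_add_atTop_nhds_zero_nat (𝕜 := ℝ)).mul_const K).const_add L
  rw [zero_mul, add_zero] at h5
  have h6 : 0 ≤ L := ge_of_tendsto' h5 fun k =>
    key _ (one_div_succ_bounds k).1 (one_div_succ_bounds k).2
  linarith

/-- `Qs` minimizes the information over the couplings with f ≥ v. It has full support because `Qm`,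
slightly mixed with the product distribution, stays in this set. Its information is at least `R`,
since otherwise a small step towards `Qm` would give I ≤ R and f > v. The first-order condition
transfers the bound `R` from `Qs` to the cross term of every competitor. -/
lemma exists_tilted {W : X → Y → ℝ} {P : X → ℝ} {q : Y → ℝ} {v R : ℝ}
    (hP : P ∈ stdSimplex ℝ X) (hq : q ∈ stdSimplex ℝ Y)
    (hR : ∀ Q ∈ couplings P q, info P Q ≤ R → linLik W Q ≤ v)
    {Qm : X × Y → ℝ} (hQm : Qm ∈ couplings P q) (hv : v < linLik W Qm) :
    ∃ Qs ∈ couplings P q, (∀ x y, 0 < P x → 0 < q y → 0 < Qs (x, y)) ∧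
      ∀ Q ∈ couplings P q, v ≤ linLik W Q →
        R ≤ (∑ s, Q s * Real.log (Qs s)) - phi P - phi q := by
  set K := couplings P q ∩ {Q | v ≤ linLik W Q} with hK_def
  have hcomp : IsCompact K := (isCompact_couplings P q).inter_right
    (isClosed_le continuous_const (continuous_linLik W))
  obtain ⟨Qs, ⟨hQs, hQsv⟩, hmin⟩ := hcomp.exists_isMinOn ⟨Qm, hQm, hv.le⟩
    continuous_phi.continuousOn
  have hconv : ∀ Q ∈ K, ∀ t : ℝ, 0 ≤ t → t ≤ 1 → phi Qs ≤ phi ((1 - t) • Qs + t • Q) := by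
    intro Q hQ t ht0 ht1
    refine hmin ⟨couplings_convex hQs hQ.1 (by linarith) ht0 (by ring), ?_⟩
    change v ≤ linLik W _
    rw [linLik_add]
    have h1 : v ≤ linLik W Qs := hQsv
    have h2 : v ≤ linLik W Q := hQ.2
    nlinarith
  have hpos : ∀ x y, 0 < P x → 0 < q y → 0 < Qs (x, y) := by
    intro x y hx hy
    have hlim := tendsto_segment Qm (prodDist P q)
    have hev : ∀ᶠ k : ℕ in atTop, v < linLik W ((1 - 1 / ((k : ℝ) + 1)) • Qm +
        (1 / ((k : ℝ) + 1)) • prodDist P q) :=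
      (((continuous_linLik W).tendsto Qm).comp hlim).eventually_const_lt hv
    obtain ⟨k, hk⟩ := hev.exists
    obtain ⟨hk0, hk1⟩ := one_div_succ_bounds k
    have hmem := couplings_convex hQm (prodDist_mem hP hq) (sub_nonneg.mpr hk1) hk0.le (by ring)
    refine pos_of_phi_minimizer hQs.1.1.1 hmem.1.1.1 (hconv _ ⟨hmem, hk.le⟩) ?_
    simp only [Pi.add_apply, Pi.smul_apply, smul_eq_mul, prodDist]
    have := mul_nonneg (sub_nonneg.mpr hk1) (hQm.1.1.1 (x, y))
    have : 0 < 1 / ((k : ℝ) + 1) * (P x * q y) := by positivity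
    linarith
  have hinfo : R ≤ info P Qs := by
    by_contra hlt
    push Not at hlt
    have hlim := tendsto_segment Qs Qm
    obtain ⟨k, hk⟩ := ((((continuous_info P).tendsto Qs).comp hlim).eventually_lt_const hlt).exists
    obtain ⟨hk0, hk1⟩ := one_div_succ_bounds k
    have h1 := hR _ (couplings_convex hQs hQm (sub_nonneg.mpr hk1) hk0.le (by ring)) hk.le
    rw [linLik_add] at h1
    have h2 : v ≤ linLik W Qs := hQsv
    nlinarith
  refine ⟨Qs, hQs, hpos, fun Q hQ hvQ => ?_⟩
  have h1 := phi_le_cross_of_minimizer hQs.1.1.1 hQ.1.1.1 (by rw [hQs.1.1.2, hQ.1.1.2])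
    (fun s hs => by
      obtain ⟨x, y⟩ := s
      refine coupling_zero hQ ?_
      by_contra hne
      push Not at hne
      have hx := lt_of_le_of_ne (hP.1 x) hne.1.symm
      have hy := lt_of_le_of_ne (hq.1 y) hne.2.symm
      exact (hpos x y hx hy).ne' hs) (hconv Q ⟨hQ, hvQ⟩)
  rw [info, hQs.2] at hinfo
  linarith

/-- The fraction of the vectors of the type `P` whose normalized log-likelihood exceeds a level
not exceeded by the distributions with `I ≤ R` is `O(exp (-n R))`, without a polynomial factor. -/
theorem exists_card_exceed_le {W : X → Y → ℝ} {P : X → ℝ} {q : Y → ℝ} {v R : ℝ}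
    (hP : P ∈ stdSimplex ℝ X) (hq : q ∈ stdSimplex ℝ Y)
    (hR : ∀ Q ∈ couplings P q, info P Q ≤ R → linLik W Q ≤ v) :
    ∃ C : ℝ, ∀ n : ℕ, 0 < n → ∀ y : Fin n → Y, empDist y = q →
      (((typeClass P n).filter fun x => v < linLik W (empJoint x y)).card : ℝ) /
        (typeClass P n).card ≤ Real.exp (C - n * R) := by
  by_cases hex : ∃ Qm ∈ couplings P q, v < linLik W Qm
  swap
  · push Not at hex
    refine ⟨0, fun n hn y hy => ?_⟩
    rw [Finset.filter_false_of_mem, Finset.card_empty, Nat.cast_zero, zero_div]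
    · exact (Real.exp_pos _).le
    · intro x hx
      exact not_lt.mpr (hex _ ⟨empJoint_mem hn hx y, by rw [margY_empJoint, hy]⟩)
  obtain ⟨Qm, hQm, hv⟩ := hex
  obtain ⟨Qs, hQs, hpos, hcross⟩ := exists_tilted hP hq hR hQm hv
  obtain ⟨b, hb⟩ : ∃ b, 0 < q b := by
    by_contra hno
    push Not at hno
    have h1 := hq.2
    rw [Finset.sum_eq_zero fun y _ => le_antisymm (hno y) (hq.1 y)] at h1
    exact zero_ne_one h1
  -- The new measure: given `y`, the letters are drawn independently from the conditional law of
  -- `Qs`.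
  set θ : X → Y → ℝ := fun x y => Qs (x, y) / q y with hθ
  have hθ0 : ∀ x y, 0 ≤ θ x y := fun x y => div_nonneg (hQs.1.1.1 _) (hq.1 y)
  have hθsum : ∀ y, 0 < q y → ∑ x, θ x y = 1 := by
    intro y hy
    simp only [hθ]
    rw [← Finset.sum_div, div_eq_one_iff_eq hy.ne', ← hQs.2]
    rfl
  have hS : univ.filter (fun x => 0 < θ x b) = univ.filter (fun x => 0 < P x) := by
    refine Finset.filter_congr fun x _ => ?_
    constructor
    · intro h
      refine lt_of_le_of_ne (hP.1 x) fun h0 => h.ne' ?_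
      simp [hθ, coupling_zero hQs (Or.inl h0.symm : P x = 0 ∨ q b = 0)]
    · intro h
      exact div_pos (hpos x b h hb) hb
  set k : ℝ := ((univ.filter (fun x => 0 < P x)).card : ℝ) with hk
  set C₁ : ℝ := 1 + ∑ x ∈ univ.filter (fun x => 0 < P x), (1 - Real.log (θ x b) / 2) with hC₁
  refine ⟨C₁ - (k - 1) / 2 * Real.log (q b) + k, fun n hn y hy => ?_⟩
  have hn' : (0 : ℝ) < n := by exact_mod_cast hn
  rcases (typeClass P n).eq_empty_or_nonempty with hT | hT
  · rw [hT]
    simpa using (Real.exp_pos _).le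
  have hqy : ∀ i, 0 < q (y i) := by
    intro i
    rw [← hy, empDist_eq]
    have : 0 < cnt y (y i) := Finset.card_pos.mpr ⟨i, by simp⟩
    positivity
  have hm : (Fintype.card {i // y i = b} : ℝ) = n * q b := by
    rw [Fintype.card_subtype, ← hy, empDist_eq, cnt]
    field_simp
  have hm0 : 0 < Fintype.card {i // y i = b} := by
    have : (0 : ℝ) < Fintype.card {i // y i = b} := by rw [hm]; positivity
    exact_mod_cast this
  -- A single letter `b` suffices: its positions number n·q(b), proportional to n, and θ(·|b) has
  -- the same support as `P`, so the full order n^{-(k-1)/2} is reached.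
  have hB : ∑ x ∈ typeClass P n, chanProb θ x y ≤
      Real.exp (C₁ - (k - 1) / 2 * (Real.log n + Real.log (q b))) := by
    refine sum_typeClass_chanProb_le hθ0 hn (fun i => hθsum _ (hqy i)) (b := b)
      (Real.exp_pos _).le fun u => ?_
    have h1 := multinomial_le (fun x => hθ0 x b) (hθsum b hb) hm0 u
    rw [hS, hm, Real.log_mul hn'.ne' hb.ne'] at h1
    exact h1
  set F := (typeClass P n).filter fun x => v < linLik W (empJoint x y) with hF
  -- Under θ every exceeding vector has a large probability, by the cross-term inequality; summing
  -- these probabilities bounds their number.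
  have hterm : ∀ x ∈ F, Real.exp (n * (R + phi P)) ≤ chanProb θ x y := by
    intro x hx
    obtain ⟨hxT, hxv⟩ := Finset.mem_filter.mp hx
    have hmem : empJoint x y ∈ couplings P q :=
      ⟨empJoint_mem hn hxT y, by rw [margY_empJoint, hy]⟩
    have hsupp : SuppIn θ (empJoint x y) := by
      intro s t hst
      refine coupling_zero hmem ?_
      by_contra hne
      push Not at hne
      have h1 := lt_of_le_of_ne (hP.1 s) hne.1.symm
      have h2 := lt_of_le_of_ne (hq.1 t) hne.2.symm
      exact (div_pos (hpos s t h1 h2) h2).ne' hst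
    rw [chanProb_eq_exp hθ0 hn hsupp, Real.exp_le_exp]
    refine mul_le_mul_of_nonneg_left ?_ hn'.le
    have h3 := hcross _ hmem hxv.le
    have h4 : linLik θ (empJoint x y) =
        (∑ s, empJoint x y s * Real.log (Qs s)) - phi q := by
      rw [← hmem.2, ← sum_mul_log_margY, hmem.2, Fintype.sum_prod_type, linLik,
        ← Finset.sum_sub_distrib]
      refine Finset.sum_congr rfl fun s _ => ?_
      rw [← Finset.sum_sub_distrib]
      refine Finset.sum_congr rfl fun t _ => ?_
      by_cases h5 : P s = 0 ∨ q t = 0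
      · simp [coupling_zero hmem h5]
      · push Not at h5
        have h6 := lt_of_le_of_ne (hP.1 s) h5.1.symm
        have h7 := lt_of_le_of_ne (hq.1 t) h5.2.symm
        simp only [hθ]
        rw [Real.log_div (hpos s t h6 h7).ne' h7.ne']
        ring
    rw [h4]
    linarith
  have h1 : (F.card : ℝ) * Real.exp (n * (R + phi P)) ≤
      Real.exp (C₁ - (k - 1) / 2 * (Real.log n + Real.log (q b))) := by
    refine le_trans ?_ hB
    rw [← nsmul_eq_mul]
    refine (Finset.card_nsmul_le_sum F _ _ hterm).trans ?_
    exact Finset.sum_le_sum_of_subset_of_nonneg (Finset.filter_subset _ _)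
      fun x _ _ => chanProb_nonneg hθ0 x y
  have h2 : (0 : ℝ) < (typeClass P n).card := by exact_mod_cast Finset.card_pos.mpr hT
  have h3 := log_card_typeClass_ge hn hT
  rw [Real.le_log_iff_exp_le h2] at h3
  rw [div_le_iff₀ h2]
  refine le_trans ?_ (mul_le_mul_of_nonneg_left h3 (Real.exp_pos _).le)
  rw [← Real.exp_add]
  rw [← le_div_iff₀ (Real.exp_pos _), ← Real.exp_sub] at h1
  refine h1.trans (le_of_eq ?_)
  congr 1
  ring

end Tilt

/-! ### Joint types near a given coupling -/

section Rounding

variable {X Y : Type*} [Fintype X] [Fintype Y] [DecidableEq X] [DecidableEq Y]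

lemma exists_cnt_eq {X : Type*} [Fintype X] [DecidableEq X] {N : ℕ} {r : X → ℕ}
    (hr : ∑ x, r x = N) : ∃ u : Fin N → X, ∀ x, cnt u x = r x := by
  obtain ⟨u, hu⟩ := exists_joint_cnt (fun _ : Fin N => ()) (fun p : Unit × X => r p.2)
    (fun s => by rw [hr]; simp [cnt])
  refine ⟨u, fun x => ?_⟩
  have h2 := hu ((), x)
  simp only [cnt, Prod.mk.injEq, true_and] at h2
  exact h2

/-- Nonnegative integer matrices with given marginals exist. -/
lemma exists_matrix_of_marginals {r : X → ℕ} {s : Y → ℕ} (h : ∑ x, r x = ∑ y, s y) :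
    ∃ d : X × Y → ℕ, (∀ x, ∑ y, d (x, y) = r x) ∧ (∀ y, ∑ x, d (x, y) = s y) ∧
      ∀ p, d p ≤ ∑ x, r x := by
  -- Pair two vectors with letter counts `r` and `s`; their joint counts form the matrix.
  obtain ⟨u, hu⟩ := exists_cnt_eq (rfl : ∑ x, r x = ∑ x, r x)
  obtain ⟨v, hv⟩ := exists_cnt_eq h.symm
  refine ⟨cnt fun i => (u i, v i), fun x => ?_, fun y => ?_, fun p => cnt_le _ _⟩
  · rw [sum_cnt_pair, hu]
  · rw [← hv, ← sum_cnt_pair v u]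
    exact Finset.sum_congr rfl fun x _ => (cnt_swap u v x y).symm

/-- Round n(1-ε)Q down. The shrinking keeps its marginals below those of nP and of `y`, although the
type of `y` need not be `q`. The leftover marginals have total at most nε + |X × Y| and are filled
by an arbitrary matrix. -/
lemma exists_empJoint_near {P : X → ℝ} {q : Y → ℝ} {Q : X × Y → ℝ} (hQ : Q ∈ couplings P q)
    {n : ℕ} (hn : 0 < n) (hT : (typeClass P n).Nonempty) {y : Fin n → Y} {ε : ℝ} (hε0 : 0 ≤ ε)
    (hε1 : ε ≤ 1) (hy : ∀ b, (1 - ε) * q b ≤ empDist y b) :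
    ∃ x ∈ typeClass P n, ∀ s, |empJoint x y s - Q s| ≤
      ε + (Fintype.card (X × Y) : ℝ) / n := by
  obtain ⟨x₀, hx₀⟩ := hT
  have hn' : (0 : ℝ) < n := by exact_mod_cast hn
  have hP : ∀ x, (cnt x₀ x : ℝ) = n * P x := by
    intro x
    rw [← mem_typeClass.mp hx₀, empDist_eq]
    field_simp
  have hqy : ∀ b, (cnt y b : ℝ) = n * empDist y b := by
    intro b
    rw [empDist_eq]
    field_simp
  have hQ0 := hQ.1.1.1
  have hε : 0 ≤ 1 - ε := by linarith
  let a : X × Y → ℕ := fun s => ⌊n * ((1 - ε) * Q s)⌋₊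
  have ha : ∀ s, (a s : ℝ) ≤ n * ((1 - ε) * Q s) := fun s =>
    Nat.floor_le (mul_nonneg hn'.le (mul_nonneg hε (hQ0 s)))
  have ha' : ∀ s, n * ((1 - ε) * Q s) - 1 ≤ a s := fun s => (Nat.sub_one_lt_floor _).le
  have hrow : ∀ x, ∑ t, a (x, t) ≤ cnt x₀ x := by
    intro x
    have h1 : (∑ t, (a (x, t) : ℝ)) ≤ cnt x₀ x := by
      calc _ ≤ ∑ t, n * ((1 - ε) * Q (x, t)) := Finset.sum_le_sum fun t _ => ha _
        _ = n * ((1 - ε) * P x) := by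
            rw [← Finset.mul_sum, ← Finset.mul_sum, ← hQ.1.2]
            rfl
        _ ≤ _ := by
            rw [hP]
            have hPx : 0 ≤ P x := by
              rw [← hQ.1.2]
              exact Finset.sum_nonneg fun _ _ => hQ0 _
            refine mul_le_mul_of_nonneg_left ?_ hn'.le
            nlinarith
    exact_mod_cast h1
  have hcol : ∀ t, ∑ x, a (x, t) ≤ cnt y t := by
    intro t
    have h1 : (∑ x, (a (x, t) : ℝ)) ≤ cnt y t := by
      calc _ ≤ ∑ x, n * ((1 - ε) * Q (x, t)) := Finset.sum_le_sum fun x _ => ha _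
        _ = n * ((1 - ε) * q t) := by
            rw [← Finset.mul_sum, ← Finset.mul_sum, ← hQ.2]
            rfl
        _ ≤ _ := by
            rw [hqy]
            exact mul_le_mul_of_nonneg_left (hy t) hn'.le
    exact_mod_cast h1
  have hcx : ∑ x, cnt x₀ x = n := by simpa using sum_cnt x₀
  have hcy : ∑ t, cnt y t = n := by simpa using sum_cnt y
  have htot : ∑ x, (cnt x₀ x - ∑ t, a (x, t)) = n - ∑ s, a s := by
    rw [Finset.sum_tsub_distrib _ fun x _ => hrow x, hcx, Fintype.sum_prod_type]
  have htot' : ∑ t, (cnt y t - ∑ x, a (x, t)) = n - ∑ s, a s := by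
    rw [Finset.sum_tsub_distrib _ fun t _ => hcol t, hcy, Fintype.sum_prod_type_right]
  obtain ⟨d, hd1, hd2, hd3⟩ := exists_matrix_of_marginals (htot.trans htot'.symm)
  obtain ⟨x, hx⟩ := exists_joint_cnt y (fun p : Y × X => a (p.2, p.1) + d (p.2, p.1)) (fun t => by
    rw [Finset.sum_add_distrib, hd2]
    have := hcol t
    lia)
  have hx' : ∀ s : X × Y, cnt (fun i => (x i, y i)) s = a s + d s := fun s => by
    rw [← cnt_swap, hx]
  refine ⟨x, ?_, fun s => ?_⟩
  · rw [mem_typeClass, ← mem_typeClass.mp hx₀, empDist_eq_iff hn]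
    intro z
    rw [← sum_cnt_pair x y, Finset.sum_congr rfl fun t _ => hx' (z, t), Finset.sum_add_distrib, hd1]
    have := hrow z
    lia
  · have hQ1 : Q s ≤ 1 := by
      rw [← hQ.1.1.2]
      exact Finset.single_le_sum (fun s _ => hQ0 s) (Finset.mem_univ s)
    have hcard : (1 : ℝ) ≤ Fintype.card (X × Y) := by
      exact_mod_cast Fintype.card_pos_iff.mpr ⟨s⟩
    have hsum : (n : ℝ) * (1 - ε) - Fintype.card (X × Y) ≤ ∑ s, (a s : ℝ) := by
      calc _ = ∑ s, (n * ((1 - ε) * Q s) - 1) := by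
            rw [Finset.sum_sub_distrib, ← Finset.mul_sum, ← Finset.mul_sum, hQ.1.1.2]
            simp
        _ ≤ _ := Finset.sum_le_sum fun s _ => ha' s
    have hds : (d s : ℝ) ≤ n * ε + Fintype.card (X × Y) := by
      have h1 := hd3 s
      rw [htot] at h1
      have h2 : d s + ∑ s, a s ≤ n := by
        have h3 : ∑ s, a s ≤ n := by
          rw [Fintype.sum_prod_type, ← hcx]
          exact Finset.sum_le_sum fun x _ => hrow x
        lia
      have h3 : (d s : ℝ) + ∑ s, (a s : ℝ) ≤ n := by exact_mod_cast h2
      linarith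
    have hd0 : (0 : ℝ) ≤ d s := Nat.cast_nonneg _
    have h4 := ha s
    have h5 := ha' s
    have h6 : n * ε * Q s ≤ n * ε := by
      have : 0 ≤ n * ε := by positivity
      nlinarith
    have h7 : 0 ≤ n * ε * Q s := mul_nonneg (by positivity) (hQ0 s)
    rw [empJoint, empDist_eq, hx' s]
    have e1 : (((a s + d s : ℕ) : ℝ) / n - Q s) = ((a s + d s : ℝ) - n * Q s) / n := by
      push_cast
      field_simp
    have e2 : ε + (Fintype.card (X × Y) : ℝ) / n = (n * ε + Fintype.card (X × Y)) / n := by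
      field_simp
    rw [e1, e2, abs_div, abs_of_pos hn']
    refine div_le_div_of_nonneg_right (abs_le.mpr ⟨?_, ?_⟩) hn'.le <;> nlinarith

/-- If the types of the vectors `y j` converge to `q`, then each coupling of `P` and `q` is the
limit of joint types with the `y j`. -/
lemma eventually_exists_empJoint_mem {P : X → ℝ} {q : Y → ℝ} {Q : X × Y → ℝ}
    (hQ : Q ∈ couplings P q) {m : ℕ → ℕ} (hm : Tendsto m atTop atTop)
    (hT : ∀ j, (typeClass P (m j)).Nonempty) {y : ∀ j, Fin (m j) → Y}
    (hy : Tendsto (fun j => empDist (y j)) atTop (nhds q)) {U : Set (X × Y → ℝ)}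
    (hU : U ∈ nhds Q) :
    ∀ᶠ j in atTop, ∃ x ∈ typeClass P (m j), empJoint x (y j) ∈ U := by
  obtain ⟨r, hr, hball⟩ := Metric.mem_nhds_iff.mp hU
  set ε := min (r / 3) 1 with hε
  have hε0 : 0 < ε := lt_min (by positivity) one_pos
  have h1 : ∀ᶠ j in atTop, ∀ b, (1 - ε) * q b ≤ empDist (y j) b := by
    rw [eventually_all]
    intro b
    have hqb : 0 ≤ q b := by
      rw [← hQ.2]
      exact Finset.sum_nonneg fun _ _ => hQ.1.1.1 _
    rcases hqb.eq_or_lt with h | h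
    · refine Eventually.of_forall fun j => ?_
      rw [← h, mul_zero, empDist_eq]
      positivity
    · have h2 := (tendsto_pi_nhds.mp hy b).eventually_const_lt
        (show (1 - ε) * q b < q b by nlinarith)
      exact h2.mono fun j hj => hj.le
  have h2 : Tendsto (fun j => (Fintype.card (X × Y) : ℝ) / m j) atTop (nhds 0) :=
    (tendsto_const_div_atTop_nhds_zero_nat _).comp hm
  filter_upwards [h1, h2.eventually_lt_const (show 0 < r / 3 by positivity),
    hm.eventually_gt_atTop 0] with j hj1 hj2 hj3
  obtain ⟨x, hx, hxs⟩ := exists_empJoint_near hQ hj3 (hT j) hε0.le (min_le_right _ _) hj1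
  refine ⟨x, hx, hball ?_⟩
  rw [Metric.mem_ball, dist_pi_lt_iff hr]
  intro s
  rw [Real.dist_eq]
  have := min_le_left (r / 3) 1
  refine (hxs s).trans_lt ?_
  rw [hε]
  linarith

end Rounding

/-! ### The list size exponent: bounds for a fixed block length -/

section ListBounds

variable {X Y : Type*} [Fintype X] [Fintype Y] [DecidableEq X] [DecidableEq Y]

lemma suppIn_of_pos {W : X → Y → ℝ} {P : X → ℝ} (hWP : ∀ x y, 0 < P x → 0 < W x y)
    {Q : X × Y → ℝ} (hQ : Q ∈ jointDists Y P) : SuppIn W Q := by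
  intro x y hxy
  have h1 : ¬ 0 < P x := fun h => (hWP x y h).ne' hxy
  refine le_antisymm ?_ (hQ.1.1 _)
  exact (le_margX hQ.1.1 x y).trans (by rw [hQ.2]; exact not_lt.mp h1)

lemma add_logLik_le_iff {W : X → Y → ℝ} {P : X → ℝ} (hWP : ∀ x y, 0 < P x → 0 < W x y)
    {Q Q' : X × Y → ℝ} (hQ : Q ∈ jointDists Y P) (hQ' : Q' ∈ jointDists Y P) (T : ℝ) :
    (T : EReal) + logLik W Q ≤ logLik W Q' ↔ T + linLik W Q ≤ linLik W Q' := by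
  rw [logLik_of_suppIn (suppIn_of_pos hWP hQ), logLik_of_suppIn (suppIn_of_pos hWP hQ'),
    ← EReal.coe_add, EReal.coe_le_coe_iff]

/-- The exponent of a pair of joint types in the list size. -/
noncomputable def listVal (W : X → Y → ℝ) (P : X → ℝ) (R : ℝ)
    (z : (X × Y → ℝ) × (X × Y → ℝ)) : ℝ :=
  cdiv W P z.1 + (info P z.2 - R)

lemma continuous_listVal (W : X → Y → ℝ) (P : X → ℝ) (R : ℝ) : Continuous (listVal W P R) := by
  unfold listVal
  exact ((continuous_cdiv W P).comp continuous_fst).add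
    (((continuous_info P).comp continuous_snd).sub continuous_const)

open Classical in
/-- The expected number of wrong listed codewords, given the transmitted and received vectors. -/
noncomputable def condList (W : X → Y → ℝ) (P : X → ℝ) (R T : ℝ) {n : ℕ} (x : Fin n → X)
    (y : Fin n → Y) : ℝ :=
  ((codeSize R n : ℝ) - 1) * ((∑ x' ∈ (typeClass P n).filter fun x' =>
    (T : EReal) + logLik W (empJoint x y) ≤ logLik W (empJoint x' y),
      okFrac W P T x' y ^ (codeSize R n - 2)) / (typeClass P n).card)

lemma condList_nonneg (W : X → Y → ℝ) (P : X → ℝ) {R : ℝ} (hR : 0 < R) (T : ℝ) {n : ℕ}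
    (hn : 0 < n) (x : Fin n → X) (y : Fin n → Y) : 0 ≤ condList W P R T x y := by
  have hM : (2 : ℝ) ≤ codeSize R n := by exact_mod_cast two_le_codeSize hR hn
  refine mul_nonneg (by linarith) (div_nonneg (Finset.sum_nonneg fun z _ =>
    pow_nonneg (okFrac_nonneg W P T z y) _) (Nat.cast_nonneg _))

lemma listAvg_eq (W : X → Y → ℝ) (P : X → ℝ) {R : ℝ} (hR : 0 < R) (T : ℝ) {n : ℕ}
    (hn : 0 < n) (hT : (typeClass P n).Nonempty) :
    codeAvg P n (codeSize R n) (fun C => listSize W C (decRegion W T C)) =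
      (1 / ((typeClass P n).card : ℝ)) * ∑ x ∈ typeClass P n, ∑ y,
        chanProb W x y * condList W P R T x y := by
  classical
  have hc : ((typeClass P n).card : ℝ) ≠ 0 := by exact_mod_cast Finset.card_ne_zero.mpr hT
  rw [codeAvg_listSize W P T (two_le_codeSize hR hn) hT]
  have h1 : ∀ x ∈ typeClass P n, ∀ y : Fin n → Y, chanProb W x y * condList W P R T x y =
      ((codeSize R n : ℝ) - 1) / (typeClass P n).card *
        ∑ x' ∈ typeClass P n, (if (T : EReal) + logLik W (empJoint x y) ≤
          logLik W (empJoint x' y) then chanProb W x y else 0) *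
          okFrac W P T x' y ^ (codeSize R n - 2) := by
    intro x _ y
    have h2 : ∑ x' ∈ typeClass P n, (if (T : EReal) + logLik W (empJoint x y) ≤
          logLik W (empJoint x' y) then chanProb W x y else 0) *
          okFrac W P T x' y ^ (codeSize R n - 2) =
        chanProb W x y * ∑ x' ∈ (typeClass P n).filter fun x' =>
          (T : EReal) + logLik W (empJoint x y) ≤ logLik W (empJoint x' y),
          okFrac W P T x' y ^ (codeSize R n - 2) := by
      rw [Finset.mul_sum, Finset.sum_filter]
      exact Finset.sum_congr rfl fun x' _ => by split_ifs <;> simp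
    rw [h2, condList]
    ring
  rw [Finset.sum_congr rfl fun x hx => Finset.sum_congr rfl fun y _ => h1 x hx y]
  simp only [← Finset.mul_sum]
  field_simp

/-- The weight `okFrac ^ (M - 2)` is deliberately kept in the bound: its double-exponential decay is
what forces feasibility of the limit. -/
lemma condList_le {W : X → Y → ℝ} {P : X → ℝ} {R T : ℝ} {n : ℕ} (hn : 0 < n)
    {x : Fin n → X} {y : Fin n → Y} (hpos : 0 < condList W P R T x y) :
    ∃ x' ∈ typeClass P n, (T : EReal) + logLik W (empJoint x y) ≤ logLik W (empJoint x' y) ∧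
      condList W P R T x y ≤ Real.exp (-(n * (info P (empJoint x' y) - R)) +
        2 * slackC X Y * slack n) * okFrac W P T x' y ^ (codeSize R n - 2) := by
  classical
  set S := (typeClass P n).filter fun x' =>
    (T : EReal) + logLik W (empJoint x y) ≤ logLik W (empJoint x' y) with hS
  set w : (Fin n → X) → ℝ := fun x' => okFrac W P T x' y ^ (codeSize R n - 2) with hw
  have hw0 : ∀ x', 0 ≤ w x' := fun x' => pow_nonneg (okFrac_nonneg W P T x' y) _
  have hcl : condList W P R T x y =
      ((codeSize R n : ℝ) - 1) * ((∑ x' ∈ S, w x') / (typeClass P n).card) := by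
    rw [condList]
  have hne : S.Nonempty := by
    rw [Finset.nonempty_iff_ne_empty]
    intro h
    rw [hcl, h] at hpos
    simp at hpos
  obtain ⟨b, hb, hle⟩ := exists_dominant_type hne (fun z i => (z i, y i)) (w := w)
    (fun z _ => hw0 z)
  set S' := S.filter (fun c => ∀ s, cnt (fun i => (c i, y i)) s = cnt (fun i => (b i, y i)) s)
    with hS'
  obtain ⟨x', hx', hmax⟩ := S'.exists_max_image w ⟨b, Finset.mem_filter.mpr ⟨hb, fun _ => rfl⟩⟩
  obtain ⟨hx'S, hx'b⟩ := Finset.mem_filter.mp hx'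
  obtain ⟨hx'T, hx'l⟩ := Finset.mem_filter.mp hx'S
  refine ⟨x', hx'T, hx'l, ?_⟩
  have hc : (0 : ℝ) < (typeClass P n).card := by exact_mod_cast Finset.card_pos.mpr ⟨x', hx'T⟩
  have hsub : S' ⊆ revClass x' y := by
    intro z hz
    rw [mem_revClass hn, empJoint, empJoint, empDist_eq_iff hn]
    intro s
    rw [(Finset.mem_filter.mp hz).2 s, hx'b s]
  have h1 : ∑ z ∈ S', w z ≤ (revClass x' y).card * w x' := by
    refine (Finset.sum_le_card_nsmul S' w _ hmax).trans ?_
    rw [nsmul_eq_mul]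
    exact mul_le_mul_of_nonneg_right (by exact_mod_cast Finset.card_le_card hsub) (hw0 x')
  have h2 : ∑ z ∈ S, w z ≤ Real.exp (slackC X Y * slack n) * ((revClass x' y).card * w x') :=
    hle.trans (mul_le_mul (Real.exp_le_exp.mpr (card_mul_le_slackC n)) h1
      (Finset.sum_nonneg fun z _ => hw0 z) (Real.exp_pos _).le)
  have h3 := card_revClass_div_le (y := y) hn hx'T
  rw [hcl]
  calc ((codeSize R n : ℝ) - 1) * ((∑ x' ∈ S, w x') / (typeClass P n).card)
      ≤ Real.exp (n * R) * ((∑ x' ∈ S, w x') / (typeClass P n).card) :=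
        mul_le_mul_of_nonneg_right (codeSize_sub_one_le R n)
          (div_nonneg (Finset.sum_nonneg fun z _ => hw0 z) hc.le)
    _ ≤ Real.exp (n * R) * ((Real.exp (slackC X Y * slack n) *
          ((revClass x' y).card * w x')) / (typeClass P n).card) :=
        mul_le_mul_of_nonneg_left (div_le_div_of_nonneg_right h2 hc.le) (Real.exp_pos _).le
    _ = Real.exp (n * R) * Real.exp (slackC X Y * slack n) *
          ((revClass x' y).card / (typeClass P n).card) * w x' := by ring
    _ ≤ Real.exp (n * R) * Real.exp (slackC X Y * slack n) *
          Real.exp (-(n * info P (empJoint x' y)) + slackC X Y * slack n) * w x' :=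
        mul_le_mul_of_nonneg_right (mul_le_mul_of_nonneg_left h3 (by positivity)) (hw0 x')
    _ = _ := by
        rw [← Real.exp_add, ← Real.exp_add]
        congr 2
        ring

lemma listAvg_le {W : X → Y → ℝ} (hW : ∀ x y, 0 ≤ W x y) {P : X → ℝ} {R T : ℝ} (hR : 0 < R)
    {n : ℕ} (hn : 0 < n) (hT : (typeClass P n).Nonempty)
    (hpos : 0 < codeAvg P n (codeSize R n) fun C => listSize W C (decRegion W T C)) :
    ∃ x ∈ typeClass P n, ∃ x' ∈ typeClass P n, ∃ y : Fin n → Y,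
      (T : EReal) + logLik W (empJoint x y) ≤ logLik W (empJoint x' y) ∧
      codeAvg P n (codeSize R n) (fun C => listSize W C (decRegion W T C)) ≤
        Real.exp (-(n * listVal W P R (empJoint x y, empJoint x' y)) +
          4 * slackC X Y * slack n) * okFrac W P T x' y ^ (codeSize R n - 2) := by
  rw [listAvg_eq W P hR T hn hT] at hpos ⊢
  obtain ⟨x, hx, hle⟩ := exists_le_of_avg hT fun x => ∑ y,
        chanProb W x y * condList W P R T x y
  obtain ⟨y, -, hey, hle2⟩ := exists_dominant_output hW hn hx
    (e := fun y => condList W P R T x y) (fun y => condList_nonneg W P hR T hn x y)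
    (hpos.trans_le hle)
  obtain ⟨x', hx', hl, hle3⟩ := condList_le hn hey
  refine ⟨x, hx, x', hx', y, hl, hle.trans (hle2.trans ?_)⟩
  refine (mul_le_mul_of_nonneg_left hle3 (Real.exp_pos _).le).trans (le_of_eq ?_)
  rw [← mul_assoc, ← Real.exp_add, listVal]
  congr 2
  ring

/-- One bad vector brings along its whole `revClass`, so p is at least about e^{-nI}; then
(1-p)^(M-2) ≤ e^{-(M-2)p}. -/
lemma okFrac_pow_le {W : X → Y → ℝ} {P : X → ℝ} {R T : ℝ} {n : ℕ} (hR : 0 < R) (hn : 0 < n)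
    {x z : Fin n → X} {y : Fin n → Y} (hz : z ∈ typeClass P n)
    (hbad : ¬ (T : EReal) + logLik W (empJoint z y) ≤ logLik W (empJoint x y)) :
    okFrac W P T x y ^ (codeSize R n - 2) ≤ Real.exp (-((Real.exp (n * R) - 2) *
      Real.exp (-(n * info P (empJoint z y)) - slackC X Y * slack n))) := by
  have hT : (typeClass P n).Nonempty := ⟨z, hz⟩
  set p := ((badSet W P T x y).card : ℝ) / (typeClass P n).card with hp
  have hok : okFrac W P T x y = 1 - p := okFrac_eq W P T hT x y
  have hp1 : 0 ≤ 1 - p := hok ▸ okFrac_nonneg W P T x y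
  have hsub : revClass z y ⊆ badSet W P T x y := by
    intro w hw
    refine Finset.mem_filter.mpr ⟨revClass_subset hn hz hw, ?_⟩
    rw [(mem_revClass hn).mp hw]
    exact hbad
  have hpge : Real.exp (-(n * info P (empJoint z y)) - slackC X Y * slack n) ≤ p := by
    refine (card_revClass_div_ge hn hz).trans ?_
    exact div_le_div_of_nonneg_right (by exact_mod_cast Finset.card_le_card hsub)
      (Nat.cast_nonneg _)
  have hM := two_le_codeSize hR hn
  have h2 : 1 - p ≤ Real.exp (-p) := by linarith [Real.add_one_le_exp (-p)]
  rw [hok]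
  refine (pow_le_pow_left₀ hp1 h2 _).trans ?_
  rw [← Real.exp_nat_mul, Real.exp_le_exp, Nat.cast_sub hM, mul_neg, neg_le_neg_iff]
  have h3 : Real.exp (n * R) ≤ codeSize R n := Nat.le_ceil _
  have h4 : (0 : ℝ) ≤ (codeSize R n : ℝ) - 2 := by
    have : (2 : ℝ) ≤ codeSize R n := by exact_mod_cast hM
    linarith
  push_cast
  calc _ ≤ ((codeSize R n : ℝ) - 2) *
        Real.exp (-(n * info P (empJoint z y)) - slackC X Y * slack n) :=
        mul_le_mul_of_nonneg_right (by linarith) (Real.exp_pos _).le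
    _ ≤ _ := mul_le_mul_of_nonneg_left hpge h4

/-- Under `hbad`, (M-2)p ≤ e^C is bounded, so the weight is at least the constant e^{-2e^C}. A
polynomial factor in `hbad` could make this weight smaller than any exponential. -/
lemma listAvg_ge {W : X → Y → ℝ} (hW : ∀ x y, 0 ≤ W x y) {P : X → ℝ}
    (hWP : ∀ x y, 0 < P x → 0 < W x y) {R T : ℝ} (hR : 0 < R)
    {n : ℕ} (hn : 0 < n) {Qt Q : X × Y → ℝ} (hdt : HasDenom n Qt) (hd : HasDenom n Q)
    (hQt : Qt ∈ jointDists Y P) (hQ : Q ∈ jointDists Y P) (hm : margY Q = margY Qt)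
    (hle : T + linLik W Qt ≤ linLik W Q) {C : ℝ} (hC : Real.exp (C - n * R) ≤ 1 / 2)
    (hbad : ∀ y : Fin n → Y, empDist y = margY Q →
      (((typeClass P n).filter fun x => linLik W Q - T < linLik W (empJoint x y)).card : ℝ) /
        (typeClass P n).card ≤ Real.exp (C - n * R)) :
    Real.exp (-(n * listVal W P R (Qt, Q)) - (2 * slackC X Y + 2 * Real.exp C + 1) * slack n) ≤
      codeAvg P n (codeSize R n) fun C => listSize W C (decRegion W T C) := by
  classical
  have hT := typeClass_nonempty_of_hasDenom hn hdt hQt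
  rw [listAvg_eq W P hR T hn hT]
  refine le_avg hT fun x hx => ?_
  refine le_trans (le_of_eq ?_) (sum_chanProb_mul_ge hW hn hx hdt hQt (suppIn_of_pos hWP hQt)
    (c := -(n * (info P Q - R)) - (slackC X Y + 2 * Real.exp C + 1) * slack n)
    (fun y => condList_nonneg W P hR T hn x y) ?_)
  · rw [listVal]
    congr 1
    ring
  rintro y hxy
  have hyq : empDist y = margY Q := by rw [hm, ← hxy, margY_empJoint]
  obtain ⟨x', hx', hx'Q⟩ := exists_empJoint_of_hasDenom' hn hd hQ hyq
  have hc : (0 : ℝ) < (typeClass P n).card := by exact_mod_cast Finset.card_pos.mpr hT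
  have hok : ∀ z ∈ revClass x' y, Real.exp (-(2 * Real.exp C)) ≤
      okFrac W P T z y ^ (codeSize R n - 2) := by
    intro z hz
    have hzQ : empJoint z y = Q := by rw [(mem_revClass hn).mp hz, hx'Q]
    set p := ((badSet W P T z y).card : ℝ) / (typeClass P n).card with hp
    have hok : okFrac W P T z y = 1 - p := okFrac_eq W P T hT z y
    have hple : p ≤ Real.exp (C - n * R) := by
      refine le_trans (le_of_eq ?_) (hbad y hyq)
      rw [hp, badSet]
      congr 3
      refine Finset.filter_congr fun w hw => ?_
      rw [hzQ, add_logLik_le_iff hWP (empJoint_mem hn hw y) hQ, not_le, sub_lt_iff_lt_add']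
    have hp0 : 0 ≤ p := by positivity
    -- Valid because p ≤ 1/2, which is what `hC` provides.
    have h1 : Real.exp (-(2 * p)) ≤ 1 - p := by
      have h2 := Real.add_one_le_exp (2 * p)
      rw [Real.exp_neg, inv_le_comm₀ (Real.exp_pos _) (by linarith)]
      refine le_trans ?_ h2
      rw [inv_le_iff_one_le_mul₀ (by linarith)]
      nlinarith
    rw [hok]
    refine le_trans ?_ (pow_le_pow_left₀ (Real.exp_pos _).le h1 _)
    rw [← Real.exp_nat_mul, Real.exp_le_exp]
    have h3 : ((codeSize R n - 2 : ℕ) : ℝ) ≤ Real.exp (n * R) := by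
      rw [Nat.cast_sub (two_le_codeSize hR hn)]
      have := codeSize_sub_one_le R n
      push_cast
      linarith
    have h4 : ((codeSize R n - 2 : ℕ) : ℝ) * p ≤ Real.exp (n * R) * Real.exp (C - n * R) :=
      mul_le_mul h3 hple hp0 (Real.exp_pos _).le
    rw [← Real.exp_add, add_sub_cancel] at h4
    linarith
  have hsub : revClass x' y ⊆ (typeClass P n).filter fun x' =>
    (T : EReal) + logLik W (empJoint x y) ≤ logLik W (empJoint x' y) := by
    intro z hz
    refine Finset.mem_filter.mpr ⟨revClass_subset hn hx' hz, ?_⟩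
    rw [(mem_revClass hn).mp hz, hx'Q, hxy, add_logLik_le_iff hWP hQt hQ]
    exact hle
  have h5 : (revClass x' y).card * Real.exp (-(2 * Real.exp C)) ≤
      ∑ x' ∈ (typeClass P n).filter fun x' =>
        (T : EReal) + logLik W (empJoint x y) ≤ logLik W (empJoint x' y),
        okFrac W P T x' y ^ (codeSize R n - 2) := by
    rw [← nsmul_eq_mul]
    refine (Finset.card_nsmul_le_sum _ _ _ hok).trans ?_
    exact Finset.sum_le_sum_of_subset_of_nonneg hsub
      fun z _ _ => pow_nonneg (okFrac_nonneg W P T z y) _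
  have h6 := card_revClass_div_ge (y := y) hn hx'
  rw [hx'Q] at h6
  have h7 : Real.exp (-1) ≤ 1 / 2 := by
    rw [Real.exp_neg, ← one_div]
    refine one_div_le_one_div_of_le (by norm_num) ?_
    linarith [Real.add_one_le_exp (1 : ℝ)]
  have hsl := slack_ge_one n
  rw [condList]
  calc Real.exp (-(n * (info P Q - R)) - (slackC X Y + 2 * Real.exp C + 1) * slack n)
      ≤ Real.exp (n * R) * Real.exp (-1) *
        (Real.exp (-(n * info P Q) - slackC X Y * slack n) * Real.exp (-(2 * Real.exp C))) := by
        rw [← Real.exp_add, ← Real.exp_add, ← Real.exp_add, Real.exp_le_exp]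
        have := Real.exp_pos C
        nlinarith
    _ ≤ ((codeSize R n : ℝ) - 1) * (((revClass x' y).card / (typeClass P n).card) *
          Real.exp (-(2 * Real.exp C))) := by
        refine mul_le_mul ?_ (mul_le_mul_of_nonneg_right h6 (Real.exp_pos _).le) (by positivity) ?_
        · refine le_trans ?_ (half_exp_le_codeSize_sub_one hR hn)
          have := mul_le_mul_of_nonneg_left h7 (Real.exp_pos (n * R)).le
          linarith
        · have := half_exp_le_codeSize_sub_one hR hn
          have := Real.exp_pos (n * R)
          linarith
    _ ≤ _ := by
        refine mul_le_mul_of_nonneg_left ?_ ?_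
        · rw [div_mul_eq_mul_div]
          exact div_le_div_of_nonneg_right h5 hc.le
        · have := half_exp_le_codeSize_sub_one hR hn
          have := Real.exp_pos (n * R)
          linarith

end ListBounds

/-! ### Convexity of the mutual information -/

section InfoConvex

variable {X Y : Type*} [Fintype X] [Fintype Y] [DecidableEq X] [DecidableEq Y]

lemma phi_prodDist {P : X → ℝ} {q : Y → ℝ} (hP : P ∈ stdSimplex ℝ X) (hq : q ∈ stdSimplex ℝ Y) :
    phi (prodDist P q) = phi P + phi q := by
  have h := prodDist_mem hP hq
  have h1 := sum_mul_log_margX (prodDist P q)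
  have h2 := sum_mul_log_margY (prodDist P q)
  rw [h.1.2] at h1
  rw [h.2] at h2
  rw [phi_prod, ← h1, ← h2, ← Finset.sum_add_distrib]
  refine Finset.sum_congr rfl fun x _ => ?_
  rw [← Finset.sum_add_distrib]
  refine Finset.sum_congr rfl fun y _ => ?_
  simp only [prodDist]
  rcases eq_or_ne (P x) 0 with hx | hx
  · simp [hx]
  rcases eq_or_ne (q y) 0 with hy | hy
  · simp [hy]
  rw [Real.log_mul hx hy]
  ring

lemma info_prodDist {P : X → ℝ} {q : Y → ℝ} (hP : P ∈ stdSimplex ℝ X) (hq : q ∈ stdSimplex ℝ Y) :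
    info P (prodDist P q) = 0 := by
  rw [info, phi_prodDist hP hq, (prodDist_mem hP hq).2]
  ring

lemma phi_mix_le {A : Type*} [Fintype A] [DecidableEq A] {Q Q' : A → ℝ} (hQ : ∀ s, 0 ≤ Q s)
    (hQ' : ∀ s, 0 ≤ Q' s) {t : ℝ} (ht0 : 0 ≤ t) (ht1 : t ≤ 1) :
    phi ((1 - t) • Q + t • Q') ≤ (1 - t) * phi Q + t * phi Q' := by
  simp only [phi, Finset.mul_sum, ← Finset.sum_add_distrib]
  exact Finset.sum_le_sum fun s _ => mul_log_mix_le (hQ s) (hQ' s) ht0 ht1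

lemma info_mix_le {P : X → ℝ} {q : Y → ℝ} {Q Q' : X × Y → ℝ} (hQ : Q ∈ couplings P q)
    (hQ' : Q' ∈ couplings P q) {t : ℝ} (ht0 : 0 ≤ t) (ht1 : t ≤ 1) :
    info P ((1 - t) • Q + t • Q') ≤ (1 - t) * info P Q + t * info P Q' := by
  have h := phi_mix_le hQ.1.1.1 hQ'.1.1.1 ht0 ht1
  have hm := (couplings_convex hQ hQ' (sub_nonneg.mpr ht1) ht0 (by ring)).2
  rw [info, info, info, hm, hQ.2, hQ'.2]
  linarith

/-- Gibbs' inequality for the conditional distributions of `X` given `Y`. -/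
lemma cross_le_phi_sub {Q S : X × Y → ℝ} (hQ : ∀ s, 0 ≤ Q s) (hS : ∀ s, 0 ≤ S s)
    (hQS : ∀ s, S s = 0 → Q s = 0) :
    ∑ x, ∑ y, (Q (x, y) * Real.log (S (x, y)) - Q (x, y) * Real.log (margY S y)) ≤
      phi Q - phi (margY Q) := by
  rw [← sum_mul_log_margY Q, phi_prod, ← Finset.sum_sub_distrib]
  simp only [← Finset.sum_sub_distrib]
  -- From log t ≤ t - 1 with t = Q_Y S / (Q S_Y), multiplied by Q. The correction terms have a
  -- nonnegative total.
  have hterm : ∀ x y, Q (x, y) * Real.log (S (x, y)) - Q (x, y) * Real.log (margY S y) +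
      (Q (x, y) - margY Q y * S (x, y) / margY S y) ≤
      Q (x, y) * Real.log (Q (x, y)) - Q (x, y) * Real.log (margY Q y) := by
    intro x y
    have hc : 0 ≤ margY Q y := Finset.sum_nonneg fun _ _ => hQ _
    have hU : 0 ≤ margY S y := Finset.sum_nonneg fun _ _ => hS _
    rcases (hQ (x, y)).eq_or_lt with h | h
    · rw [← h]
      have := div_nonneg (mul_nonneg hc (hS (x, y))) hU
      linarith
    have hSp : 0 < S (x, y) := lt_of_le_of_ne (hS _) fun h0 => h.ne' (hQS _ h0.symm)
    have hcp : 0 < margY Q y := h.trans_le (le_margY hQ x y)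
    have hUp : 0 < margY S y := hSp.trans_le (le_margY hS x y)
    have h1 := Real.log_le_sub_one_of_pos
      (show 0 < margY Q y * S (x, y) / (Q (x, y) * margY S y) by positivity)
    rw [Real.log_div (by positivity) (by positivity), Real.log_mul hcp.ne' hSp.ne',
      Real.log_mul h.ne' hUp.ne'] at h1
    have h2 := mul_le_mul_of_nonneg_left h1 h.le
    have h3 : Q (x, y) * (margY Q y * S (x, y) / (Q (x, y) * margY S y) - 1) =
        margY Q y * S (x, y) / margY S y - Q (x, y) := by
      field_simp
    rw [h3] at h2
    linarith
  have hsum : 0 ≤ ∑ x, ∑ y, (Q (x, y) - margY Q y * S (x, y) / margY S y) := by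
    rw [Finset.sum_comm]
    refine Finset.sum_nonneg fun y _ => ?_
    have hc : 0 ≤ margY Q y := Finset.sum_nonneg fun _ _ => hQ _
    rw [Finset.sum_sub_distrib, ← Finset.sum_div, ← Finset.mul_sum]
    change 0 ≤ margY Q y - margY Q y * margY S y / margY S y
    rw [mul_div_assoc]
    have := mul_le_mul_of_nonneg_left (div_self_le_one (margY S y)) hc
    linarith
  have h := Finset.sum_le_sum fun x (_ : x ∈ univ) =>
    Finset.sum_le_sum fun y (_ : y ∈ univ) => hterm x y
  simp only [Finset.sum_add_distrib] at h hsum ⊢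
  linarith

/-- The second marginals may differ here, so convexity of `phi` alone is not enough. For the
midpoint S, phi S - phi S_Y is the average of the cross terms of `Q` and `Q'` with S, and Gibbs'
inequality bounds each of them. -/
lemma info_midpoint_le {P : X → ℝ} {Q Q' : X × Y → ℝ} (hQ : Q ∈ jointDists Y P)
    (hQ' : Q' ∈ jointDists Y P) {R : ℝ} (h : info P Q ≤ R) (h' : info P Q' ≤ R) :
    info P ((1 / 2 : ℝ) • Q + (1 / 2 : ℝ) • Q') ≤ R := by
  set S := (1 / 2 : ℝ) • Q + (1 / 2 : ℝ) • Q' with hS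
  have hSv : ∀ s, S s = (1 / 2) * Q s + (1 / 2) * Q' s := fun s => rfl
  have hS0 : ∀ s, 0 ≤ S s := fun s => by
    rw [hSv]
    have := hQ.1.1 s
    have := hQ'.1.1 s
    linarith
  have h1 := cross_le_phi_sub hQ.1.1 hS0 fun s hs => by
    have := hQ.1.1 s
    have := hQ'.1.1 s
    rw [hSv] at hs
    linarith
  have h2 := cross_le_phi_sub hQ'.1.1 hS0 fun s hs => by
    have := hQ.1.1 s
    have := hQ'.1.1 s
    rw [hSv] at hs
    linarith
  have h3 : phi S - phi (margY S) =
      (1 / 2) * ∑ x, ∑ y, (Q (x, y) * Real.log (S (x, y)) - Q (x, y) * Real.log (margY S y)) +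
      (1 / 2) * ∑ x, ∑ y, (Q' (x, y) * Real.log (S (x, y)) -
        Q' (x, y) * Real.log (margY S y)) := by
    rw [← sum_mul_log_margY S, phi_prod, ← Finset.sum_sub_distrib, Finset.mul_sum, Finset.mul_sum,
      ← Finset.sum_add_distrib]
    refine Finset.sum_congr rfl fun x _ => ?_
    rw [← Finset.sum_sub_distrib, Finset.mul_sum, Finset.mul_sum, ← Finset.sum_add_distrib]
    refine Finset.sum_congr rfl fun y _ => ?_
    rw [hSv (x, y)]
    ring
  unfold info at *
  linarith

end InfoConvex

/-! ### The list size exponent -/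

section ListExponent

variable {X Y : Type*} [Fintype X] [Fintype Y] [DecidableEq X] [DecidableEq Y]

/-- The conditions on a pair of joint distributions in the formula for the list size exponent. -/
structure ListFeasible (W : X → Y → ℝ) (P : X → ℝ) (R T : ℝ)
    (z : (X × Y → ℝ) × (X × Y → ℝ)) : Prop where
  fst_mem : z.1 ∈ jointDists Y P
  snd_mem : z.2 ∈ jointDists Y P
  marg : margY z.2 = margY z.1
  le_fst : T + linLik W z.1 ≤ linLik W z.2
  le_info : ∀ Q ∈ couplings P (margY z.2), info P Q ≤ R → T + linLik W Q ≤ linLik W z.2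

lemma mem_listSet_iff {W : X → Y → ℝ} {P : X → ℝ} (hWP : ∀ x y, 0 < P x → 0 < W x y) {R T : ℝ}
    {Qt Q : X × Y → ℝ} (hQt : Qt ∈ jointDists Y P) :
    Q ∈ listSet W P R T Qt ↔ ListFeasible W P R T (Qt, Q) := by
  have key : ∀ s t : EReal, (T : EReal) + s ≤ t ↔ s ≤ t - T := fun s t => by
    rw [add_comm, EReal.le_sub_iff_add_le (by simp) (by simp)]
  have h1 : ∀ hQ : Q ∈ jointDists Y P,
      ((T : EReal) + max (maxLogLik W P (margY Q) R) (logLik W Qt) ≤ logLik W Q ↔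
      (∀ Q' ∈ couplings P (margY Q), info P Q' ≤ R → T + linLik W Q' ≤ linLik W Q) ∧
      T + linLik W Qt ≤ linLik W Q) := by
    intro hQ
    rw [key, max_le_iff, ← key (logLik W Qt), add_logLik_le_iff hWP hQt hQ, maxLogLik, sSup_le_iff]
    refine and_congr_left fun _ => ?_
    constructor
    · intro h Q' hQ' hI
      rw [← add_logLik_le_iff hWP hQ'.1 hQ, key]
      exact h _ ⟨Q', hQ'.1, hQ'.2, by rwa [mutualInfo_eq hQ'.1], rfl⟩
    · rintro h v ⟨Q', hQ', hm, hI, rfl⟩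
      rw [← key, add_logLik_le_iff hWP hQ' hQ]
      exact h Q' ⟨hQ', hm⟩ (by rwa [← mutualInfo_eq hQ'])
  constructor
  · rintro ⟨hQ, hm, hle⟩
    exact ⟨hQt, hQ, hm, ((h1 hQ).mp hle).2, ((h1 hQ).mp hle).1⟩
  · rintro ⟨-, hQ, hm, hle, hI⟩
    exact ⟨hQ, hm, (h1 hQ).mpr ⟨hI, hle⟩⟩

lemma listExponent_le_of_hasDenom {W : X → Y → ℝ} (hW : ∀ x y, 0 ≤ W x y) {P : X → ℝ}
    (hWP : ∀ x y, 0 < P x → 0 < W x y) {R T : ℝ} (hR : 0 < R) {N : ℕ} (hN : 0 < N)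
    {z : (X × Y → ℝ) × (X × Y → ℝ)} (hdt : HasDenom N z.1) (hd : HasDenom N z.2)
    (hz : ListFeasible W P R T z) :
    listExponent W P R T ≤ listVal W P R z := by
  obtain ⟨C, hC⟩ := exists_card_exceed_le (W := W) (v := linLik W z.2 - T)
    (hz.snd_mem.2 ▸ margX_mem hz.snd_mem.1) (margY_mem hz.snd_mem.1)
    (fun Q hQ hI => by linarith [hz.le_info Q hQ hI])
  -- Positive multiples of N(k+1) exceed (C+1)/R, which gives e^{C-nR} ≤ e^{-1} ≤ 1/2.
  obtain ⟨k, hk⟩ := exists_nat_ge ((C + 1) / R)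
  refine expRate_le (N := N * (k + 1)) (by positivity)
    (tendsto_const_mul_slack_div (2 * slackC X Y + 2 * Real.exp C + 1)) fun n hn hNn => ?_
  have hn' : (0 : ℝ) < n := by exact_mod_cast hn
  have hNn' : N ∣ n := (dvd_mul_right _ _).trans hNn
  have hkn : (k : ℝ) ≤ n := by
    have h1 : k + 1 ≤ n := Nat.le_of_dvd hn ((dvd_mul_left _ _).trans hNn)
    exact_mod_cast (Nat.le_succ k).trans h1
  refine ⟨typeClass_nonempty_of_hasDenom hn (hdt.of_dvd hNn') hz.fst_mem, ?_⟩
  have hhalf : Real.exp (C - n * R) ≤ 1 / 2 := by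
    have h1 : C + 1 ≤ n * R := by
      rw [← div_le_iff₀ hR]
      exact hk.trans hkn
    have h2 : Real.exp (C - n * R) ≤ Real.exp (-1) := Real.exp_le_exp.mpr (by linarith)
    refine h2.trans ?_
    rw [Real.exp_neg, ← one_div]
    refine one_div_le_one_div_of_le (by norm_num) ?_
    linarith [Real.add_one_le_exp (1 : ℝ)]
  refine le_trans (le_of_eq ?_) (listAvg_ge hW hWP hR hn (hdt.of_dvd hNn') (hd.of_dvd hNn')
    hz.fst_mem hz.snd_mem hz.marg hz.le_fst hhalf (hC n hn))
  congr 1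
  field_simp
  ring

/-- The strict form of the condition on the log-likelihoods is open. -/
lemma eventually_strict {W : X → Y → ℝ} {P : X → ℝ} {R T : ℝ} {Q : X × Y → ℝ}
    {u : ℕ → X × Y → ℝ} (hu : Tendsto u atTop (nhds Q))
    (h : ∀ Q' ∈ couplings P (margY Q), info P Q' ≤ R → T + linLik W Q' < linLik W Q) :
    ∀ᶠ k in atTop, ∀ Q' ∈ couplings P (margY (u k)), info P Q' ≤ R →
      T + linLik W Q' < linLik W (u k) := by
  -- If the condition failed for infinitely many `k`, a cluster point of the violating couplings
  -- would violate it at `Q`, by compactness.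
  by_contra hno
  rw [not_eventually] at hno
  obtain ⟨φ, hφ, hφ'⟩ := extraction_of_frequently_atTop hno
  push Not at hφ'
  choose Q' hQ' hI hle using hφ'
  obtain ⟨Q₀, hQ₀, ψ, hψ, hlim⟩ := (isCompact_jointDists (Y := Y) P).tendsto_subseq
    (x := Q') fun j => (hQ' j).1
  have hu' : Tendsto (fun j => u (φ (ψ j))) atTop (nhds Q) :=
    hu.comp (hφ.tendsto_atTop.comp hψ.tendsto_atTop)
  have h1 : margY Q₀ = margY Q := by
    refine tendsto_nhds_unique ((continuous_margY.tendsto Q₀).comp hlim) ?_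
    exact ((continuous_margY.tendsto Q).comp hu').congr fun j => ((hQ' (ψ j)).2).symm
  have h2 : info P Q₀ ≤ R := le_of_tendsto' (((continuous_info P).tendsto Q₀).comp hlim)
    fun j => hI (ψ j)
  have h3 : linLik W Q ≤ T + linLik W Q₀ := le_of_tendsto_of_tendsto'
    (((continuous_linLik W).tendsto Q).comp hu')
    ((((continuous_linLik W).tendsto Q₀).comp hlim).const_add T) fun j => hle (ψ j)
  exact absurd (h Q₀ ⟨hQ₀, h1⟩ h2) (not_lt.mpr h3)

lemma eventually_add_linLik_lt {W : X → Y → ℝ} {T : ℝ} {z : (X × Y → ℝ) × (X × Y → ℝ)}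
    {ι : Type*} {l : Filter ι} {u : ι → (X × Y → ℝ) × (X × Y → ℝ)} (hu : Tendsto u l (nhds z))
    (h : T + linLik W z.1 < linLik W z.2) :
    ∀ᶠ k in l, T + linLik W (u k).1 < linLik W (u k).2 :=
  ((((continuous_linLik W).comp continuous_fst).tendsto z |>.comp hu).const_add T).eventually_lt
    (((continuous_linLik W).comp continuous_snd).tendsto z |>.comp hu) h

/-! ### Upper bound for the list size exponent at every feasible pair -/

section UpperBound

variable {W : X → Y → ℝ} {P : X → ℝ} {R T : ℝ} {N : ℕ}

lemma listExponent_le_of_strict (hW : ∀ x y, 0 ≤ W x y)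
    (hWP : ∀ x y, 0 < P x → 0 < W x y) (hR : 0 < R) (hN : 0 < N) (hP : HasDenom N P)
    {z : (X × Y → ℝ) × (X × Y → ℝ)} (hz1 : z.1 ∈ jointDists Y P) (hz2 : z.2 ∈ jointDists Y P)
    (hm : margY z.2 = margY z.1) (hlt : T + linLik W z.1 < linLik W z.2)
    (hI : ∀ Q ∈ couplings P (margY z.2), info P Q ≤ R → T + linLik W Q < linLik W z.2) :
    listExponent W P R T ≤ listVal W P R z := by
  obtain ⟨u, hu, hu'⟩ := exists_rational_pairs hN hP hz1 hz2 hm (suppIn_of_pos hWP hz1)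
    (suppIn_of_pos hWP hz2)
  have hu2 : Tendsto (fun k => (u k).2) atTop (nhds z.2) := (continuous_snd.tendsto _).comp hu
  refine le_coe_of_tendsto (((continuous_listVal W P R).tendsto z).comp hu) ?_
  filter_upwards [hu', eventually_strict hu2 hI, eventually_add_linLik_lt hu hlt] with k
    ⟨g1, g2, g3, g4, g5, ⟨M, hM, g6, g7⟩, _⟩ hk1 hk2
  exact listExponent_le_of_hasDenom hW hWP hR hM g6 g7
    ⟨g1, g2, g3, hk2.le, fun Q hQ hQI => (hk1 Q hQ hQI).le⟩

/-- Either there are strictly feasible pairs near `z`, or all the nearby pairs with the same support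
are feasible: a pair and its reflection at `z` cannot both be infeasible, since the mutual
information is convex. -/
lemma listExponent_le_of_fst_strict (hW : ∀ x y, 0 ≤ W x y)
    (hWP : ∀ x y, 0 < P x → 0 < W x y) (hR : 0 < R) (hN : 0 < N) (hP : HasDenom N P)
    {z : (X × Y → ℝ) × (X × Y → ℝ)} (hz : ListFeasible W P R T z)
    (hlt : T + linLik W z.1 < linLik W z.2) :
    listExponent W P R T ≤ listVal W P R z := by
  set Good : (X × Y → ℝ) × (X × Y → ℝ) → Prop := fun z' => z'.1 ∈ jointDists Y P ∧
    z'.2 ∈ jointDists Y P ∧ margY z'.2 = margY z'.1 ∧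
    ∀ Q ∈ couplings P (margY z'.2), info P Q ≤ R → T + linLik W Q < linLik W z'.2 with hGood
  by_cases hfreq : ∃ᶠ z' in nhds z, Good z'
  -- Good pairs accumulate at `z`, and by continuity of the value the bound at these pairs passes to
  -- `z`.
  · by_contra hcon
    rw [not_le] at hcon
    have h1 : ∀ᶠ z' in nhds z, (listVal W P R z' : EReal) < listExponent W P R T :=
      ((continuous_coe_real_ereal.comp (continuous_listVal W P R)).tendsto z).eventually_lt_const
        hcon
    obtain ⟨z', ⟨⟨h2, h3, h4, h5⟩, h6⟩, h7⟩ := ((hfreq.and_eventually h1).and_eventually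
      (eventually_add_linLik_lt (u := id) tendsto_id hlt)).exists
    exact absurd (listExponent_le_of_strict hW hWP hR hN hP h2 h3 h4 h7 h5) (not_le.mpr h6)
  rw [not_frequently] at hfreq
  obtain ⟨u, hu, hu'⟩ := exists_rational_pairs hN hP hz.fst_mem hz.snd_mem hz.marg
    (suppIn_of_pos hWP hz.fst_mem) (suppIn_of_pos hWP hz.snd_mem)
  have hrefl : Tendsto (fun k => (2 : ℝ) • z + (-1 : ℝ) • u k) atTop (nhds z) := by
    have h1 : Tendsto (fun k => (2 : ℝ) • z + (-1 : ℝ) • u k) atTop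
        (nhds ((2 : ℝ) • z + (-1 : ℝ) • z)) := (hu.const_smul (-1 : ℝ)).const_add _
    have h2 : (2 : ℝ) • z + (-1 : ℝ) • z = z := by
      rw [← add_smul]
      norm_num
    rwa [h2] at h1
  -- The reflection 2Q - v_k is nonnegative for large `k`: positive entries survive in the limit,
  -- and `v k` vanishes wherever `Q` does.
  have hnn : ∀ (Q : X × Y → ℝ) (v : ℕ → X × Y → ℝ), Q ∈ jointDists Y P →
      Tendsto (fun k => (2 : ℝ) • Q + (-1 : ℝ) • v k) atTop (nhds Q) →
      ∀ᶠ k in atTop, (∀ s, Q s = 0 → v k s = 0) → v k ∈ jointDists Y P →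
        (2 : ℝ) • Q + (-1 : ℝ) • v k ∈ jointDists Y P := by
    intro Q v hQ hlim
    have h1 : ∀ᶠ k in atTop, ∀ s, 0 < Q s → 0 < ((2 : ℝ) • Q + (-1 : ℝ) • v k) s := by
      rw [eventually_all]
      intro s
      by_cases hs : 0 < Q s
      · exact ((tendsto_pi_nhds.mp hlim s).eventually_const_lt hs).mono fun k hk _ => hk
      · exact Eventually.of_forall fun k h => absurd h hs
    filter_upwards [h1] with k hk hsupp hv
    refine ⟨⟨fun s => ?_, ?_⟩, ?_⟩
    · rcases (hQ.1.1 s).eq_or_lt with h | h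
      · simp [← h, hsupp s h.symm]
      · exact (hk s h).le
    · simp only [Pi.add_apply, Pi.smul_apply, smul_eq_mul, Finset.sum_add_distrib,
        ← Finset.mul_sum, hQ.1.2, hv.1.2]
      norm_num
    · rw [margX_add, hQ.2, hv.2, ← add_smul]
      norm_num
  have hr1 := hnn z.1 (fun k => (u k).1) hz.fst_mem ((continuous_fst.tendsto _).comp hrefl)
  have hr2 := hnn z.2 (fun k => (u k).2) hz.snd_mem ((continuous_snd.tendsto _).comp hrefl)
  refine le_coe_of_tendsto (((continuous_listVal W P R).tendsto z).comp hu) ?_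
  filter_upwards [hu', hr1, hr2, hrefl.eventually hfreq, eventually_add_linLik_lt hu hlt] with k
    ⟨g1, g2, g3, g4, g5, ⟨M, hM, g6, g7⟩, g8, g9⟩ hk1 hk2 hk3 hk4
  refine listExponent_le_of_hasDenom hW hWP hR hM g6 g7 ⟨g1, g2, g3, hk4.le, fun Q hQ hQI => ?_⟩
  have hk3' : ∃ Q' ∈ couplings P (margY ((2 : ℝ) • z.2 + (-1 : ℝ) • (u k).2)), info P Q' ≤ R ∧
      linLik W ((2 : ℝ) • z.2 + (-1 : ℝ) • (u k).2) ≤ T + linLik W Q' := by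
    by_contra hno
    push Not at hno
    refine hk3 ⟨hk1 g8 g1, hk2 g9 g2, ?_, hno⟩
    change margY ((2 : ℝ) • z.2 + (-1 : ℝ) • (u k).2) = margY ((2 : ℝ) • z.1 + (-1 : ℝ) • (u k).1)
    rw [margY_add, margY_add, hz.marg, g3]
  obtain ⟨Q', hQ', hQ'I, hle⟩ := hk3'
  -- `Q'` witnesses that the reflected pair is not good. The midpoint with `Q` couples `P` with the
  -- second marginal of `z` and has I ≤ R; feasibility of `z` there, combined with the reverse
  -- inequality at the reflection, gives feasibility of `u k`.
  have hmid : (1 / 2 : ℝ) • Q + (1 / 2 : ℝ) • Q' ∈ couplings P (margY z.2) := by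
    refine ⟨jointDists_convex P hQ.1 hQ'.1 (by norm_num) (by norm_num) (by norm_num), ?_⟩
    rw [margY_add, hQ.2, hQ'.2, margY_add]
    funext y
    simp only [Pi.add_apply, Pi.smul_apply, smul_eq_mul]
    ring
  have h1 := hz.le_info _ hmid (info_midpoint_le hQ.1 hQ'.1 hQI hQ'I)
  rw [linLik_add] at h1 hle
  linarith

/-- A coupling with the support of an optimal coupling is optimal for its own marginals. -/
lemma linLik_le_of_support {Q Q' Q'' : X × Y → ℝ} (hQ : Q ∈ jointDists Y P)
    (hopt : ∀ Q₀ ∈ couplings P (margY Q), linLik W Q₀ ≤ linLik W Q)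
    (hQ' : Q' ∈ jointDists Y P) (hsupp : ∀ s, Q s = 0 → Q' s = 0)
    (hQ'' : Q'' ∈ couplings P (margY Q')) : linLik W Q'' ≤ linLik W Q' := by
  obtain ⟨t, ht0, ht⟩ : ∃ t : ℝ, 0 < t ∧ ∀ s, 0 < Q s → t ≤ Q s := by
    by_cases hne : (univ.filter fun s => 0 < Q s).Nonempty
    · obtain ⟨s, hs, hmin⟩ := Finset.exists_min_image _ Q hne
      exact ⟨Q s, (Finset.mem_filter.mp hs).2, fun s' hs' => hmin s' (by simpa using hs')⟩
    · rw [Finset.not_nonempty_iff_eq_empty, Finset.filter_eq_empty_iff] at hne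
      exact ⟨1, one_pos, fun s hs => absurd hs (hne (Finset.mem_univ s))⟩
  have hQ'1 : ∀ s, Q' s ≤ 1 := fun s => by
    rw [← hQ'.1.2]
    exact Finset.single_le_sum (fun s _ => hQ'.1.1 s) (Finset.mem_univ s)
  -- A feasible direction at `Q` with zero marginals: it is negative only where Q' > 0, hence where
  -- Q ≥ t, and the step t·Δ removes at most t·Q' ≤ t. Optimality of `Q` then forbids an increase of
  -- f along Δ.
  set Δ := (1 : ℝ) • Q'' + (-1 : ℝ) • Q' with hΔ
  have hmem : (1 : ℝ) • Q + t • Δ ∈ couplings P (margY Q) := by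
    refine ⟨⟨⟨fun s => ?_, ?_⟩, ?_⟩, ?_⟩
    · have h1 := hQ''.1.1.1 s
      simp only [hΔ, Pi.add_apply, Pi.smul_apply, smul_eq_mul]
      rcases (hQ.1.1 s).eq_or_lt with h | h
      · rw [← h, hsupp s h.symm]
        have := mul_nonneg ht0.le h1
        linarith
      · have h2 := ht s h
        have h3 := hQ'1 s
        nlinarith
    · simp only [hΔ, Pi.add_apply, Pi.smul_apply, smul_eq_mul, Finset.sum_add_distrib,
        ← Finset.mul_sum, hQ.1.2, hQ''.1.1.2, hQ'.1.2]
      ring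
    · rw [margX_add, hΔ, margX_add, hQ.2, hQ''.1.2, hQ'.2]
      simp
    · rw [margY_add, hΔ, margY_add, hQ''.2]
      simp
  have h1 := hopt _ hmem
  rw [linLik_add, hΔ, linLik_add] at h1
  have h2 : t * (linLik W Q'' - linLik W Q') ≤ 0 := by linarith
  have h3 := nonpos_of_mul_nonpos_right h2 ht0
  linarith

lemma listExponent_le_of_feasible (hW : ∀ x y, 0 ≤ W x y)
    (hWP : ∀ x y, 0 < P x → 0 < W x y) (hR : 0 < R) (hN : 0 < N) (hP : HasDenom N P)
    {z : (X × Y → ℝ) × (X × Y → ℝ)} (hz : ListFeasible W P R T z) :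
    listExponent W P R T ≤ listVal W P R z := by
  have hPs : P ∈ stdSimplex ℝ X := hz.snd_mem.2 ▸ margX_mem hz.snd_mem.1
  have hqs : margY z.2 ∈ stdSimplex ℝ Y := margY_mem hz.snd_mem.1
  have hzc : z.2 ∈ couplings P (margY z.2) := ⟨hz.snd_mem, rfl⟩
  rcases le_or_gt T 0 with hT | hT
  · by_cases hex : ∃ Q ∈ couplings P (margY z.2), linLik W z.2 < linLik W Q
    · obtain ⟨Q, hQ, hlt⟩ := hex
      -- Moving the second component towards a coupling of larger f keeps the marginals and makes
      -- all the constraints strict.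
      refine le_coe_of_tendsto (((continuous_listVal W P R).tendsto z).comp
        (tendsto_segment z (z.1, Q))) (Eventually.of_forall fun k => ?_)
      obtain ⟨hk0, hk1⟩ := one_div_succ_bounds k
      set ε := 1 / ((k : ℝ) + 1)
      have hmem := couplings_convex hzc hQ (sub_nonneg.mpr hk1) hk0.le (by ring)
      have hgt : linLik W z.2 < linLik W ((1 - ε) • z.2 + ε • Q) := by
        rw [linLik_add]
        nlinarith
      have h1 : (1 - ε) • z + ε • (z.1, Q) = (z.1, (1 - ε) • z.2 + ε • Q) := by
        refine Prod.ext ?_ rfl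
        change (1 - ε) • z.1 + ε • z.1 = z.1
        rw [← add_smul]
        simp
      change _ ≤ ((listVal W P R ((1 - ε) • z + ε • (z.1, Q)) : ℝ) : EReal)
      rw [h1]
      refine listExponent_le_of_strict hW hWP hR hN hP hz.fst_mem hmem.1
        (hmem.2.trans hz.marg) (hz.le_fst.trans_lt hgt) fun Q' hQ' hI => ?_
      rw [hmem.2] at hQ'
      exact (hz.le_info Q' hQ' hI).trans_lt hgt
    · push Not at hex
      -- Here `z.2` is optimal among the couplings of its marginals. Its rational approximants have
      -- no larger support, so they are optimal too; as T ≤ 0, they are feasible.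
      obtain ⟨u, hu, hu'⟩ := exists_rational_pairs hN hP hz.fst_mem hz.snd_mem hz.marg
        (suppIn_of_pos hWP hz.fst_mem) (suppIn_of_pos hWP hz.snd_mem)
      refine le_coe_of_tendsto (((continuous_listVal W P R).tendsto z).comp hu) ?_
      filter_upwards [hu'] with k ⟨g1, g2, g3, g4, g5, ⟨M, hM, g6, g7⟩, _, g9⟩
      have hopt : ∀ Q ∈ couplings P (margY (u k).2), linLik W Q ≤ linLik W (u k).2 :=
        fun Q hQ => linLik_le_of_support hz.snd_mem hex g2 g9 hQ
      refine listExponent_le_of_hasDenom hW hWP hR hM g6 g7 ⟨g1, g2, g3, ?_, fun Q hQ _ => ?_⟩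
      · linarith [hopt (u k).1 ⟨g1, g3.symm⟩]
      · linarith [hopt Q hQ]
  · rcases hz.le_fst.lt_or_eq with hlt | heq
    · exact listExponent_le_of_fst_strict hW hWP hR hN hP hz hlt
    -- If `z.1` were minimal, the product distribution, with I = 0 < R, would have f at least
    -- f(z.1). A small mixture with `z.2`, where f = f(z.1) + T, would keep I ≤ R and raise f above
    -- f(z.1), contradicting `le_info`. Lowering f of the first component then reduces to the strict
    -- case.
    obtain ⟨Q, hQ, hlt⟩ : ∃ Q ∈ couplings P (margY z.2), linLik W Q < linLik W z.1 := by
      by_contra hno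
      push Not at hno
      have hprod := prodDist_mem hPs hqs
      have hlim := tendsto_segment (prodDist P (margY z.2)) z.2
      have h0 : info P (prodDist P (margY z.2)) < R := by rwa [info_prodDist hPs hqs]
      obtain ⟨k, hk⟩ :=
        ((((continuous_info P).tendsto _).comp hlim).eventually_lt_const h0).exists
      obtain ⟨hk0, hk1⟩ := one_div_succ_bounds k
      have h1 := hz.le_info _ (couplings_convex hprod hzc (sub_nonneg.mpr hk1) hk0.le (by ring))
        hk.le
      have h2 := hno _ hprod
      rw [linLik_add] at h1
      nlinarith
    refine le_coe_of_tendsto (((continuous_listVal W P R).tendsto z).comp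
      (tendsto_segment z (Q, z.2))) (Eventually.of_forall fun k => ?_)
    obtain ⟨hk0, hk1⟩ := one_div_succ_bounds k
    set ε := 1 / ((k : ℝ) + 1)
    have hz1c : z.1 ∈ couplings P (margY z.2) := ⟨hz.fst_mem, hz.marg.symm⟩
    have hmem := couplings_convex hz1c hQ (sub_nonneg.mpr hk1) hk0.le (by ring)
    have h1 : (1 - ε) • z + ε • (Q, z.2) = ((1 - ε) • z.1 + ε • Q, z.2) := by
      refine Prod.ext rfl ?_
      change (1 - ε) • z.2 + ε • z.2 = z.2
      rw [← add_smul]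
      simp
    change _ ≤ ((listVal W P R ((1 - ε) • z + ε • (Q, z.2)) : ℝ) : EReal)
    rw [h1]
    have h2 : T + linLik W ((1 - ε) • z.1 + ε • Q) < linLik W z.2 := by
      rw [linLik_add]
      nlinarith
    exact listExponent_le_of_fst_strict hW hWP hR hN hP
      ⟨hmem.1, hz.snd_mem, hmem.2.symm, h2.le, hz.le_info⟩ h2

end UpperBound

end ListExponent

/-! ### The formula for the list size exponent: limits of dominant pairs -/

section ListExponentFormula

variable {X Y : Type*} [Fintype X] [Fintype Y] [DecidableEq X] [DecidableEq Y]

/-- A doubly exponentially small factor cannot be compensated by an exponential one. -/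
lemma false_of_double_exp {m : ℕ → ℕ} (hm : Tendsto m atTop atTop) {η c κ : ℝ} (hη : 0 < η)
    {d : ℕ → ℝ} (hd : Tendsto d atTop (nhds c))
    (h : ∀ᶠ j in atTop, (1 / 2) * Real.exp (2 * η * m j - κ * slack (m j)) ≤ m j * d j) :
    False := by
  have h1 := ((tendsto_const_mul_slack_div κ).comp hm).eventually_lt_const hη
  have h2 : Tendsto (fun j => (m j : ℝ)) atTop atTop := tendsto_natCast_atTop_atTop.comp hm
  have h3 := h2.eventually_gt_atTop (4 * (c + 1) / η ^ 2)
  have h4 := hd.eventually_lt_const (lt_add_one c)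
  obtain ⟨j, hj, hj1, hj3, hj4, hj5⟩ := (h.and (h1.and (h3.and (h4.and
    (hm.eventually_gt_atTop 0))))).exists
  have hpos : (0 : ℝ) < m j := by exact_mod_cast hj5
  simp only [Function.comp] at hj1
  rw [div_lt_iff₀ hpos] at hj1
  have h5 : Real.exp (η * m j) ≤ Real.exp (2 * η * m j - κ * slack (m j)) :=
    Real.exp_le_exp.mpr (by linarith)
  -- Half of the growth e^{2ηm} absorbs the polynomial factor; a quadratic lower bound for the rest
  -- already exceeds the linear right side.
  have h6 := Real.quadratic_le_exp_of_nonneg (x := η * m j) (by positivity)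
  rw [div_lt_iff₀ (by positivity)] at hj3
  have h7 : 0 < η * m j := by positivity
  have h8 : (m j : ℝ) * d j < m j * (c + 1) := mul_lt_mul_of_pos_left hj4 hpos
  have h9 : (m j : ℝ) * (4 * (c + 1)) < m j * (m j * η ^ 2) := mul_lt_mul_of_pos_left hj3 hpos
  nlinarith

/-- A coupling with `I ≤ R` can be replaced by one with `I < R`. -/
lemma exists_info_lt {W : X → Y → ℝ} {P : X → ℝ} {q : Y → ℝ} (hP : P ∈ stdSimplex ℝ X)
    (hq : q ∈ stdSimplex ℝ Y) {R v : ℝ} (hR : 0 < R) {Q : X × Y → ℝ} (hQ : Q ∈ couplings P q)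
    (hI : info P Q ≤ R) (hv : v < linLik W Q) :
    ∃ Q' ∈ couplings P q, info P Q' < R ∧ v < linLik W Q' := by
  have hprod := prodDist_mem hP hq
  obtain ⟨k, hk⟩ := ((((continuous_linLik W).tendsto _).comp
    (tendsto_segment Q (prodDist P q))).eventually_const_lt hv).exists
  obtain ⟨hk0, hk1⟩ := one_div_succ_bounds k
  refine ⟨_, couplings_convex hQ hprod (sub_nonneg.mpr hk1) hk0.le (by ring), ?_, hk⟩
  have h1 := info_mix_le hQ hprod hk0.le hk1
  rw [info_prodDist hP hq] at h1
  nlinarith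

/-- Without the weight, the bound for the list size gives the value of the limit pair. The weight
gives its feasibility: an infeasible limit would have near it, for each large `j`, a joint type with
I < R beating the threshold, and the average would decay doubly exponentially. -/
lemma exists_feasible_of_frequently {W : X → Y → ℝ} (hW : ∀ x y, 0 ≤ W x y) {P : X → ℝ}
    (hWP : ∀ x y, 0 < P x → 0 < W x y) {R T : ℝ} (hR : 0 < R) {c : ℕ → ℝ} {c₀ : ℝ}
    (hc : Tendsto c atTop (nhds c₀))
    (hfreq : ∀ j, ∃ᶠ n in atTop, (typeClass P n).Nonempty ∧ 0 < n ∧ Real.exp (-(n * c j)) <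
      codeAvg P n (codeSize R n) fun C => listSize W C (decRegion W T C)) :
    ∃ z, ListFeasible W P R T z ∧ listVal W P R z ≤ c₀ := by
  obtain ⟨φ, hφ, hφ'⟩ := extraction_forall_of_frequently hfreq
  have hex : ∀ j, ∃ x ∈ typeClass P (φ j), ∃ x' ∈ typeClass P (φ j), ∃ y : Fin (φ j) → Y,
      (T : EReal) + logLik W (empJoint x y) ≤ logLik W (empJoint x' y) ∧
      Real.exp (-(φ j * c j)) ≤
        Real.exp (-(φ j * listVal W P R (empJoint x y, empJoint x' y)) +
          4 * slackC X Y * slack (φ j)) * okFrac W P T x' y ^ (codeSize R (φ j) - 2) := by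
    intro j
    obtain ⟨hT, hn, hlt⟩ := hφ' j
    obtain ⟨x, hx, x', hx', y, hl, hle⟩ := listAvg_le hW hR hn hT ((Real.exp_pos _).trans hlt)
    exact ⟨x, hx, x', hx', y, hl, hlt.le.trans hle⟩
  choose x hx x' hx' y hl hbound using hex
  have hn : ∀ j, 0 < φ j := fun j => (hφ' j).2.1
  have hT : ∀ j, (typeClass P (φ j)).Nonempty := fun j => (hφ' j).1
  set z : ℕ → (X × Y → ℝ) × (X × Y → ℝ) := fun j => (empJoint (x j) (y j), empJoint (x' j) (y j))
    with hz
  have hz1 : ∀ j, (z j).1 ∈ jointDists Y P := fun j => empJoint_mem (hn j) (hx j) _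
  have hz2 : ∀ j, (z j).2 ∈ jointDists Y P := fun j => empJoint_mem (hn j) (hx' j) _
  have hz3 : ∀ j, T + linLik W (z j).1 ≤ linLik W (z j).2 := fun j =>
    (add_logLik_le_iff hWP (hz1 j) (hz2 j) T).mp (hl j)
  obtain ⟨Qt, hQt, Q, hQ, hm, ψ, hψ, hlim⟩ := exists_limit_pair hz1 hz2
    (fun j => by simp only [hz, margY_empJoint])
  have hlim2 : Tendsto (fun j => (z (ψ j)).2) atTop (nhds Q) :=
    (continuous_snd.tendsto (Qt, Q)).comp hlim
  have hle : T + linLik W Qt ≤ linLik W Q := le_of_tendsto_of_tendsto'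
    (((((continuous_linLik W).comp continuous_fst).tendsto (Qt, Q)).comp hlim).const_add T)
    (((continuous_linLik W).tendsto Q).comp hlim2) fun j => hz3 (ψ j)
  have hcψ : Tendsto (fun j => c (ψ j)) atTop (nhds c₀) := hc.comp hψ.tendsto_atTop
  have hφψ : Tendsto (fun j => φ (ψ j)) atTop atTop := hφ.tendsto_atTop.comp hψ.tendsto_atTop
  have hvlim : Tendsto (fun j => listVal W P R (z (ψ j))) atTop (nhds (listVal W P R (Qt, Q))) :=
    ((continuous_listVal W P R).tendsto (Qt, Q)).comp hlim
  have hslim : Tendsto (fun j => 4 * slackC X Y * slack (φ (ψ j)) / φ (ψ j)) atTop (nhds 0) :=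
    (tendsto_const_mul_slack_div (4 * slackC X Y)).comp hφψ
  refine ⟨(Qt, Q), ⟨hQt, hQ, hm, hle, fun Q₁ hQ₁ hI₁ => ?_⟩, ?_⟩
  · by_contra hlt
    rw [not_le] at hlt
    have hPs : P ∈ stdSimplex ℝ X := hQ.2 ▸ margX_mem hQ.1
    -- The violation may occur at I = R; mixing with the product distribution gives a margin below
    -- `R`, which makes Mp exponentially large.
    obtain ⟨Q', hQ', hI, hgt⟩ := exists_info_lt hPs (margY_mem hQ.1) hR hQ₁ hI₁
      (show linLik W Q - T < linLik W Q₁ by linarith)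
    obtain ⟨v, hv1, hv2⟩ := exists_between hgt
    set η := (R - info P Q') / 4 with hη
    have hη0 : 0 < η := by rw [hη]; linarith
    have hU : {S : X × Y → ℝ | info P S < R - 2 * η ∧ v < linLik W S} ∈ nhds Q' :=
      (((continuous_info P).tendsto Q').eventually_lt_const
        (show info P Q' < R - 2 * η by linarith)).and
      (((continuous_linLik W).tendsto Q').eventually_const_lt hv2)
    have hy : Tendsto (fun j => empDist (y (ψ j))) atTop (nhds (margY Q)) :=
      ((continuous_margY.tendsto Q).comp hlim2).congr fun j => by
        simp only [Function.comp, hz, margY_empJoint]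
    -- The outputs are given and their types only converge to the marginal of `Q`, so the violating
    -- coupling has to be rounded to a joint type with each particular output.
    have hev := eventually_exists_empJoint_mem hQ' hφψ (fun j => hT (ψ j)) hy hU
    have hev2 : ∀ᶠ j in atTop, linLik W (z (ψ j)).2 - T < v :=
      ((((continuous_linLik W).tendsto Q).comp hlim2).sub_const T).eventually_lt_const hv1
    have hbig : ∀ᶠ j in atTop, 4 ≤ Real.exp (φ (ψ j) * R) := by
      have h1 : Tendsto (fun j => Real.exp (φ (ψ j) * R)) atTop atTop :=
        Real.tendsto_exp_atTop.comp
          ((tendsto_natCast_atTop_atTop.comp hφψ).atTop_mul_const hR)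
      exact h1.eventually_ge_atTop 4
    refine false_of_double_exp hφψ (κ := slackC X Y) hη0
      ((hcψ.sub hvlim).add hslim) ?_
    filter_upwards [hev, hev2, hbig] with j ⟨w, hw, hwI, hwv⟩ hj2 hj3
    have hn0 : (0 : ℝ) < φ (ψ j) := by exact_mod_cast hn (ψ j)
    have hbad : ¬ (T : EReal) + logLik W (empJoint w (y (ψ j))) ≤
        logLik W (empJoint (x' (ψ j)) (y (ψ j))) := by
      rw [add_logLik_le_iff hWP (empJoint_mem (hn _) hw _) (hz2 (ψ j)), not_le]
      linarith
    have h1 := okFrac_pow_le hR (hn (ψ j)) hw hbad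
    have h2 := (hbound (ψ j)).trans (mul_le_mul_of_nonneg_left h1 (Real.exp_pos _).le)
    rw [← Real.exp_add, Real.exp_le_exp] at h2
    have h3 : (1 / 2) * Real.exp (2 * η * φ (ψ j) - slackC X Y * slack (φ (ψ j))) ≤
        (Real.exp (φ (ψ j) * R) - 2) * Real.exp (-(φ (ψ j) * info P (empJoint w (y (ψ j)))) -
          slackC X Y * slack (φ (ψ j))) := by
      calc _ ≤ (1 / 2) * (Real.exp (φ (ψ j) * R) *
            Real.exp (-(φ (ψ j) * info P (empJoint w (y (ψ j)))) -
              slackC X Y * slack (φ (ψ j)))) := by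
            rw [← Real.exp_add]
            refine mul_le_mul_of_nonneg_left (Real.exp_le_exp.mpr ?_) (by norm_num)
            have := mul_le_mul_of_nonneg_left hwI.le hn0.le
            linarith
        _ = (Real.exp (φ (ψ j) * R) / 2) *
            Real.exp (-(φ (ψ j) * info P (empJoint w (y (ψ j)))) -
              slackC X Y * slack (φ (ψ j))) := by ring
        _ ≤ _ := mul_le_mul_of_nonneg_right (by linarith) (Real.exp_pos _).le
    have h4 : (φ (ψ j) : ℝ) * (c (ψ j) - listVal W P R (z (ψ j)) +
        4 * slackC X Y * slack (φ (ψ j)) / φ (ψ j)) =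
        φ (ψ j) * c (ψ j) - φ (ψ j) * listVal W P R (z (ψ j)) +
        4 * slackC X Y * slack (φ (ψ j)) := by
      field_simp
    rw [h4]
    simp only [hz] at h2 ⊢
    linarith
  · refine le_of_tendsto_of_tendsto' hvlim (by simpa using hcψ.add hslim) fun j => ?_
    have hn0 : (0 : ℝ) < φ (ψ j) := by exact_mod_cast hn (ψ j)
    have h1 : okFrac W P T (x' (ψ j)) (y (ψ j)) ^ (codeSize R (φ (ψ j)) - 2) ≤ 1 :=
      pow_le_one₀ (okFrac_nonneg _ _ _ _ _) (okFrac_le_one W P T (hT _) _ _)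
    have h2 := (hbound (ψ j)).trans (mul_le_of_le_one_right (Real.exp_pos _).le h1)
    rw [Real.exp_le_exp] at h2
    rw [← sub_le_iff_le_add', le_div_iff₀ hn0]
    simp only [hz]
    linarith

theorem isMinOrTop_listExponent {W : X → Y → ℝ} (hW : ∀ x y, 0 ≤ W x y) {P : X → ℝ}
    (hWP : ∀ x y, 0 < P x → 0 < W x y) {R T : ℝ} (hR : 0 < R) {N : ℕ} (hN : 0 < N)
    (hP : HasDenom N P) :
    IsMinOrTop (listValues W P R T) (listExponent W P R T) := by
  have hval : ∀ {Qt Q : X × Y → ℝ}, Qt ∈ jointDists Y P → Q ∈ jointDists Y P →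
      condDiv W Qt + ((mutualInfo Q - R : ℝ) : EReal) = (listVal W P R (Qt, Q) : ℝ) := by
    intro Qt Q hQt hQ
    rw [condDiv_of_suppIn hQt (suppIn_of_pos hWP hQt), mutualInfo_eq hQ, ← EReal.coe_add]
    rfl
  refine isMinOrTop_expRate ?_ ?_ ?_
  · rintro v ⟨Qt, hQt, Q, hQ, rfl⟩
    rw [mem_listSet_iff hWP hQt] at hQ
    rw [hval hQt hQ.snd_mem]
    exact listExponent_le_of_feasible hW hWP hR hN hP hQ
  · intro c c₀ hc hfreq
    obtain ⟨⟨Qt, Q⟩, hz, hle⟩ := exists_feasible_of_frequently hW hWP hR hc hfreq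
    refine ⟨_, ⟨Qt, hz.fst_mem, Q, (mem_listSet_iff hWP hz.fst_mem).mpr hz, rfl⟩, ?_⟩
    rw [hval hz.fst_mem hz.snd_mem]
    exact EReal.coe_le_coe_iff.mpr hle
  · obtain ⟨B, hB⟩ :=
      ((isCompact_jointDists (Y := Y) P).prod (isCompact_jointDists (Y := Y) P)).bddBelow_image
        (continuous_listVal W P R).continuousOn
    refine ⟨B, ?_⟩
    rintro v ⟨Qt, hQt, Q, hQ, rfl⟩
    rw [mem_listSet_iff hWP hQt] at hQ
    rw [hval hQt hQ.snd_mem]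
    exact EReal.coe_le_coe_iff.mpr (hB (Set.mem_image_of_mem _ ⟨hQt, hQ.snd_mem⟩))

end ListExponentFormula

end ErasureList

/-! ### The two formulas together -/

theorem corollary2 {X Y : Type*} [Fintype X] [Fintype Y] [DecidableEq X] [DecidableEq Y]
    (W : X → Y → ℝ) (hW : ∀ x, W x ∈ stdSimplex ℝ Y)
    (P : X → ℝ) (hP : ∃ n : ℕ, 0 < n ∧ (ErasureList.typeClass P n).Nonempty)
    (R : ℝ) (hR : 0 < R) (T : ℝ) :
    (¬ IsLeast (ErasureList.logLikGaps W P) T →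
      ErasureList.IsMinOrTop (ErasureList.errorValues W P R T) (ErasureList.errorExponent W P R T)) ∧
    ((∀ x y, 0 < P x → 0 < W x y) →
      ErasureList.IsMinOrTop (ErasureList.listValues W P R T) (ErasureList.listExponent W P R T)) := by
  obtain ⟨N, hN, hne⟩ := hP
  have hd := ErasureList.hasDenom_of_typeClass hN hne
  exact ⟨ErasureList.isMinOrTop_errorExponent (fun x y => (hW x).1 y) hR hN hd,
    fun hWP => ErasureList.isMinOrTop_listExponent (fun x y => (hW x).1 y) hWP hR hN hd⟩
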